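/- **Setting.** For a bipartite (multi)graph $H$ with parts $V^1,V^2$, the intersection graph $G(H)$ is the simple graph on $V^1$ in which distinct $u,v$ are adjacent iff they have a common neighbour in $V^2$ in $H$. For a law $D$ on $\{0,1,2,\dots\}$ with $0<\mathbb E D<\infty$, let $D^*$ be its size-biased version, $\mathbb P(D^*=j)=j\,\mathbb P(D=j)/\mathbb E D$. For random variables $D_1,D_2$ on $\{0,1,2,\dots\}$ with means in $(0,\infty)$, let $\mathcal T(D_1,D_2)$ be the random rooted tree in which all numbers of children are independent, the root has $D_1$ children, each node in an odd generation has $D_2^*-1$ children, and each node in an even generation $\ge 2$ has $D_1^*-1$ children. View $\mathcal T$ as a bipartite graph, with part 1 the even and part 2 the odd generations, and let $d^*$ be the degree of the root in the intersection graph of $\mathcal T(D_1,D_2)$. Write $\mathrm{Po}(X)$ for the mixed Poisson law with $\mathbb P(j)=\mathbb E\,e^{-X}X^j/j!$. Let $n_1=n_1(n)$ and $n_2=n_2(n)$ be sequences of positive integers with $n_1,n_2\to\infty$ and $n_2/n_1\to\beta\in(0,\infty)$. Let $H_n$ be a random bipartite (multi)graph with parts $V^1,V^2$ of sizes $n_1,n_2$,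 let $G_n=G(H_n)$, let $d_n$ be the degree in $G_n$ of a uniformly random vertex of $V^1$, and let $X^{(i)}$ be the degree in $H_n$ of a uniformly random vertex of $V^i$. Let $k\ge1$ be an integer. **Statement.** Suppose that one of the following holds. 1. (Active.) Each $v\in V^1$ independently draws a size from a distribution $P_n$ on $\{0,\dots,n_2\}$ and then takes as its neighbourhood in $H_n$ a uniformly random subset of $V^2$ of that size. There is $D_1$ with $\mathbb E D_1\in(0,\infty)$, $X^{(1)}\to D_1$ in distribution, $\mathbb E X^{(1)}\to\mathbb E D_1$ and $\mathbb E(X^{(1)})^k\to\mathbb E D_1^k<\infty$. Here $D_2\sim\mathrm{Po}(\beta^{-1}\mathbb E D_1)$. 2. (Passive.) Each $w\in V^2$ independently draws a size from a distribution $P_n$ on $\{0,\dots,n_1\}$ and then takes as its neighbourhood in $H_n$ a uniformly random subset of $V^1$ of that size. There is $D_2$ with $\mathbb E D_2\in(0,\infty)$, $X^{(2)}\to D_2$ in distribution, $\mathbb E X^{(2)}\to\mathbb E D_2$ and $\mathbb E(X^{(2)})^{k+1}\to\mathbb E D_2^{k+1}<\infty$. Here $D_1\sim\mathrm{Po}(\beta\,\mathbb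 E D_2)$. 3. (Inhomogeneous.) The vertices $v\in V^1$ and $w\in V^2$ get independent non-negative random weights $\xi^{(1)}_v\sim\xi^{(1)}$, $\xi^{(2)}_w\sim\xi^{(2)}$, where the laws of $\xi^{(1)},\xi^{(2)}$ do not depend on $n$ and have means in $(0,\infty)$; given the weights, the edges $vw$ appear in $H_n$ independently with probabilities $\min\bigl(\xi^{(1)}_v\xi^{(2)}_w/\sqrt{n_1n_2},\,1\bigr)$. Moreover $\mathbb E(\xi^{(1)})^k<\infty$ and $\mathbb E(\xi^{(2)})^{k+1}<\infty$. Here $D_1\sim\mathrm{Po}(\beta^{1/2}\xi^{(1)}\,\mathbb E\xi^{(2)})$ and $D_2\sim\mathrm{Po}(\beta^{-1/2}\xi^{(2)}\,\mathbb E\xi^{(1)})$. 4. (Configuration.) $d_1=(d_{1,j})_{j\le n_1}$ and $d_2=(d_{2,j})_{j\le n_2}$ are random sequences of non-negative integers with $N=\sum_jd_{1,j}=\sum_jd_{2,j}$; given them, the $j$-th vertex of part $i$ gets $d_{i,j}$ half-edges, and $H_n$ is the multigraph given by a uniformly random perfect matching of the half-edges of part 1 with those of part 2. There are $D_1,D_2$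 on $\{0,1,2,\dots\}$ with means in $(0,\infty)$ such that for $i=1,2$: $N/n_i\to\mathbb E D_i$ in probability and, for each $j\ge1$, $n_i^{-1}|\{l:d_{i,l}=j\}|\to\mathbb P(D_i=j)$ in probability. Moreover $\mathbb E D_1^k<\infty$, $\mathbb E D_2^{k+1}<\infty$, and there is a sequence $f_n\to0$ with $$\mathbb P\Bigl(\Bigl|\mathbb E D_i^m-n_i^{-1}\sum_{j=1}^{n_i}d_{i,j}^m\Bigr|>f_n\Bigr)=o(n_1^{-2k}),\qquad i=1,2,\quad m=1,\dots,k+i-1.$$ Then $\mathbb E(d^*)^k<\infty$ and $\mathbb E d_n^k\to\mathbb E(d^*)^k$ as $n\to\infty$. -/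

import Mathlib

open MeasureTheory ProbabilityTheory Filter Topology Asymptotics
open scoped ENNReal NNReal

noncomputable section

namespace RIG

/-! ### Bipartite graphs and intersection graphs -/

/-- A bipartite graph with parts `V` and `W`, given by its incidence relation. -/
abbrev BipGraph (V W : Type*) := V → W → Prop

/-- The intersection graph of a bipartite graph: distinct `u v : V` are adjacent iff they have a
common neighbour in `W`. -/
def intersectionGraph {V W : Type*} (H : BipGraph V W) : SimpleGraph V where
  Adj u v := u ≠ v ∧ ∃ w, H u w ∧ H v w
  symm := ⟨fun _ _ h => ⟨h.1.symm, h.2.imp fun _ hw => hw.symm⟩⟩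
  loopless := ⟨fun _ h => h.1 rfl⟩

/-- The degree of a vertex of the intersection graph. -/
def ideg {V W : Type*} (H : BipGraph V W) (v : V) : ℕ∞ :=
  ((intersectionGraph H).neighborSet v).encard

/-! ### Moments, Poisson mixtures and size-biased laws -/

/-- `E Z ^ k` for a random variable `Z` with law `D` on `ℕ`. -/
def natMoment (D : Measure ℕ) (k : ℕ) : ℝ≥0∞ := ∫⁻ x, (x : ℝ≥0∞) ^ k ∂D

/-- `E ξ ^ k` for a non-negative random variable `ξ` with law `ν`. -/
def weightMoment (ν : Measure ℝ≥0) (k : ℕ) : ℝ≥0∞ := ∫⁻ x, (x : ℝ≥0∞) ^ k ∂ν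

/-- The mixed Poisson law: mass `E (exp (-X) * X ^ j / j!)` at `j`, where `X` has law `ν`. -/
def mixedPoisson (ν : Measure ℝ≥0) : Measure ℕ :=
  Measure.sum fun j : ℕ =>
    (∫⁻ x, ENNReal.ofReal (Real.exp (-x) * (x : ℝ) ^ j / (j.factorial : ℝ)) ∂ν) • Measure.dirac j

/-- The size-biased law `D^*(A) = (E Z)⁻¹ ∫_A t dD(t)`, where `Z` has law `D`. -/
def sizeBiased (D : Measure ℕ) : Measure ℕ :=
  (natMoment D 1)⁻¹ • D.withDensity fun x => (x : ℝ≥0∞)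

/-! ### The two-type Galton-Watson tree and the uncorrelated random clique tree

Nodes are labelled by lists of natural numbers: the root is `[]`, the children of `u` are
`0 :: u, 1 :: u, …`, and the generation of `u` is its length. -/

/-- `InTree N u`: the node `u` belongs to the tree in which `u` has `N u` children. -/
def InTree (N : List ℕ → ℕ) : List ℕ → Prop
  | [] => True
  | i :: u => InTree N u ∧ i < N u

/-- The nodes in even generations. -/
abbrev EvenNode (N : List ℕ → ℕ) := {u : List ℕ // InTree N u ∧ Even u.length}

/-- The nodes in odd generations. -/
abbrev OddNode (N : List ℕ → ℕ) := {u : List ℕ // InTree N u ∧ Odd u.length}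

/-- The tree as a bipartite graph: edges join a node and its offspring. -/
def treeGraph (N : List ℕ → ℕ) : BipGraph (EvenNode N) (OddNode N) :=
  fun u w => ∃ i : ℕ, w.1 = i :: u.1 ∨ u.1 = i :: w.1

/-- The root of the tree. -/
def treeRoot (N : List ℕ → ℕ) : EvenNode N := ⟨[], trivial, Even.zero⟩

/-- The law of the number of children of `u`: `D₁` for the root, `D₂^* - 1` in odd generations
and `D₁^* - 1` in the other even generations. -/
def offspringLaw (D₁ D₂ : Measure ℕ) (u : List ℕ) : Measure ℕ :=
  if u = [] then D₁
  else if Odd u.length then (sizeBiased D₂).map fun x => x - 1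
  else (sizeBiased D₁).map fun x => x - 1

/-- The law of the tree `𝒯(D₁, D₂)`: independent offspring numbers. -/
def treeLaw (D₁ D₂ : Measure ℕ) : Measure (List ℕ → ℕ) :=
  Measure.infinitePi (offspringLaw D₁ D₂)

/-- `E (d^*) ^ k`, with `d^*` the degree of the root in the intersection graph of `𝒯(D₁, D₂)`. -/
def limitDegreeMoment (D₁ D₂ : Measure ℕ) (k : ℕ) : ℝ≥0∞ :=
  ∫⁻ N, (ideg (treeGraph N) (treeRoot N) : ℝ≥0∞) ^ k ∂(treeLaw D₁ D₂)

/-! ### Random bipartite graphs and their degrees -/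

/-- The law of a random bipartite graph together with an independent uniform vertex of part 1. -/
def withVertex₁ {n₁ n₂ : ℕ} [NeZero n₁] (μ : Measure (BipGraph (Fin n₁) (Fin n₂))) :
    Measure (BipGraph (Fin n₁) (Fin n₂) × Fin n₁) :=
  μ.prod (PMF.uniformOfFintype (Fin n₁)).toMeasure

/-- The law of a random bipartite graph together with an independent uniform vertex of part 2. -/
def withVertex₂ {n₁ n₂ : ℕ} [NeZero n₂] (μ : Measure (BipGraph (Fin n₁) (Fin n₂))) :
    Measure (BipGraph (Fin n₁) (Fin n₂) × Fin n₂) :=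
  μ.prod (PMF.uniformOfFintype (Fin n₂)).toMeasure

instance {n₁ n₂ : ℕ} [NeZero n₁] (μ : Measure (BipGraph (Fin n₁) (Fin n₂)))
    [IsProbabilityMeasure μ] : IsProbabilityMeasure (withVertex₁ μ) := by
  unfold withVertex₁; infer_instance

instance {n₁ n₂ : ℕ} [NeZero n₂] (μ : Measure (BipGraph (Fin n₁) (Fin n₂)))
    [IsProbabilityMeasure μ] : IsProbabilityMeasure (withVertex₂ μ) := by
  unfold withVertex₂; infer_instance

/-- `X⁽¹⁾`: the degree in the bipartite graph of the chosen vertex of part 1. -/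
def X₁ {n₁ n₂ : ℕ} (p : BipGraph (Fin n₁) (Fin n₂) × Fin n₁) : ℕ := {w | p.1 p.2 w}.ncard

/-- `X⁽²⁾`: the degree in the bipartite graph of the chosen vertex of part 2. -/
def X₂ {n₁ n₂ : ℕ} (p : BipGraph (Fin n₁) (Fin n₂) × Fin n₂) : ℕ := {v | p.1 v p.2}.ncard

/-- `E (d_n) ^ k`, with `d_n` the degree of a uniformly random vertex of the intersection graph. -/
def degreeMoment {n₁ n₂ : ℕ} [NeZero n₁] (μ : Measure (BipGraph (Fin n₁) (Fin n₂))) (k : ℕ) :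
    ℝ≥0∞ :=
  ∫⁻ p, (ideg p.1 p.2 : ℝ≥0∞) ^ k ∂(withVertex₁ μ)

/-! ### The active and the passive model -/

/-- A random subset of `Fin m` (as a predicate): its size is drawn from `P`, and given the size
the set is uniform. -/
def randomSubset {m : ℕ} (P : PMF (Fin (m + 1))) : PMF (Fin m → Prop) :=
  P.bind fun x =>
    (PMF.uniformOfFinset (Finset.powersetCard (x : ℕ) (Finset.univ : Finset (Fin m)))
      (Finset.powersetCard_nonempty.2 (by simpa using Nat.lt_succ_iff.1 x.2))).map
      fun S w => w ∈ S

/-- The active model: the vertices of part 1 independently choose their neighbourhoods. -/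
def activeLaw (n₁ n₂ : ℕ) (P : PMF (Fin (n₂ + 1))) : Measure (BipGraph (Fin n₁) (Fin n₂)) :=
  Measure.pi fun _ : Fin n₁ => (randomSubset P).toMeasure

/-- The passive model: the vertices of part 2 independently choose their neighbourhoods. -/
def passiveLaw (n₁ n₂ : ℕ) (P : PMF (Fin (n₁ + 1))) : Measure (BipGraph (Fin n₁) (Fin n₂)) :=
  (Measure.pi fun _ : Fin n₂ => (randomSubset P).toMeasure).map fun S v w => S w v

/-! ### The inhomogeneous model -/

/-- The edge probability `min (x y / √(n₁ n₂)) 1`. -/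
def edgeProb (n₁ n₂ : ℕ) (x y : ℝ≥0) : unitInterval :=
  ⟨min ((x : ℝ) * y / √((n₁ : ℝ) * n₂)) 1, by positivity, min_le_right _ _⟩

/-- Independent edges with the above probabilities, given the weights of the vertices. -/
def inhomogGiven {n₁ n₂ : ℕ} (p : (Fin n₁ → ℝ≥0) × (Fin n₂ → ℝ≥0)) :
    Measure (BipGraph (Fin n₁) (Fin n₂)) :=
  Measure.pi fun v => Measure.pi fun w =>
    bernoulliMeasure True False (edgeProb n₁ n₂ (p.1 v) (p.2 w))

/-- The inhomogeneous model: all weights are independent, with law `ν₁` in part 1 and law `ν₂` in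
part 2. -/
def inhomogLaw (n₁ n₂ : ℕ) (ν₁ ν₂ : Measure ℝ≥0) : Measure (BipGraph (Fin n₁) (Fin n₂)) :=
  ((Measure.pi fun _ : Fin n₁ => ν₁).prod (Measure.pi fun _ : Fin n₂ => ν₂)).bind inhomogGiven

/-! ### The configuration model -/

/-- Pairs of degree sequences of lengths `n₁` and `n₂` with equal sums. -/
abbrev DegSeqs (n₁ n₂ : ℕ) :=
  {d : (Fin n₁ → ℕ) × (Fin n₂ → ℕ) // ∑ j, d.1 j = ∑ l, d.2 l}

/-- Perfect matchings of the half-edges of part 1 with those of part 2. -/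
abbrev Matching {n₁ n₂ : ℕ} (d : DegSeqs n₁ n₂) :=
  ((j : Fin n₁) × Fin (d.1.1 j)) ≃ ((l : Fin n₂) × Fin (d.1.2 l))

instance {n₁ n₂ : ℕ} (d : DegSeqs n₁ n₂) : Nonempty (Matching d) :=
  Fintype.card_eq.1 (by simpa using d.2)

/-- The adjacency relation of the multigraph given by a matching. -/
def matchingGraph {n₁ n₂ : ℕ} (d : DegSeqs n₁ n₂) (σ : Matching d) :
    BipGraph (Fin n₁) (Fin n₂) :=
  fun v w => ∃ i, (σ ⟨v, i⟩).1 = w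

/-- The configuration model: given the random degree sequences, with law `L`, the matching of the
half-edges is uniform. -/
def confLaw {n₁ n₂ : ℕ} (L : PMF (DegSeqs n₁ n₂)) : Measure (BipGraph (Fin n₁) (Fin n₂)) :=
  (L.bind fun d => (PMF.uniformOfFintype (Matching d)).map (matchingGraph d)).toMeasure

/-- The number of half-edges in each part. -/
def halfEdges {n₁ n₂ : ℕ} (d : DegSeqs n₁ n₂) : ℕ := ∑ j, d.1.1 j

/-- The number of entries of a sequence that are equal to `j`. -/
def countEq {m : ℕ} (s : Fin m → ℕ) (j : ℕ) : ℕ := (Finset.univ.filter fun i => s i = j).card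

/-- The empirical moment `m⁻¹ ∑ᵢ sᵢ ^ r`. -/
def empMoment {m : ℕ} (s : Fin m → ℕ) (r : ℕ) : ℝ := (∑ i, (s i : ℝ) ^ r) / m

/-- Convergence in probability to a constant; the variables may live on different spaces. -/
def TendstoInProb {Ω : ℕ → Type*} [∀ n, MeasurableSpace (Ω n)] (μ : ∀ n, Measure (Ω n))
    (Y : ∀ n, Ω n → ℝ) (c : ℝ) : Prop :=
  ∀ ε : ℝ, 0 < ε → Tendsto (fun n => μ n {ω | ε < |Y n ω - c|}) atTop (𝓝 0)

/-! ### The four settings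

In each of them `μ n` is the law of the `n`-th bipartite graph, with parts of sizes `n₁ n` and
`n₂ n`, and `D₁`, `D₂` are the laws that determine the limit tree. -/

section Cases

variable (k : ℕ) (n₁ n₂ : ℕ → ℕ) [∀ n, NeZero (n₁ n)] [∀ n, NeZero (n₂ n)] (β : ℝ≥0)
  (μ : ∀ n, Measure (BipGraph (Fin (n₁ n)) (Fin (n₂ n)))) [∀ n, IsProbabilityMeasure (μ n)]
  (D₁ D₂ : Measure ℕ) [IsProbabilityMeasure D₁] [IsProbabilityMeasure D₂]

/-- Active random intersection graphs. -/
structure ActiveCase : Prop where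
  model : ∃ P : ∀ n, PMF (Fin (n₂ n + 1)), ∀ n, μ n = activeLaw (n₁ n) (n₂ n) (P n)
  mean_pos : 0 < natMoment D₁ 1
  mean_lt_top : natMoment D₁ 1 < ⊤
  tendsto_mean :
    Tendsto (fun n => ∫⁻ p, (X₁ p : ℝ≥0∞) ∂(withVertex₁ (μ n))) atTop (𝓝 (natMoment D₁ 1))
  tendsto_law : TendstoInDistribution (fun _ => X₁) atTop id (fun n => withVertex₁ (μ n)) D₁
  law₂ : D₂ = poissonMeasure (β⁻¹ * (natMoment D₁ 1).toNNReal)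
  moment_lt_top : natMoment D₁ k < ⊤
  tendsto_moment :
    Tendsto (fun n => ∫⁻ p, (X₁ p : ℝ≥0∞) ^ k ∂(withVertex₁ (μ n))) atTop (𝓝 (natMoment D₁ k))

/-- Passive random intersection graphs. -/
structure PassiveCase : Prop where
  model : ∃ P : ∀ n, PMF (Fin (n₁ n + 1)), ∀ n, μ n = passiveLaw (n₁ n) (n₂ n) (P n)
  mean_pos : 0 < natMoment D₂ 1
  mean_lt_top : natMoment D₂ 1 < ⊤
  tendsto_mean :
    Tendsto (fun n => ∫⁻ p, (X₂ p : ℝ≥0∞) ∂(withVertex₂ (μ n))) atTop (𝓝 (natMoment D₂ 1))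
  tendsto_law : TendstoInDistribution (fun _ => X₂) atTop id (fun n => withVertex₂ (μ n)) D₂
  law₁ : D₁ = poissonMeasure (β * (natMoment D₂ 1).toNNReal)
  moment_lt_top : natMoment D₂ (k + 1) < ⊤
  tendsto_moment :
    Tendsto (fun n => ∫⁻ p, (X₂ p : ℝ≥0∞) ^ (k + 1) ∂(withVertex₂ (μ n))) atTop
      (𝓝 (natMoment D₂ (k + 1)))

/-- Inhomogeneous random intersection graphs, with weights of law `ν₁` and `ν₂`. -/
structure InhomogCase (ν₁ ν₂ : Measure ℝ≥0) : Prop where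
  prob₁ : IsProbabilityMeasure ν₁
  prob₂ : IsProbabilityMeasure ν₂
  model : ∀ n, μ n = inhomogLaw (n₁ n) (n₂ n) ν₁ ν₂
  mean_pos₁ : 0 < weightMoment ν₁ 1
  mean_lt_top₁ : weightMoment ν₁ 1 < ⊤
  mean_pos₂ : 0 < weightMoment ν₂ 1
  mean_lt_top₂ : weightMoment ν₂ 1 < ⊤
  law₁ : D₁ = mixedPoisson (ν₁.map fun x => NNReal.sqrt β * x * (weightMoment ν₂ 1).toNNReal)
  law₂ : D₂ = mixedPoisson (ν₂.map fun x => (NNReal.sqrt β)⁻¹ * x * (weightMoment ν₁ 1).toNNReal)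
  moment_lt_top₁ : weightMoment ν₁ k < ⊤
  moment_lt_top₂ : weightMoment ν₂ (k + 1) < ⊤

/-- Random intersection graphs based on the configuration model, with random degree sequences of
law `L n`. -/
structure ConfCase (L : ∀ n, PMF (DegSeqs (n₁ n) (n₂ n))) : Prop where
  model : ∀ n, μ n = confLaw (L n)
  mean_pos₁ : 0 < natMoment D₁ 1
  mean_lt_top₁ : natMoment D₁ 1 < ⊤
  mean_pos₂ : 0 < natMoment D₂ 1
  mean_lt_top₂ : natMoment D₂ 1 < ⊤
  tendsto_mean₁ : TendstoInProb (fun n => (L n).toMeasure)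
    (fun n d => (halfEdges d : ℝ) / n₁ n) (natMoment D₁ 1).toReal
  tendsto_mean₂ : TendstoInProb (fun n => (L n).toMeasure)
    (fun n d => (halfEdges d : ℝ) / n₂ n) (natMoment D₂ 1).toReal
  tendsto_freq₁ : ∀ j : ℕ, 1 ≤ j → TendstoInProb (fun n => (L n).toMeasure)
    (fun n d => (countEq d.1.1 j : ℝ) / n₁ n) (D₁.real {j})
  tendsto_freq₂ : ∀ j : ℕ, 1 ≤ j → TendstoInProb (fun n => (L n).toMeasure)
    (fun n d => (countEq d.1.2 j : ℝ) / n₂ n) (D₂.real {j})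
  moment_lt_top₁ : natMoment D₁ k < ⊤
  moment_lt_top₂ : natMoment D₂ (k + 1) < ⊤
  concentration : ∃ f : ℕ → ℝ, Tendsto f atTop (𝓝 0) ∧
    (∀ m ∈ Finset.Icc 1 k,
      (fun n => (L n).toMeasure.real {d | f n < |(natMoment D₁ m).toReal - empMoment d.1.1 m|})
        =o[atTop] fun n => ((n₁ n : ℝ) ^ (2 * k))⁻¹) ∧
    (∀ m ∈ Finset.Icc 1 (k + 1),
      (fun n => (L n).toMeasure.real {d | f n < |(natMoment D₂ m).toReal - empMoment d.1.2 m|})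
        =o[atTop] fun n => ((n₁ n : ℝ) ^ (2 * k))⁻¹)

end Cases

end RIG

end

/-! A power is a non-negative combination of falling factorials, so it suffices that the `m`-th
factorial moment of the degree `d_n` tends to that of `d^*` for `1 ≤ m ≤ k`
(`tendsto_degreeMoment`).

A falling factorial counts injections: `n₁` times the factorial moment is the expected number of
tuples of `m + 1` distinct vertices whose first entry, the root, is adjacent to all the others.
Adding to such a tuple a choice of common neighbours `w : Fin m → W` and sorting by the kernel `π`
of `w` turns this into a count of trees of height two: the root has degree `|π|`, each block `q`
gives a middle vertex of degree `blk π q + 1`, and the `m` leaves have degree one. In each model the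
probability of a given tree is, up to negligible errors, a constant times a product of vertex
weights that depend only on degrees in the tree. Sums over embeddings become products of averages,
and the expected count per vertex tends to `treeSum`. In the limit tree `d^*` is the number of
grandchildren of the root; expanding its falling factorial over the same partitions gives `limFac`,
where size-biasing accounts for the shift `blk π q + 1` (`lintegral_descFactorial_grandchildren`,
`fmom_sizeBiased_map`). Comparing the two limits is then algebra, one partition at a time
(`toReal_limFac`).

Upper bound: every star has at least one choice of `w`, so trees overcount stars (`facMom_le`,
`eventually_facMom_le`). Since `|π| ≤ m` and `blk π q + 1 ≤ m + 1`, moments of order `k` in part 1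
and `k + 1` in part 2 suffice.

Lower bound: the overcount is at most the number of paths with a second connection between the root
and a leaf (`card_isPath_le`). It is negligible if edge sets `E` have probability at most `y ^ |E|`
with `y` of order `1 / n` (`sum_treeCount_le`). Truncation at a level `K` achieves this and passes
to a subgraph, so the factorial moments only decrease (`eventually_le_facMom`). Letting `K → ∞`
after `n → ∞` recovers the full limit (`tendsto_of_eventually_le`).

In the configuration model both bounds are applied given the degree sequences, along a filter of
events with small complements (`probFilter`). This is why they are stated for arbitrary filters. For
the upper bound the exceptional probability `o(n₁ ^ (-2k))` beats the trivial bound `n₁ ^ m`; for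
the lower bound convergence in probability is enough. -/

noncomputable section

namespace RIG

/-! ### Paths from the root and falling factorials of the degree -/

section Paths

variable {V W : Type*}

/-- The degree of a vertex of the intersection graph, as a natural number. -/
def natDeg (H : BipGraph V W) (u : V) : ℕ := ((intersectionGraph H).neighborSet u).ncard

theorem ideg_eq_natDeg [Finite V] (H : BipGraph V W) (u : V) : ideg H u = (natDeg H u : ℕ∞) :=
  (Set.Finite.cast_ncard_eq (Set.toFinite _)).symm

theorem natDeg_mono [Finite V] {H H' : BipGraph V W} (h : H' ≤ H) (u : V) :
    natDeg H' u ≤ natDeg H u := by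
  refine Set.ncard_le_ncard ?_ (Set.toFinite _)
  rintro v ⟨hne, w, hu, hv⟩
  exact ⟨hne, w, h _ _ hu, h _ _ hv⟩

theorem natDeg_le_card [Fintype V] (H : BipGraph V W) (u : V) :
    natDeg H u ≤ Fintype.card V := by
  rw [← Nat.card_eq_fintype_card]
  exact Set.ncard_le_card _

/-- The `w i` are common neighbours of the root `x none` and of the vertices `x (some i)`. -/
def IsPath {m : ℕ} (H : BipGraph V W) (x : Option (Fin m) ↪ V) (w : Fin m → W) : Prop :=
  ∀ i, H (x none) (w i) ∧ H (x (some i)) (w i)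

/-- All the vertices `x (some i)` are adjacent to the root in the intersection graph. -/
def IsStar {m : ℕ} (H : BipGraph V W) (x : Option (Fin m) ↪ V) : Prop :=
  ∀ i, (intersectionGraph H).Adj (x none) (x (some i))

theorem isStar_iff {m : ℕ} {H : BipGraph V W} {x : Option (Fin m) ↪ V} :
    IsStar H x ↔ ∃ w, IsPath H x w := by
  constructor
  · intro h
    choose _ w hw using h
    exact ⟨w, hw⟩
  · rintro ⟨w, hw⟩ i
    exact ⟨fun h => by simpa using x.injective h, w i, hw i⟩

/-- Embeddings of `Option (Fin m)` whose values satisfy a relation with the value at `none`. -/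
def starEquiv (m : ℕ) (G : SimpleGraph V) :
    {x : Option (Fin m) ↪ V // ∀ i, G.Adj (x none) (x (some i))} ≃
      (u : V) × (Fin m ↪ G.neighborSet u) where
  toFun x := ⟨x.1 none, ⟨fun i => ⟨x.1 (some i), x.2 i⟩, fun i j h => by
    simpa using x.1.injective (congrArg Subtype.val h)⟩⟩
  invFun p := ⟨⟨fun o => o.elim p.1 fun i => p.2 i, by
    rintro (_ | i) (_ | j) h
    · rfl
    · exact absurd h (p.2 j).2.ne
    · exact absurd h (p.2 i).2.ne'
    · exact congrArg some (p.2.injective (Subtype.ext h))⟩, fun i => (p.2 i).2⟩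
  left_inv x := by
    ext o
    cases o <;> rfl
  right_inv p := rfl

open Classical in
-- `(natDeg H u).descFactorial m` counts the injections of `Fin m` into the neighbourhood of `u`. As
-- `u` is not its own neighbour, adding it keeps the tuple injective.
theorem sum_descFactorial_natDeg [Fintype V] (m : ℕ) (H : BipGraph V W) :
    ∑ u, (natDeg H u).descFactorial m =
      (Finset.univ.filter fun x : Option (Fin m) ↪ V => IsStar H x).card := by
  rw [← Fintype.card_subtype, Fintype.card_congr
    (show {x : Option (Fin m) ↪ V // IsStar H x} ≃ _ from starEquiv m (intersectionGraph H)),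
    Fintype.card_sigma]
  refine Finset.sum_congr rfl fun u _ => ?_
  rw [Fintype.card_embedding_eq, Fintype.card_fin, natDeg, ← Nat.card_coe_set_eq,
    Nat.card_eq_fintype_card]

open Classical in
-- Forgetting the common neighbours maps the paths onto the stars.
theorem sum_descFactorial_natDeg_le [Fintype V] [Fintype W] (m : ℕ) (H : BipGraph V W) :
    ∑ u, (natDeg H u).descFactorial m ≤
      (Finset.univ.filter fun p : (Option (Fin m) ↪ V) × (Fin m → W) =>
        IsPath H p.1 p.2).card := by
  rw [sum_descFactorial_natDeg]
  refine (Finset.card_le_card ?_).trans (Finset.card_image_le (f := Prod.fst))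
  intro x hx
  obtain ⟨w, hw⟩ := isStar_iff.1 (Finset.mem_filter.1 hx).2
  exact Finset.mem_image.2 ⟨(x, w), by simpa using hw, rfl⟩

/-- A path together with a second common neighbour of the root and one of the vertices. -/
def IsDoublePath {m : ℕ} (H : BipGraph V W) (x : Option (Fin m) ↪ V) (w : Fin m → W) (i : Fin m)
    (w' : W) : Prop :=
  IsPath H x w ∧ w' ≠ w i ∧ H (x none) w' ∧ H (x (some i)) w'

open Classical in
-- Fix one choice `w₀` for each star. The paths that use it inject into the stars; any other path
-- differs from it at some `i`, and `w₀ i` is then a second common neighbour of the root and `x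
-- (some i)`.
theorem card_isPath_le [Fintype V] [Fintype W] (m : ℕ) (H : BipGraph V W) :
    (Finset.univ.filter fun p : (Option (Fin m) ↪ V) × (Fin m → W) => IsPath H p.1 p.2).card ≤
      ∑ u, (natDeg H u).descFactorial m +
      (Finset.univ.filter fun p : (Option (Fin m) ↪ V) × (Fin m → W) × Fin m × W =>
        IsDoublePath H p.1 p.2.1 p.2.2.1 p.2.2.2).card := by
  rw [sum_descFactorial_natDeg]
  have hw (x : Option (Fin m) ↪ V) (hx : IsStar H x) := isStar_iff.1 hx
  choose w₀ hw₀ using hw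
  set S := Finset.univ.filter fun p : (Option (Fin m) ↪ V) × (Fin m → W) => IsPath H p.1 p.2
  have hS (p) (hp : p ∈ S) : IsPath H p.1 p.2 := (Finset.mem_filter.1 hp).2
  have hst (p) (hp : p ∈ S) : IsStar H p.1 := isStar_iff.2 ⟨_, hS p hp⟩
  set S₁ := S.filter fun p => ∃ h : IsStar H p.1, p.2 = w₀ p.1 h
  set S₂ := S.filter fun p => ¬ ∃ h : IsStar H p.1, p.2 = w₀ p.1 h
  rw [← Finset.card_filter_add_card_filter_not (s := S)
    (fun p => ∃ h : IsStar H p.1, p.2 = w₀ p.1 h)]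
  refine add_le_add ?_ ?_
  · refine Finset.card_le_card_of_injOn Prod.fst (fun p hp => ?_) (fun p hp q hq h => ?_)
    · obtain ⟨-, h, -⟩ := Finset.mem_filter.1 hp
      simpa using h
    · obtain ⟨-, h₁, h₂⟩ := Finset.mem_filter.1 hp
      obtain ⟨-, h₃, h₄⟩ := Finset.mem_filter.1 hq
      obtain ⟨x, w⟩ := p
      obtain ⟨y, z⟩ := q
      obtain rfl : x = y := h
      simp only at h₂ h₄
      rw [h₂, h₄]
  · refine (Finset.card_le_card ?_).trans
      (Finset.card_image_le (f := fun p : (Option (Fin m) ↪ V) × (Fin m → W) × Fin m × W =>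
        (p.1, p.2.1)))
    intro p hp
    obtain ⟨hp₁, hp₂⟩ := Finset.mem_filter.1 hp
    have hne : p.2 ≠ w₀ p.1 (hst p hp₁) := fun h => hp₂ ⟨_, h⟩
    obtain ⟨i, hi⟩ := Function.ne_iff.1 hne
    refine Finset.mem_image.2 ⟨(p.1, p.2, i, w₀ p.1 (hst p hp₁) i), ?_, rfl⟩
    simp only [Finset.mem_filter, Finset.mem_univ, true_and]
    exact ⟨hS p hp₁, hi.symm, hw₀ _ _ i⟩

end Paths

/-! ### Functions and their kernels -/

section Kernels

/-- A function is the same as its kernel together with an embedding of the quotient. -/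
def kerEquiv (ι T : Type*) : (ι → T) ≃ (π : Setoid ι) × (Quotient π ↪ T) where
  toFun f := ⟨Setoid.ker f, ⟨Quotient.lift f fun _ _ h => h, Setoid.kerLift_injective f⟩⟩
  invFun p i := p.2 (Quotient.mk p.1 i)
  left_inv f := rfl
  right_inv := by
    rintro ⟨π, e⟩
    have hπ : (Setoid.ker fun i => e (Quotient.mk π i)) = π := by
      ext i j
      simp only [Setoid.ker_def, EmbeddingLike.apply_eq_iff_eq]
      exact Quotient.eq
    refine Sigma.ext hπ ?_
    -- The two embeddings live over setoids that are only propositionally equal; generalising over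
    -- the setoid makes substitution possible.
    have key : ∀ (π' : Setoid ι) (e' : Quotient π' ↪ T), π' = π →
        (∀ i, e' (Quotient.mk π' i) = e (Quotient.mk π i)) → e' ≍ e := by
      rintro π' e' rfl h
      exact heq_of_eq (DFunLike.ext _ _ fun q => Quotient.inductionOn q h)
    exact key _ _ hπ fun i => rfl

instance {ι : Type*} [Finite ι] : Finite (Setoid ι) :=
  Finite.of_injective (fun π : Setoid ι => π.r) fun π ρ h => Setoid.ext fun a b => by
    exact iff_of_eq (congrFun (congrFun h a) b)

instance {ι : Type*} [Finite ι] : Fintype (Setoid ι) := Fintype.ofFinite _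

open Classical in
instance {ι : Type*} [Fintype ι] (π : Setoid ι) : Fintype (Quotient π) := Quotient.fintype π

/-- Splits maps by their pattern of coincidences. Its use both for common neighbours and for
grandchildren is what indexes the two limits by the same partitions. -/
theorem sum_fun_eq_sum_setoid {ι T R : Type*} [Fintype ι] [DecidableEq ι] [Fintype T]
    [∀ π : Setoid ι, Fintype (Quotient π ↪ T)] [AddCommMonoid R] (F : (ι → T) → R) :
    ∑ f : ι → T, F f = ∑ π : Setoid ι, ∑ e : Quotient π ↪ T, F fun i => e (Quotient.mk π i) := by
  rw [← (kerEquiv ι T).symm.sum_comp, Fintype.sum_sigma]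
  rfl

/-- The number of preimages of a point. -/
def fib {ι T : Type*} (f : ι → T) (t : T) : ℕ := Nat.card {i // f i = t}

theorem fib_embedding_comp {ι T S : Type*} (f : ι → T) (e : T ↪ S) (t : T) :
    fib (fun i => e (f i)) (e t) = fib f t := by
  simp [fib]

theorem fib_eq_zero {ι T : Type*} {f : ι → T} {t : T} (h : ∀ i, f i ≠ t) : fib f t = 0 := by
  have : IsEmpty {i // f i = t} := ⟨fun i => h i.1 i.2⟩
  exact Nat.card_of_isEmpty

theorem fib_sumElim {ι κ T : Type*} [Finite ι] [Finite κ] (f : ι → T) (g : κ → T) (t : T) :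
    fib (Sum.elim f g) t = fib f t + fib g t := by
  rw [fib, fib, fib, ← Nat.card_sum]
  exact Nat.card_congr (Equiv.subtypeSum.trans (Equiv.refl _))

theorem fib_const {ι T : Type*} (t : T) : fib (fun _ : ι => t) t = Nat.card ι := by
  simp [fib]

theorem fib_injective {ι T : Type*} {f : ι → T} (hf : Function.Injective f) (i : ι) :
    fib f (f i) = 1 := by
  have : Unique {j // f j = f i} := ⟨⟨⟨i, rfl⟩⟩, fun j => Subtype.ext (hf j.2)⟩
  exact Nat.card_unique

theorem sum_fib {ι T : Type*} [Fintype ι] [Fintype T] (f : ι → T) :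
    ∑ t, fib f t = Fintype.card ι := by
  classical
  rw [← Fintype.card_congr (Equiv.sigmaFiberEquiv f), Fintype.card_sigma]
  simp [fib]

/-- The embeddings into a sigma type that lift a given function. -/
def liftEquiv {ι T : Type*} {F : T → Type*} (f : ι → T) :
    {G : (i : ι) → F (f i) // Function.Injective fun i => (⟨f i, G i⟩ : (t : T) × F t)} ≃
      ((t : T) → {i // f i = t} ↪ F t) where
  toFun G t := ⟨fun i => i.2 ▸ G.1 i.1, by
    rintro ⟨i, hi⟩ ⟨j, hj⟩ h
    refine Subtype.ext (G.2 ?_)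
    dsimp only at h ⊢
    subst hi
    refine Sigma.ext hj.symm ?_
    simp only at h
    rw [h]
    exact eqRec_heq _ _⟩
  invFun E := ⟨fun i => E (f i) ⟨i, rfl⟩, by
    intro i j h
    obtain ⟨h₁, h₂⟩ := Sigma.mk.inj_iff.1 h
    have key : ∀ (t : T) (hi : f i = t), E t ⟨i, hi⟩ ≍ E (f i) ⟨i, rfl⟩ := by
      rintro t rfl
      rfl
    have := eq_of_heq ((key (f j) h₁).trans h₂)
    exact congrArg Subtype.val ((E (f j)).injective this)⟩
  left_inv G := rfl
  right_inv E := by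
    funext t
    ext ⟨i, rfl⟩
    rfl

open Classical in
-- Injectivity constrains only indices in the same fibre of `f`, so a lift is an independent choice,
-- for each `t`, of an injection of that fibre into `Fin (d t)`.
theorem card_lift {ι T : Type*} [Fintype ι] [Fintype T] (f : ι → T) (d : T → ℕ) :
    Fintype.card {G : (i : ι) → Fin (d (f i)) //
      Function.Injective fun i => (⟨f i, G i⟩ : (t : T) × Fin (d t))} =
      ∏ t, (d t).descFactorial (fib f t) := by
  rw [Fintype.card_congr (liftEquiv (F := fun t => Fin (d t)) f), Fintype.card_pi]
  simp [Fintype.card_embedding_eq, fib]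

open Classical in
/-- Falling factorials of a sum. -/
theorem descFactorial_sum {ι T : Type*} [Fintype ι] [Fintype T] (d : T → ℕ) :
    (∑ t, d t).descFactorial (Fintype.card ι) =
      ∑ f : ι → T, ∏ t, (d t).descFactorial (fib f t) := by
  -- Both sides count injections of `ι` into a disjoint union of sets with `d t` elements; the
  -- right-hand side sorts them by the components that are hit.
  have : (∑ t, d t) = Fintype.card ((t : T) × Fin (d t)) := by simp
  rw [this, ← Fintype.card_embedding_eq]
  simp_rw [← card_lift]
  rw [← Fintype.card_sigma]
  exact Fintype.card_congr
    { toFun F := ⟨fun i => (F i).1, fun i => (F i).2, F.injective⟩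
      invFun p := ⟨fun i => ⟨p.1 i, p.2.1 i⟩, p.2.2⟩
      left_inv F := rfl
      right_inv p := rfl }

/-- A product over all points of a function of the number of preimages. -/
theorem prod_fib_comp_embedding {ι T S R : Type*} [Fintype T] [Fintype S] [CommMonoid R]
    (f : ι → T) (e : T ↪ S) (φ : S → ℕ → R) (hφ : ∀ s, φ s 0 = 1) :
    ∏ s, φ s (fib (fun i => e (f i)) s) = ∏ t, φ (e t) (fib f t) := by
  classical
  rw [← Finset.prod_subset (Finset.subset_univ (Finset.univ.map e)), Finset.prod_map]
  · exact Finset.prod_congr rfl fun t _ => by rw [fib_embedding_comp]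
  · intro s _ hs
    rw [fib_eq_zero, hφ]
    rintro i rfl
    exact hs (Finset.mem_map_of_mem _ (Finset.mem_univ _))

end Kernels

/-! ### Expected numbers of trees -/

section Trees

variable {V W : Type*}

/-- The event that all the edges of a given family are present. -/
def incl {ι : Type*} (L : ι → V) (R : ι → W) : Set (BipGraph V W) := {H | ∀ i, H (L i) (R i)}

/-- The end vertices in part 1 of the edges of the tree of height two whose leaves are grouped
according to `π`. -/
def treeL {m : ℕ} (π : Setoid (Fin m)) (x : Option (Fin m) ↪ V) : Quotient π ⊕ Fin m → V :=
  Sum.elim (fun _ => x none) fun i => x (some i)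

/-- The end vertices in part 2 of the edges of the tree. -/
def treeR {m : ℕ} (π : Setoid (Fin m)) (e : Quotient π ↪ W) : Quotient π ⊕ Fin m → W :=
  Sum.elim e fun i => e (Quotient.mk π i)

/-- The size of a block. -/
def blk {m : ℕ} (π : Setoid (Fin m)) (q : Quotient π) : ℕ := fib (Quotient.mk π) q

theorem sum_blk {m : ℕ} (π : Setoid (Fin m)) : ∑ q, blk π q = m := by
  simpa [blk] using sum_fib (Quotient.mk π)

theorem blk_le {m : ℕ} (π : Setoid (Fin m)) (q : Quotient π) : blk π q ≤ m := by
  refine le_of_le_of_eq ?_ (sum_blk π)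
  exact Finset.single_le_sum (f := fun q => blk π q) (fun _ _ => Nat.zero_le _) (Finset.mem_univ q)

theorem card_quotient_le {m : ℕ} (π : Setoid (Fin m)) : Fintype.card (Quotient π) ≤ m := by
  simpa using Fintype.card_le_of_surjective _ (Quotient.mk_surjective (s := π))

theorem one_le_card_quotient {m : ℕ} (hm : 1 ≤ m) (π : Setoid (Fin m)) :
    1 ≤ Fintype.card (Quotient π) :=
  Fintype.card_pos_iff.2 ⟨Quotient.mk π ⟨0, hm⟩⟩

/-- No edge of the tree is listed twice: root edges differ in part 2, leaf edges differ in part 1.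
Hence the `fib` counts are genuine degrees. -/
theorem treeL_treeR_injective {m : ℕ} (π : Setoid (Fin m)) (x : Option (Fin m) ↪ V)
    (e : Quotient π ↪ W) : Function.Injective fun i => (treeL π x i, treeR π e i) := by
  rintro (q | i) (q' | i') h <;> simp_all [treeL, treeR]

/-- The root meets one edge per block and each leaf exactly one; other vertices drop out because `φ
v 0 = 1`. -/
theorem prod_fib_treeL {R : Type*} [CommMonoid R] [Fintype V] {m : ℕ} (π : Setoid (Fin m))
    (x : Option (Fin m) ↪ V) (φ : V → ℕ → R) (hφ : ∀ v, φ v 0 = 1) :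
    ∏ v, φ v (fib (treeL π x) v) =
      φ (x none) (Fintype.card (Quotient π)) * ∏ i, φ (x (some i)) 1 := by
  have h : treeL π x = fun i =>
      x (Sum.elim (fun _ : Quotient π => none) (fun i : Fin m => some i) i) := by
    funext i
    cases i <;> rfl
  rw [h, prod_fib_comp_embedding _ x φ hφ, Fintype.prod_option]
  congr 1
  · rw [fib_sumElim, fib_const, fib_eq_zero (f := fun i : Fin m => some i) (by simp)]
    simp
  · refine Finset.prod_congr rfl fun i _ => ?_
    rw [fib_sumElim, fib_eq_zero (f := fun _ : Quotient π => none) (by simp),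
      fib_injective (Option.some_injective _)]

/-- A middle vertex meets its edge to the root and one edge for each leaf in its block. This is the
source of the shift by one, and so of the moment of order `k + 1` in part 2. -/
theorem prod_fib_treeR {R : Type*} [CommMonoid R] [Fintype W] {m : ℕ} (π : Setoid (Fin m))
    (e : Quotient π ↪ W) (φ : W → ℕ → R) (hφ : ∀ v, φ v 0 = 1) :
    ∏ w, φ w (fib (treeR π e) w) = ∏ q, φ (e q) (blk π q + 1) := by
  have h : treeR π e = fun i =>
      e (Sum.elim (fun q : Quotient π => q) (fun i : Fin m => Quotient.mk π i) i) := by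
    funext i
    cases i <;> rfl
  rw [h, prod_fib_comp_embedding _ e φ hφ]
  refine Finset.prod_congr rfl fun q _ => ?_
  rw [fib_sumElim, fib_injective (f := fun q : Quotient π => q) (fun _ _ h => h), blk, add_comm]

theorem setOf_isPath {m : ℕ} (π : Setoid (Fin m)) (x : Option (Fin m) ↪ V) (e : Quotient π ↪ W) :
    {H : BipGraph V W | IsPath H x fun i => e (Quotient.mk π i)} =
      incl (treeL π x) (treeR π e) := by
  ext H
  constructor
  · rintro h (q | i)
    · obtain ⟨i, rfl⟩ := Quotient.exists_rep q
      exact (h i).1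
    · exact (h i).2
  · exact fun h i => ⟨h (.inl _), h (.inr i)⟩

/-- The probability that all edges of a finite set are present. -/
def edgesProb (μ : Measure (BipGraph V W)) (E : Finset (V × W)) : ℝ :=
  μ.real {H | ∀ e ∈ E, H e.1 e.2}

/-- With `S` the set of all middle vertices, including `w'`, a double path has `|S|` edges at the
root, `m` edges at the leaves and one more from leaf `i` to `w'`. These are `m + 1 + |S| ≤ 2 * m +
2` distinct edges, one more than a tree on the same vertices has. -/
theorem measureReal_isDoublePath_le (μ : Measure (BipGraph V W)) [IsFiniteMeasure μ] {m : ℕ}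
    {y : ℝ} (hy : 0 ≤ y)
    (hμ : ∀ E : Finset (V × W), E.card ≤ 2 * m + 2 → edgesProb μ E ≤ y ^ E.card)
    (x : Option (Fin m) ↪ V) (w : Fin m → W) (i : Fin m) (w' : W) :
    letI := Classical.decEq W
    μ.real {H | IsDoublePath H x w i w'} ≤
      y ^ (m + 1) * y ^ (Finset.univ.image (Fin.cons w' w : Fin (m + 1) → W)).card := by
  classical
  by_cases hw : w' = w i
  · have : {H | IsDoublePath H x w i w'} = ∅ := by
      ext H
      simp [IsDoublePath, hw]
    rw [this, measureReal_empty]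
    positivity
  set S := Finset.univ.image (Fin.cons w' w : Fin (m + 1) → W)
  set E₁ : Finset (V × W) := S.image fun a => (x none, a)
  set E₂ : Finset (V × W) := Finset.univ.image fun i : Fin m => (x (some i), w i)
  have h₁ : E₁.card = S.card := Finset.card_image_of_injective _ fun a b h => (Prod.ext_iff.1 h).2
  have h₂ : E₂.card = m := by
    rw [Finset.card_image_of_injective, Finset.card_univ, Fintype.card_fin]
    intro a b h
    simpa using (Prod.ext_iff.1 h).1
  have h₁₂ : Disjoint E₁ E₂ := by
    rw [Finset.disjoint_left]
    intro a ha hb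
    simp only [E₁, E₂, Finset.mem_image] at ha hb
    obtain ⟨b, -, rfl⟩ := ha
    obtain ⟨j, -, hj⟩ := hb
    simpa using (Prod.ext_iff.1 hj).1
  have h₃ : (x (some i), w') ∉ E₁ ∪ E₂ := by
    simp only [E₁, E₂, Finset.mem_union, Finset.mem_image, not_or, not_exists, not_and]
    refine ⟨fun a _ h => by simpa using (Prod.ext_iff.1 h).1, fun j _ h => hw ?_⟩
    have hj : j = i := by simpa using (Prod.ext_iff.1 h).1
    exact hj ▸ (Prod.ext_iff.1 h).2.symm
  have hcard : (insert (x (some i), w') (E₁ ∪ E₂)).card = m + 1 + S.card := by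
    rw [Finset.card_insert_of_notMem h₃, Finset.card_union_of_disjoint h₁₂, h₁, h₂]
    ring
  have hSm : S.card ≤ m + 1 := by
    simpa using Finset.card_image_le (s := Finset.univ) (f := (Fin.cons w' w : Fin (m + 1) → W))
  have := hμ (insert (x (some i), w') (E₁ ∪ E₂)) (by omega)
  rw [hcard, pow_add] at this
  refine le_trans (measureReal_mono ?_) this
  rintro H ⟨hp, -, hu, hv⟩ a ha
  simp only [E₁, E₂, S, Finset.mem_insert, Finset.mem_union, Finset.mem_image, Finset.mem_univ,
    true_and] at ha
  rcases ha with rfl | ⟨b, ⟨j, rfl⟩, rfl⟩ | ⟨j, rfl⟩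
  · exact hv
  · refine Fin.cases hu (fun j => ?_) j
    exact (hp j).1
  · exact (hp j).2

variable [Fintype V] [Fintype W]

/-- The `m`-th factorial moment of the degree of a uniformly random vertex. -/
def facMom (μ : Measure (BipGraph V W)) (m : ℕ) : ℝ :=
  (Fintype.card V : ℝ)⁻¹ * ∫ H, ∑ u, ((natDeg H u).descFactorial m : ℝ) ∂μ

open Classical in
/-- The expected number of trees of height two of type `π`, divided by the number of vertices. -/
def treeCount (μ : Measure (BipGraph V W)) {m : ℕ} (π : Setoid (Fin m)) : ℝ :=
  (Fintype.card V : ℝ)⁻¹ * ∑ x : Option (Fin m) ↪ V, ∑ e : Quotient π ↪ W,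
    μ.real (incl (treeL π x) (treeR π e))

open Classical in
theorem integral_card_filter {Ω ι : Type*} [Fintype ι] [MeasurableSpace Ω]
    [DiscreteMeasurableSpace Ω] (μ : Measure Ω) [IsFiniteMeasure μ] (p : ι → Ω → Prop) :
    ∫ ω, ((Finset.univ.filter fun i => p i ω).card : ℝ) ∂μ = ∑ i, μ.real {ω | p i ω} := by
  have h (ω) : ((Finset.univ.filter fun i => p i ω).card : ℝ) =
      ∑ i, Set.indicator {ω | p i ω} (1 : Ω → ℝ) ω := by
    rw [Finset.card_filter]
    simp [Set.indicator_apply]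
  simp_rw [h]
  rw [integral_finsetSum]
  · exact Finset.sum_congr rfl fun i _ => integral_indicator_one (.of_discrete)
  · exact fun i _ => (integrable_const (1 : ℝ)).indicator .of_discrete

open Classical in
theorem card_inv_mul_sum_isPath (μ : Measure (BipGraph V W)) [IsFiniteMeasure μ] (m : ℕ) :
    (Fintype.card V : ℝ)⁻¹ * ∫ H, ((Finset.univ.filter
      fun p : (Option (Fin m) ↪ V) × (Fin m → W) => IsPath H p.1 p.2).card : ℝ) ∂μ =
      ∑ π : Setoid (Fin m), treeCount μ π := by
  rw [integral_card_filter μ fun (p : (Option (Fin m) ↪ V) × (Fin m → W)) H => IsPath H p.1 p.2,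
    Fintype.sum_prod_type]
  simp_rw [treeCount, ← Finset.mul_sum]
  rw [Finset.sum_comm (s := Finset.univ (α := Setoid (Fin m)))]
  congr 1
  refine Finset.sum_congr rfl fun x _ => ?_
  rw [sum_fun_eq_sum_setoid]
  refine Finset.sum_congr rfl fun π _ => Finset.sum_congr rfl fun e _ => ?_
  rw [← setOf_isPath]

/-- This half needs no control of the edge probabilities. -/
theorem facMom_le (μ : Measure (BipGraph V W)) [IsFiniteMeasure μ] (m : ℕ) :
    facMom μ m ≤ ∑ π : Setoid (Fin m), treeCount μ π := by
  classical
  rw [← card_inv_mul_sum_isPath, facMom]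
  refine mul_le_mul_of_nonneg_left (integral_mono .of_finite .of_finite fun H => ?_) (by positivity)
  exact_mod_cast sum_descFactorial_natDeg_le m H

open Classical in
-- Choose the values one at a time: a new value costs a factor `y` with at most `|W|` choices, while
-- a repeated one is free but has at most `p` choices.
theorem sum_pow_card_image_le (p : ℕ) (y : ℝ) (hy : 0 ≤ y) :
    ∑ f : Fin p → W, y ^ (Finset.univ.image f).card ≤ (Fintype.card W * y + p) ^ p := by
  induction p with
  | zero => simp
  | succ p ih =>
    rw [← (Fin.consEquiv fun _ : Fin (p + 1) => W).sum_comp, Fintype.sum_prod_type_right]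
    have key (g : Fin p → W) : ∑ a : W, y ^ (Finset.univ.image
        (Fin.consEquiv (fun _ : Fin (p + 1) => W) (a, g))).card ≤
        y ^ (Finset.univ.image g).card * (Fintype.card W * y + (p + 1 : ℕ)) := by
      have himg (a : W) : Finset.univ.image (Fin.consEquiv (fun _ : Fin (p + 1) => W) (a, g)) =
          insert a (Finset.univ.image g) := by
        ext b
        simp [Fin.consEquiv, Fin.exists_fin_succ, eq_comm]
      simp_rw [himg]
      set S := Finset.univ.image g
      have hS : S.card ≤ p := by simpa using Finset.card_image_le (s := Finset.univ) (f := g)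
      calc ∑ a : W, y ^ (insert a S).card
          ≤ ∑ a : W, ((if a ∈ S then y ^ S.card else 0) + y ^ S.card * y) := by
            refine Finset.sum_le_sum fun a _ => ?_
            split_ifs with ha
            · rw [Finset.insert_eq_of_mem ha]
              have : 0 ≤ y ^ S.card * y := by positivity
              linarith
            · rw [Finset.card_insert_of_notMem ha, pow_succ, zero_add]
        _ = y ^ S.card * (Fintype.card W * y + S.card) := by
            rw [Finset.sum_add_distrib, Finset.sum_ite_mem]
            simp
            ring
        _ ≤ _ := by
            gcongr
            omega
    refine (Finset.sum_le_sum fun g _ => key g).trans ?_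
    rw [← Finset.sum_mul, pow_succ]
    refine mul_le_mul_of_nonneg_right (ih.trans ?_) (by positivity)
    gcongr
    omega

/-- `μ'` is the truncated model, dominated by `μ` on increasing functions, and the last term bounds
the expected number of double paths per vertex. When `y` is of order `1 / n`, the factor `|V| ^ m *
y ^ (m + 1)` makes it of order `1 / n`. -/
theorem sum_treeCount_le (μ μ' : Measure (BipGraph V W)) [IsFiniteMeasure μ] [IsFiniteMeasure μ']
    (m : ℕ) (hmono : ∀ f : BipGraph V W → ℝ, Monotone f → 0 ≤ f → ∫ H, f H ∂μ' ≤ ∫ H, f H ∂μ)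
    {y : ℝ} (hy : 0 ≤ y)
    (hμ : ∀ E : Finset (V × W), E.card ≤ 2 * m + 2 → edgesProb μ' E ≤ y ^ E.card) :
    ∑ π : Setoid (Fin m), treeCount μ' π ≤ facMom μ m +
      m * (Fintype.card V : ℝ) ^ m * y ^ (m + 1) *
        (Fintype.card W * y + (m + 1 : ℕ)) ^ (m + 1) := by
  classical
  have hfac : facMom μ' m ≤ facMom μ m := by
    refine mul_le_mul_of_nonneg_left (hmono _ (fun H' H hH => ?_) fun H =>
      Finset.sum_nonneg fun _ _ => Nat.cast_nonneg _) (by positivity)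
    refine Finset.sum_le_sum fun u _ => ?_
    exact_mod_cast Nat.descFactorial_le _ (natDeg_mono hH u)
  refine le_trans ?_ (add_le_add_left hfac _)
  rw [← card_inv_mul_sum_isPath]
  have h₁ : ∫ H, ((Finset.univ.filter
      fun p : (Option (Fin m) ↪ V) × (Fin m → W) => IsPath H p.1 p.2).card : ℝ) ∂μ' ≤
      ∫ H, ∑ u, ((natDeg H u).descFactorial m : ℝ) ∂μ' +
      ∫ H, ((Finset.univ.filter fun p : (Option (Fin m) ↪ V) × (Fin m → W) × Fin m × W =>
        IsDoublePath H p.1 p.2.1 p.2.2.1 p.2.2.2).card : ℝ) ∂μ' := by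
    rw [← integral_add .of_finite .of_finite]
    refine integral_mono .of_finite .of_finite fun H => ?_
    simp only [← Nat.cast_sum, ← Nat.cast_add]
    exact Nat.cast_le.2 (card_isPath_le m H)
  refine (mul_le_mul_of_nonneg_left h₁ (by positivity)).trans ?_
  rw [mul_add, facMom]
  refine add_le_add_right ?_ _
  rw [integral_card_filter μ' fun (p : (Option (Fin m) ↪ V) × (Fin m → W) × Fin m × W) H =>
    IsDoublePath H p.1 p.2.1 p.2.2.1 p.2.2.2]
  simp_rw [Fintype.sum_prod_type]
  have h₂ (x : Option (Fin m) ↪ V) : ∑ w : Fin m → W, ∑ i : Fin m, ∑ w' : W,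
      μ'.real {H | IsDoublePath H x w i w'} ≤
      m * (y ^ (m + 1) * (Fintype.card W * y + (m + 1 : ℕ)) ^ (m + 1)) := by
    calc _ ≤ ∑ w : Fin m → W, ∑ i : Fin m, ∑ w' : W,
          y ^ (m + 1) * y ^ (Finset.univ.image (Fin.cons w' w : Fin (m + 1) → W)).card := by
          refine Finset.sum_le_sum fun w _ => Finset.sum_le_sum fun i _ =>
            Finset.sum_le_sum fun w' _ => ?_
          convert measureReal_isDoublePath_le μ' hy hμ x w i w'
      _ = m * (y ^ (m + 1) * ∑ f : Fin (m + 1) → W, y ^ (Finset.univ.image f).card) := by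
          rw [← (Fin.consEquiv fun _ : Fin (m + 1) => W).sum_comp, Fintype.sum_prod_type_right]
          simp [← Finset.mul_sum, Fin.consEquiv]
      _ ≤ _ := by
          gcongr
          exact sum_pow_card_image_le (m + 1) y hy
  rw [inv_mul_eq_div]
  refine div_le_of_le_mul₀ (by positivity) (by positivity) ?_
  refine (Finset.sum_le_sum fun x _ => h₂ x).trans ?_
  rw [Finset.sum_const, Finset.card_univ, Fintype.card_embedding_eq, nsmul_eq_mul]
  have h₃ : ((Fintype.card V).descFactorial (Fintype.card (Option (Fin m))) : ℝ) ≤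
      (Fintype.card V : ℝ) ^ (m + 1) := by
    have := Nat.descFactorial_le_pow (Fintype.card V) (m + 1)
    simpa using (by exact_mod_cast this)
  calc _ ≤ (Fintype.card V : ℝ) ^ (m + 1) *
        (m * (y ^ (m + 1) * (Fintype.card W * y + (m + 1 : ℕ)) ^ (m + 1))) := by gcongr
    _ = _ := by ring

end Trees

/-! ### Sums over embeddings -/

section Embeddings

variable {ι T : Type*} [Fintype ι] [Fintype T]

/-- The average of a function on a finite type. -/
def avg (g : T → ℝ) : ℝ := (Fintype.card T : ℝ)⁻¹ * ∑ t, g t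

open Classical in
/-- The sum of `∏ i, g i (f i)` over all embeddings `f`. -/
def embSum (g : ι → T → ℝ) : ℝ := ∑ f : ι ↪ T, ∏ i, g i (f i)

theorem avg_const [Nonempty T] (c : ℝ) : avg (fun _ : T => c) = c := by
  simp [avg]

theorem avg_nonneg {g : T → ℝ} (hg : ∀ t, 0 ≤ g t) : 0 ≤ avg g :=
  mul_nonneg (by positivity) (Finset.sum_nonneg fun t _ => hg t)

theorem prod_avg (g : ι → T → ℝ) :
    ∏ i, avg (g i) = (∏ i, ∑ t, g i t) / (Fintype.card T : ℝ) ^ Fintype.card ι := by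
  simp [avg, Finset.prod_mul_distrib, div_eq_inv_mul]

theorem sum_embedding_eq [DecidableEq ι] [DecidablePred fun f : ι → T => Function.Injective f]
    [Fintype (ι ↪ T)] (F : (ι → T) → ℝ) :
    ∑ f : ι ↪ T, F f = ∑ f : ι → T with Function.Injective f, F f := by
  rw [Finset.sum_subtype (p := fun f : ι → T => Function.Injective f) _ (by simp),
    ← (Equiv.subtypeInjectiveEquivEmbedding ι T).sum_comp]
  exact Finset.sum_congr rfl fun f _ => rfl

theorem embSum_nonneg {g : ι → T → ℝ} (hg : ∀ i t, 0 ≤ g i t) : 0 ≤ embSum g :=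
  Finset.sum_nonneg fun _ _ => Finset.prod_nonneg fun _ _ => hg _ _

theorem embSum_le {g : ι → T → ℝ} (hg : ∀ i t, 0 ≤ g i t) :
    embSum g ≤ ∏ i, ∑ t, g i t := by
  classical
  rw [embSum, sum_embedding_eq fun f => ∏ i, g i (f i), Fintype.prod_sum]
  exact Finset.sum_le_sum_of_subset_of_nonneg (Finset.filter_subset _ _)
    fun f _ _ => Finset.prod_nonneg fun i _ => hg _ _

/-- This says that `n ^ k` exceeds the falling factorial by at most `k ^ 2 * n ^ (k - 1)`;
multiplying by `n` avoids the exponent `k - 1` and any division. -/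
theorem pow_mul_le_descFactorial (n k : ℕ) :
    (n : ℝ) ^ k * n ≤ n.descFactorial k * n + (k : ℝ) ^ 2 * (n : ℝ) ^ k := by
  induction k with
  | zero => simp
  | succ k ih =>
    have h₁ : (n : ℝ) * n.descFactorial k ≤ n.descFactorial (k + 1) + k * (n : ℝ) ^ k := by
      have h₂ : n * n.descFactorial k ≤ n.descFactorial (k + 1) + k * n.descFactorial k := by
        rw [Nat.descFactorial_succ, ← add_mul]
        exact Nat.mul_le_mul_right _ (by omega)
      have h₃ : (n.descFactorial k : ℝ) ≤ (n : ℝ) ^ k := by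
        exact_mod_cast Nat.descFactorial_le_pow n k
      calc (n : ℝ) * n.descFactorial k ≤ n.descFactorial (k + 1) + k * n.descFactorial k := by
            exact_mod_cast h₂
        _ ≤ _ := by gcongr
    have hn : (0 : ℝ) ≤ n := n.cast_nonneg
    have := mul_le_mul_of_nonneg_right ih hn
    have h₄ := mul_le_mul_of_nonneg_right h₁ hn
    have h₅ : 0 ≤ ((k : ℝ) + 1) * ((n : ℝ) ^ k * n) := by positivity
    push_cast
    rw [pow_succ]
    nlinarith

/-- Expanding the product of sums gives a sum over all maps. Subtracting the two counts gives the
number of non-injective ones, each of which contributes at most `M ^ |ι|`. -/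
theorem le_embSum {g : ι → T → ℝ} {M : ℝ} (hg : ∀ i t, 0 ≤ g i t) (hM : ∀ i t, g i t ≤ M) :
    (∏ i, ∑ t, g i t) - M ^ Fintype.card ι *
      ((Fintype.card T : ℝ) ^ Fintype.card ι -
        (Fintype.card T).descFactorial (Fintype.card ι)) ≤ embSum g := by
  classical
  rw [embSum, sum_embedding_eq fun f => ∏ i, g i (f i), Fintype.prod_sum,
    ← Finset.sum_filter_add_sum_filter_not Finset.univ fun f : ι → T => Function.Injective f]
  have hcard : ((Finset.univ.filter fun f : ι → T => ¬ Function.Injective f).card : ℝ) =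
      (Fintype.card T : ℝ) ^ Fintype.card ι -
        (Fintype.card T).descFactorial (Fintype.card ι) := by
    have h₁ := Finset.card_filter_add_card_filter_not (s := Finset.univ)
      fun f : ι → T => Function.Injective f
    rw [← Fintype.card_subtype, Fintype.card_congr (Equiv.subtypeInjectiveEquivEmbedding ι T),
      Fintype.card_embedding_eq, Finset.card_univ, Fintype.card_fun] at h₁
    rw [eq_sub_iff_add_eq']
    exact_mod_cast h₁
  have : ∑ f : ι → T with ¬ Function.Injective f, ∏ i, g i (f i) ≤
      M ^ Fintype.card ι * ((Fintype.card T : ℝ) ^ Fintype.card ι -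
        (Fintype.card T).descFactorial (Fintype.card ι)) := by
    rw [← hcard, mul_comm, ← nsmul_eq_mul, ← Finset.sum_const]
    refine Finset.sum_le_sum fun f _ => ?_
    rw [← Finset.card_univ, ← Finset.prod_const]
    exact Finset.prod_le_prod (fun i _ => hg _ _) fun i _ => hM _ _
  linarith

theorem embSum_div_le {g : ι → T → ℝ} (hg : ∀ i t, 0 ≤ g i t) :
    embSum g / (Fintype.card T : ℝ) ^ Fintype.card ι ≤ ∏ i, avg (g i) := by
  rw [prod_avg]
  gcongr
  exact embSum_le hg

theorem le_embSum_div [Nonempty T] {g : ι → T → ℝ} {M : ℝ} (hM₀ : 0 ≤ M) (hg : ∀ i t, 0 ≤ g i t)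
    (hM : ∀ i t, g i t ≤ M) :
    ∏ i, avg (g i) - M ^ Fintype.card ι * (Fintype.card ι : ℝ) ^ 2 / Fintype.card T ≤
      embSum g / (Fintype.card T : ℝ) ^ Fintype.card ι := by
  have hT : (0 : ℝ) < Fintype.card T := by exact_mod_cast Fintype.card_pos
  rw [prod_avg, le_div_iff₀ (by positivity), sub_mul, div_mul_cancel₀ _ (by positivity)]
  refine le_trans (sub_le_sub_left ?_ _) (le_embSum hg hM)
  rw [mul_div_assoc, mul_assoc]
  gcongr
  rw [div_mul_eq_mul_div, le_div_iff₀ hT]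
  have := pow_mul_le_descFactorial (Fintype.card T) (Fintype.card ι)
  linarith

/-- Sampling without replacement is asymptotically independent sampling when the summands are
uniformly bounded. Truncation provides this bound too. -/
theorem tendsto_embSum_div {I : Type*} {l : Filter I} {N : I → ℕ} [∀ i, NeZero (N i)]
    (hN : Tendsto N l atTop) {g : ∀ i, ι → Fin (N i) → ℝ} {M : ℝ} (hM₀ : 0 ≤ M)
    (hg : ∀ i j t, 0 ≤ g i j t) (hM : ∀ᶠ i in l, ∀ j t, g i j t ≤ M) {a : ι → ℝ}
    (ha : ∀ j, Tendsto (fun i => avg (g i j)) l (𝓝 (a j))) :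
    Tendsto (fun i => embSum (g i) / (N i : ℝ) ^ Fintype.card ι) l (𝓝 (∏ j, a j)) := by
  have h₁ : Tendsto (fun i => ∏ j, avg (g i j)) l (𝓝 (∏ j, a j)) := tendsto_finsetProd _ fun j _ => ha j
  have h₂ : Tendsto (fun i => ∏ j, avg (g i j) -
      M ^ Fintype.card ι * (Fintype.card ι : ℝ) ^ 2 / (N i : ℝ)) l (𝓝 (∏ j, a j)) := by
    have := (tendsto_natCast_atTop_atTop (R := ℝ)).comp hN
    simpa using h₁.sub (Tendsto.div_atTop (tendsto_const_nhds
      (x := M ^ Fintype.card ι * (Fintype.card ι : ℝ) ^ 2)) this)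
  refine tendsto_of_tendsto_of_tendsto_of_le_of_le' h₂ h₁ ?_ ?_
  · filter_upwards [hM] with i hi
    simpa using le_embSum_div hM₀ (hg i) hi
  · filter_upwards with i
    simpa using embSum_div_le (hg i)

end Embeddings

/-! ### Asymptotics of the factorial moments -/

section Asymptotics

/-- The limit of the expected number of trees, summed over all types. -/
def treeSum (m : ℕ) (γ : Setoid (Fin m) → ℝ) (α₁ α₂ : ℕ → ℝ) : ℝ :=
  ∑ π : Setoid (Fin m), γ π * (α₁ (Fintype.card (Quotient π)) * α₁ 1 ^ m) *
    ∏ q, α₂ (blk π q + 1)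

/-- Only orders between `1` and `m` in part 1 and between `1` and `m + 1` in part 2 occur. Order `0`
is left out on purpose: sending large values to `0` is harmless only where the falling factorial of
`0` vanishes. -/
theorem tendsto_treeSum {I : Type*} {l : Filter I} {m : ℕ} (hm : 1 ≤ m) {γ : Setoid (Fin m) → ℝ}
    {α₁ α₂ : ℕ → ℝ} {α₁' α₂' : I → ℕ → ℝ}
    (h₁ : ∀ a, 1 ≤ a → a ≤ m → Tendsto (fun i => α₁' i a) l (𝓝 (α₁ a)))
    (h₂ : ∀ a, 1 ≤ a → a ≤ m + 1 → Tendsto (fun i => α₂' i a) l (𝓝 (α₂ a))) :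
    Tendsto (fun i => treeSum m γ (α₁' i) (α₂' i)) l (𝓝 (treeSum m γ α₁ α₂)) := by
  refine tendsto_finsetSum _ fun π _ => ((tendsto_const_nhds.mul (Tendsto.mul ?_ ?_)).mul ?_)
  · exact h₁ _ (one_le_card_quotient hm π) (card_quotient_le π)
  · exact (h₁ 1 le_rfl hm).pow m
  · refine tendsto_finsetProd _ fun q _ => h₂ _ (by omega) (by have := blk_le π q; omega)

variable {I : Type*} {l : Filter I} {N₁ N₂ : I → ℕ} {m : ℕ}

/-- The weights in part 1 of a tree of type `π`. -/
def rootWeight {V : Type*} {m : ℕ} (π : Setoid (Fin m)) (φ : ℕ → V → ℝ) : Option (Fin m) → V → ℝ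
  | none => φ (Fintype.card (Quotient π))
  | some _ => φ 1

/-- The weights in part 2 of a tree of type `π`. -/
def midWeight {W : Type*} {m : ℕ} (π : Setoid (Fin m)) (φ : ℕ → W → ℝ) (q : Quotient π) : W → ℝ :=
  φ (blk π q + 1)

theorem prod_rootWeight {V : Type*} (π : Setoid (Fin m)) (φ : ℕ → V → ℝ) (x : Option (Fin m) → V) :
    ∏ o, rootWeight π φ o (x o) =
      φ (Fintype.card (Quotient π)) (x none) * ∏ i, φ 1 (x (some i)) :=
  Fintype.prod_option _

/-- The embeddings of the two parts are chosen independently, so the double sum factorises. -/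
theorem sum_mul_eq_embSum {V W : Type*} [Fintype V] [Fintype W] [Nonempty V]
    (π : Setoid (Fin m)) (c : ℝ) (φ₁ : ℕ → V → ℝ) (φ₂ : ℕ → W → ℝ)
    [Fintype (Option (Fin m) ↪ V)] [Fintype (Quotient π ↪ W)] :
    (Fintype.card V : ℝ)⁻¹ * ∑ x : Option (Fin m) ↪ V, ∑ e : Quotient π ↪ W,
      c * (∏ o, rootWeight π φ₁ o (x o)) * ∏ q, midWeight π φ₂ q (e q) =
    c * (Fintype.card V : ℝ) ^ m * embSum (midWeight π φ₂) *
      (embSum (rootWeight π φ₁) / (Fintype.card V : ℝ) ^ Fintype.card (Option (Fin m))) := by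
  have hV : (Fintype.card V : ℝ) ≠ 0 := by simp
  have h₁ : embSum (rootWeight π φ₁) = ∑ x : Option (Fin m) ↪ V, ∏ o, rootWeight π φ₁ o (x o) := by
    unfold embSum
    congr!
  have h₂ : embSum (midWeight π φ₂) = ∑ e : Quotient π ↪ W, ∏ q, midWeight π φ₂ q (e q) := by
    unfold embSum
    congr!
  rw [h₁, h₂]
  simp_rw [mul_assoc, ← Finset.mul_sum, ← Finset.sum_mul]
  simp only [Fintype.card_option, Fintype.card_fin]
  field_simp
  ring

theorem tendsto_avg_rootWeight (hm : 1 ≤ m) (π : Setoid (Fin m))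
    {φ : ∀ i, ℕ → Fin (N₁ i) → ℝ} {α : ℕ → ℝ}
    (hα : ∀ a, 1 ≤ a → a ≤ m → Tendsto (fun i => avg (φ i a)) l (𝓝 (α a))) (o : Option (Fin m)) :
    Tendsto (fun i => avg (rootWeight π (φ i) o)) l
      (𝓝 (o.elim (α (Fintype.card (Quotient π))) fun _ => α 1)) := by
  cases o with
  | none => exact hα _ (one_le_card_quotient hm π) (card_quotient_le π)
  | some i => exact hα 1 le_rfl hm

theorem prod_option_elim (a b : ℝ) :
    ∏ o : Option (Fin m), o.elim a (fun _ => b) = a * b ^ m := by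
  simp [Fintype.prod_option]

variable [∀ i, NeZero (N₁ i)] [∀ i, NeZero (N₂ i)]

/-- The upper bound common to the four models. The hypothesis `hc` says that `c` is of the order of
the reciprocal number of positions for the leaves and the middle vertices; sums over embeddings are
bounded by sums over all maps. -/
theorem eventually_facMom_le (hm : 1 ≤ m) (μ : ∀ i, Measure (BipGraph (Fin (N₁ i)) (Fin (N₂ i))))
    [∀ i, IsFiniteMeasure (μ i)] {c : I → Setoid (Fin m) → ℝ} (hc₀ : ∀ i π, 0 ≤ c i π)
    {φ₁ : ∀ i, ℕ → Fin (N₁ i) → ℝ} (h₁ : ∀ i a v, 0 ≤ φ₁ i a v)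
    {φ₂ : ∀ i, ℕ → Fin (N₂ i) → ℝ} (h₂ : ∀ i a w, 0 ≤ φ₂ i a w)
    (hμ : ∀ᶠ i in l, ∀ π x e, (μ i).real (incl (treeL π x) (treeR π e)) ≤
      c i π * (∏ o, rootWeight π (φ₁ i) o (x o)) * ∏ q, midWeight π (φ₂ i) q (e q))
    {γ : Setoid (Fin m) → ℝ} {α₁ α₂ : ℕ → ℝ}
    (hc : ∀ π, Tendsto (fun i => c i π * (N₁ i : ℝ) ^ m * (N₂ i : ℝ) ^ Fintype.card (Quotient π)) l
      (𝓝 (γ π)))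
    (hα₁ : ∀ a, 1 ≤ a → a ≤ m → Tendsto (fun i => avg (φ₁ i a)) l (𝓝 (α₁ a)))
    (hα₂ : ∀ a, 1 ≤ a → a ≤ m + 1 → Tendsto (fun i => avg (φ₂ i a)) l (𝓝 (α₂ a)))
    {b : ℝ} (hb : treeSum m γ α₁ α₂ < b) :
    ∀ᶠ i in l, facMom (μ i) m ≤ b := by
  have hlim : Tendsto (fun i => ∑ π : Setoid (Fin m),
      c i π * (N₁ i : ℝ) ^ m * (N₂ i : ℝ) ^ Fintype.card (Quotient π) *
        (∏ o, avg (rootWeight π (φ₁ i) o)) * ∏ q, avg (midWeight π (φ₂ i) q)) l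
      (𝓝 (treeSum m γ α₁ α₂)) := by
    refine tendsto_finsetSum _ fun π _ => ((hc π).mul ?_).mul ?_
    · rw [← prod_option_elim]
      exact tendsto_finsetProd _ fun o _ => tendsto_avg_rootWeight hm π hα₁ o
    · exact tendsto_finsetProd _ fun q _ => hα₂ _ (by omega) (by have := blk_le π q; omega)
  filter_upwards [hlim.eventually_lt_const hb, hμ] with i hi hμi
  refine (facMom_le _ _).trans ((Finset.sum_le_sum fun π _ => ?_).trans hi.le)
  classical
  have hr (o v) : 0 ≤ rootWeight π (φ₁ i) o v := by cases o <;> exact h₁ _ _ _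
  calc treeCount (μ i) π
      ≤ (Fintype.card (Fin (N₁ i)) : ℝ)⁻¹ * ∑ x : Option (Fin m) ↪ Fin (N₁ i),
        ∑ e : Quotient π ↪ Fin (N₂ i),
        c i π * (∏ o, rootWeight π (φ₁ i) o (x o)) * ∏ q, midWeight π (φ₂ i) q (e q) := by
        refine mul_le_mul_of_nonneg_left (Finset.sum_le_sum fun x _ =>
          Finset.sum_le_sum fun e _ => hμi π x e) (by positivity)
    _ = _ := sum_mul_eq_embSum _ _ _ _
    _ ≤ c i π * (Fintype.card (Fin (N₁ i)) : ℝ) ^ m *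
        ((Fintype.card (Fin (N₂ i)) : ℝ) ^ Fintype.card (Quotient π) *
          ∏ q, avg (midWeight π (φ₂ i) q)) * ∏ o, avg (rootWeight π (φ₁ i) o) := by
        have hmid : embSum (midWeight π (φ₂ i)) ≤
            (Fintype.card (Fin (N₂ i)) : ℝ) ^ Fintype.card (Quotient π) *
              ∏ q, avg (midWeight π (φ₂ i) q) := by
          have := embSum_div_le (g := midWeight π (φ₂ i)) fun q w => h₂ _ _ _
          have hp : (0 : ℝ) < (Fintype.card (Fin (N₂ i)) : ℝ) := by
            simpa using NeZero.pos (N₂ i)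
          rwa [div_le_iff₀' (by positivity)] at this
        have hav : 0 ≤ ∏ q, avg (midWeight π (φ₂ i) q) :=
          Finset.prod_nonneg fun q _ => avg_nonneg fun w => h₂ _ _ _
        have hroot := embSum_div_le hr
        have h0 := embSum_nonneg hr
        have := hc₀ i π
        have h0' := embSum_nonneg (g := midWeight π (φ₂ i)) fun q w => h₂ _ _ _
        gcongr
    _ = _ := by
        simp only [Fintype.card_fin]
        ring

/-- The lower bound common to the four models, with `μ'` the truncated model and `y` a bound for its
edge probabilities. The additive error `δ` is there for the configuration model, where tree
probabilities are not exact products; elsewhere it is taken to be `0`. -/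
theorem eventually_le_facMom (hm : 1 ≤ m) (hN₁ : Tendsto N₁ l atTop) (hN₂ : Tendsto N₂ l atTop)
    (μ μ' : ∀ i, Measure (BipGraph (Fin (N₁ i)) (Fin (N₂ i))))
    [∀ i, IsFiniteMeasure (μ i)] [∀ i, IsFiniteMeasure (μ' i)]
    (hmono : ∀ i, ∀ f : BipGraph (Fin (N₁ i)) (Fin (N₂ i)) → ℝ, Monotone f → 0 ≤ f →
      ∫ H, f H ∂(μ' i) ≤ ∫ H, f H ∂(μ i))
    {y : I → ℝ} (hy : ∀ i, 0 ≤ y i) {C : ℝ} (hyC₁ : ∀ᶠ i in l, N₁ i * y i ≤ C)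
    (hyC₂ : ∀ᶠ i in l, N₂ i * y i ≤ C)
    (hdom : ∀ᶠ i in l, ∀ E : Finset (Fin (N₁ i) × Fin (N₂ i)), E.card ≤ 2 * m + 2 →
      edgesProb (μ' i) E ≤ y i ^ E.card)
    {c δ : I → Setoid (Fin m) → ℝ}
    {φ₁ : ∀ i, ℕ → Fin (N₁ i) → ℝ} (h₁ : ∀ i a v, 0 ≤ φ₁ i a v)
    {φ₂ : ∀ i, ℕ → Fin (N₂ i) → ℝ} (h₂ : ∀ i a w, 0 ≤ φ₂ i a w)
    {M : ℝ} (hM₀ : 0 ≤ M) (hM₁ : ∀ᶠ i in l, ∀ a, 1 ≤ a → a ≤ m → ∀ v, φ₁ i a v ≤ M)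
    (hM₂ : ∀ᶠ i in l, ∀ a, 1 ≤ a → a ≤ m + 1 → ∀ v, φ₂ i a v ≤ M)
    (hμ : ∀ᶠ i in l, ∀ π x e,
      c i π * (∏ o, rootWeight π (φ₁ i) o (x o)) * (∏ q, midWeight π (φ₂ i) q (e q)) - δ i π ≤
      (μ' i).real (incl (treeL π x) (treeR π e)))
    {γ : Setoid (Fin m) → ℝ} {α₁ α₂ : ℕ → ℝ}
    (hc : ∀ π, Tendsto (fun i => c i π * (N₁ i : ℝ) ^ m * (N₂ i : ℝ) ^ Fintype.card (Quotient π)) l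
      (𝓝 (γ π)))
    (hδ₀ : ∀ i π, 0 ≤ δ i π)
    (hδ : ∀ π, Tendsto (fun i => δ i π * (N₁ i : ℝ) ^ m * (N₂ i : ℝ) ^ Fintype.card (Quotient π)) l
      (𝓝 0))
    (hα₁ : ∀ a, 1 ≤ a → a ≤ m → Tendsto (fun i => avg (φ₁ i a)) l (𝓝 (α₁ a)))
    (hα₂ : ∀ a, 1 ≤ a → a ≤ m + 1 → Tendsto (fun i => avg (φ₂ i a)) l (𝓝 (α₂ a)))
    {b : ℝ} (hb : b < treeSum m γ α₁ α₂) :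
    ∀ᶠ i in l, b ≤ facMom (μ i) m := by
  classical
  have hN₁' := (tendsto_natCast_atTop_atTop (R := ℝ)).comp hN₁
  -- The double-path bound with `N₁ * y` and `N₂ * y` replaced by `C`: in `N₁ ^ m * y ^ (m + 1)` one
  -- factor `N₁` is missing, which leaves `1 / N₁`.
  set R : I → ℝ := fun i => m * C ^ (m + 1) * (C + (m + 1 : ℕ)) ^ (m + 1) / N₁ i
  have hR : Tendsto R l (𝓝 0) := Tendsto.div_atTop tendsto_const_nhds hN₁'
  have hr (π : Setoid (Fin m)) (i o v) : 0 ≤ rootWeight π (φ₁ i) o v := by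
    cases o <;> exact h₁ _ _ _
  have hlim : Tendsto (fun i => (∑ π : Setoid (Fin m),
      (c i π * (N₁ i : ℝ) ^ m * (N₂ i : ℝ) ^ Fintype.card (Quotient π) *
        (embSum (rootWeight π (φ₁ i)) / (N₁ i : ℝ) ^ Fintype.card (Option (Fin m))) *
        (embSum (midWeight π (φ₂ i)) / (N₂ i : ℝ) ^ Fintype.card (Quotient π)) -
        δ i π * (N₁ i : ℝ) ^ m * (N₂ i : ℝ) ^ Fintype.card (Quotient π))) - R i) l
      (𝓝 (treeSum m γ α₁ α₂)) := by
    rw [← sub_zero (treeSum m γ α₁ α₂)]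
    refine Tendsto.sub (tendsto_finsetSum _ fun π _ => ?_) hR
    rw [← sub_zero (γ π * _ * _)]
    refine Tendsto.sub (((hc π).mul ?_).mul ?_) (hδ π)
    · rw [← prod_option_elim]
      refine tendsto_embSum_div hN₁ hM₀ (hr π) ?_ fun o => tendsto_avg_rootWeight hm π hα₁ o
      filter_upwards [hM₁] with i hi o v
      cases o with
      | none => exact hi _ (one_le_card_quotient hm π) (card_quotient_le π) v
      | some j => exact hi 1 le_rfl hm v
    · refine tendsto_embSum_div hN₂ hM₀ (fun i q w => h₂ _ _ _) ?_
        fun q => hα₂ _ (by omega) (by have := blk_le π q; omega)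
      filter_upwards [hM₂] with i hi q v
      exact hi _ (by omega) (by have := blk_le π q; omega) v
  filter_upwards [hlim.eventually_const_lt hb, hμ, hdom, hyC₁, hyC₂] with i hi hμi hdomi hC₁ hC₂
  refine hi.le.trans ?_
  have hpos : (0 : ℝ) < N₁ i := by exact_mod_cast NeZero.pos (N₁ i)
  have hpos₂ : (0 : ℝ) < N₂ i := by exact_mod_cast NeZero.pos (N₂ i)
  have hmain := sum_treeCount_le (μ i) (μ' i) m (hmono i) (hy i) hdomi
  have hcorr : m * (Fintype.card (Fin (N₁ i)) : ℝ) ^ m * y i ^ (m + 1) *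
        (Fintype.card (Fin (N₂ i)) * y i + (m + 1 : ℕ)) ^ (m + 1) ≤ R i := by
    have hyi := hy i
    have hC : 0 ≤ C := le_trans (by positivity) hC₁
    simp only [Fintype.card_fin, R]
    rw [le_div_iff₀ hpos]
    calc _ = m * (N₁ i * y i) ^ (m + 1) * (N₂ i * y i + (m + 1 : ℕ)) ^ (m + 1) := by ring
      _ ≤ _ := by gcongr
  have htree (π : Setoid (Fin m)) :
      c i π * (N₁ i : ℝ) ^ m * (N₂ i : ℝ) ^ Fintype.card (Quotient π) *
        (embSum (rootWeight π (φ₁ i)) / (N₁ i : ℝ) ^ Fintype.card (Option (Fin m))) *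
        (embSum (midWeight π (φ₂ i)) / (N₂ i : ℝ) ^ Fintype.card (Quotient π)) -
        δ i π * (N₁ i : ℝ) ^ m * (N₂ i : ℝ) ^ Fintype.card (Quotient π) ≤
      treeCount (μ' i) π := by
    calc _ ≤ c i π * (Fintype.card (Fin (N₁ i)) : ℝ) ^ m * embSum (midWeight π (φ₂ i)) *
          (embSum (rootWeight π (φ₁ i)) /
            (Fintype.card (Fin (N₁ i)) : ℝ) ^ Fintype.card (Option (Fin m))) -
          (Fintype.card (Fin (N₁ i)) : ℝ)⁻¹ * ∑ x : Option (Fin m) ↪ Fin (N₁ i),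
            ∑ e : Quotient π ↪ Fin (N₂ i), δ i π := by
          refine sub_le_sub (le_of_eq ?_) ?_
          · simp only [Fintype.card_fin]
            field_simp
          · rw [inv_mul_le_iff₀ (by simpa using hpos)]
            simp only [Finset.sum_const, Finset.card_univ, Fintype.card_embedding_eq,
              Fintype.card_fin, Fintype.card_option, nsmul_eq_mul]
            have e₁ : ((N₁ i).descFactorial (m + 1) : ℝ) ≤ (N₁ i : ℝ) ^ (m + 1) := by
              exact_mod_cast Nat.descFactorial_le_pow _ _
            have e₂ : ((N₂ i).descFactorial (Fintype.card (Quotient π)) : ℝ) ≤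
                (N₂ i : ℝ) ^ (Fintype.card (Quotient π)) := by
              exact_mod_cast Nat.descFactorial_le_pow _ _
            have := hδ₀ i π
            calc _ ≤ (N₁ i : ℝ) ^ (m + 1) * ((N₂ i : ℝ) ^ (Fintype.card (Quotient π)) * δ i π) := by
                  gcongr
              _ = _ := by ring
      _ = (Fintype.card (Fin (N₁ i)) : ℝ)⁻¹ * ∑ x : Option (Fin m) ↪ Fin (N₁ i),
            ∑ e : Quotient π ↪ Fin (N₂ i),
            (c i π * (∏ o, rootWeight π (φ₁ i) o (x o)) * (∏ q, midWeight π (φ₂ i) q (e q)) -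
              δ i π) := by
          rw [← sum_mul_eq_embSum]
          simp only [Finset.sum_sub_distrib, mul_sub]
      _ ≤ _ := by
          refine mul_le_mul_of_nonneg_left (Finset.sum_le_sum fun x _ =>
            Finset.sum_le_sum fun e _ => hμi π x e) (by positivity)
  have := Finset.sum_le_sum fun π (_ : π ∈ (Finset.univ : Finset (Setoid (Fin m)))) => htree π
  linarith

end Asymptotics

/-! ### Factorial moments -/

section FactorialMoments

/-- The factorial moment `E Z (Z - 1) ⋯ (Z - a + 1)` for `Z` with law `D`. -/
def fmom (D : Measure ℕ) (a : ℕ) : ℝ≥0∞ := ∫⁻ x, (x.descFactorial a : ℝ≥0∞) ∂D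

theorem fmom_zero (D : Measure ℕ) [IsProbabilityMeasure D] : fmom D 0 = 1 := by
  simp [fmom]

theorem fmom_one (D : Measure ℕ) : fmom D 1 = natMoment D 1 := by
  simp [fmom, natMoment]

theorem natMoment_lt_top_of_le {D : Measure ℕ} [IsProbabilityMeasure D] {a k : ℕ} (hak : a ≤ k)
    (h : natMoment D k < ⊤) : natMoment D a < ⊤ := by
  have hle : natMoment D a ≤ ∫⁻ x, ((x : ℝ≥0∞) ^ k + 1) ∂D := by
    refine lintegral_mono fun x => ?_
    rcases Nat.eq_zero_or_pos x with rfl | hx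
    · exact le_add_left (by simpa using pow_le_one₀ (n := a) (zero_le (a := (0 : ℝ≥0∞))) zero_le_one)
    · exact le_add_right (pow_le_pow_right₀ (by exact_mod_cast hx) hak)
  refine hle.trans_lt ?_
  rw [lintegral_add_right _ measurable_const]
  simpa [natMoment] using h

theorem fmom_le_natMoment (D : Measure ℕ) (a : ℕ) : fmom D a ≤ natMoment D a := by
  refine lintegral_mono fun x => ?_
  dsimp only
  exact_mod_cast Nat.descFactorial_le_pow x a

theorem fmom_lt_top {D : Measure ℕ} [IsProbabilityMeasure D] {a k : ℕ} (hak : a ≤ k)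
    (h : natMoment D k < ⊤) : fmom D a < ⊤ :=
  (fmom_le_natMoment D a).trans_lt (natMoment_lt_top_of_le hak h)

theorem isProbabilityMeasure_sizeBiased {D : Measure ℕ} (h₀ : 0 < natMoment D 1)
    (h₁ : natMoment D 1 < ⊤) : IsProbabilityMeasure (sizeBiased D) := by
  constructor
  rw [sizeBiased, Measure.smul_apply, withDensity_apply _ MeasurableSet.univ,
    Measure.restrict_univ, smul_eq_mul]
  have : ∫⁻ x, (x : ℝ≥0∞) ∂D = natMoment D 1 := by simp [natMoment]
  rw [this, ENNReal.inv_mul_cancel h₀.ne' h₁.ne]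

/-- Since `x` times the `a`-th falling factorial of `x - 1` is the `(a + 1)`-st of `x`, size-biasing
and then removing the parent edge raises the order by one. -/
theorem fmom_sizeBiased_map (D : Measure ℕ) (a : ℕ) :
    fmom ((sizeBiased D).map fun x => x - 1) a = (natMoment D 1)⁻¹ * fmom D (a + 1) := by
  rw [fmom, lintegral_map (by fun_prop) (by fun_prop), sizeBiased, lintegral_smul_measure,
    lintegral_withDensity_eq_lintegral_mul _ (by fun_prop) (by fun_prop), smul_eq_mul, fmom]
  congr 1
  refine lintegral_congr fun x => ?_
  cases x with
  | zero => simp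
  | succ x =>
    rw [Nat.succ_descFactorial_succ]
    simp

/-- Powers are combinations of falling factorials. -/
theorem exists_pow_eq_sum_descFactorial (k : ℕ) :
    ∃ c : ℕ → ℕ, ∀ x : ℕ, x ^ k = ∑ m ∈ Finset.range (k + 1), c m * x.descFactorial m := by
  induction k with
  | zero => exact ⟨fun _ => 1, by simp⟩
  | succ k ih =>
    obtain ⟨c, hc⟩ := ih
    -- The recursion of the Stirling numbers of the second kind. The conditionals handle the missing
    -- index `m - 1` at `0` and discard `c (k + 1)`, about which nothing is known.
    refine ⟨fun m => (if m = 0 then 0 else c (m - 1)) + (if m ≤ k then c m * m else 0),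
      fun x => ?_⟩
    have hx (m : ℕ) : x * x.descFactorial m = x.descFactorial (m + 1) + m * x.descFactorial m := by
      rw [Nat.descFactorial_succ, ← add_mul]
      rcases le_or_gt m x with h | h
      · rw [Nat.sub_add_cancel h]
      · simp [Nat.descFactorial_eq_zero_iff_lt.2 h]
    rw [pow_succ, hc, Finset.sum_mul]
    simp_rw [add_mul, Finset.sum_add_distrib]
    rw [Finset.sum_range_succ' (fun m => (if m = 0 then 0 else c (m - 1)) * x.descFactorial m),
      Finset.sum_range_succ (fun m => (if m ≤ k then c m * m else 0) * x.descFactorial m)]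
    simp only [Nat.add_eq_zero_iff, one_ne_zero, and_false, if_false, Nat.add_sub_cancel, if_true,
      zero_mul, add_zero, Nat.not_succ_le_self]
    rw [← Finset.sum_add_distrib]
    refine Finset.sum_congr rfl fun m hm => ?_
    rw [if_pos (Finset.mem_range_succ_iff.1 hm), mul_assoc, mul_comm (x.descFactorial m), hx]
    ring

end FactorialMoments

/-! ### The degree of the root of the tree -/

section TreeRoot

/-- The number of grandchildren of the root. -/
def grandchildren (N : List ℕ → ℕ) : ℕ := ∑ i : Fin (N []), N [(i : ℕ)]

/-- The neighbours of the root in the intersection graph are its grandchildren. -/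
def neighborSetTreeRootEquiv (N : List ℕ → ℕ) :
    (intersectionGraph (treeGraph N)).neighborSet (treeRoot N) ≃
      (i : Fin (N [])) × Fin (N [(i : ℕ)]) := by
  refine (Equiv.ofBijective (fun p : (i : Fin (N [])) × Fin (N [(i : ℕ)]) =>
    (⟨⟨[(p.2 : ℕ), (p.1 : ℕ)], ⟨⟨⟨trivial, p.1.2⟩, p.2.2⟩, by simp⟩⟩, ?_, ?_⟩ :
      (intersectionGraph (treeGraph N)).neighborSet (treeRoot N))) ⟨?_, ?_⟩).symm
  · intro h
    simpa [treeRoot] using congrArg Subtype.val h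
  · exact ⟨⟨[(p.1 : ℕ)], ⟨trivial, p.1.2⟩, by simp⟩, ⟨p.1, .inl rfl⟩, ⟨p.2, .inr rfl⟩⟩
  · rintro ⟨i, j⟩ ⟨i', j'⟩ h
    have h' := congrArg (fun v => v.1.1) h
    simp only [List.cons.injEq, and_true] at h'
    obtain ⟨h₁, h₂⟩ := h'
    obtain rfl : i = i' := Fin.ext h₂
    obtain rfl : j = j' := Fin.ext h₁
    rfl
  · rintro ⟨⟨v, hv, hv'⟩, hne, ⟨w, hw, hw'⟩, ⟨i, hi⟩, ⟨j, hj⟩⟩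
    simp only [treeRoot, reduceCtorEq, or_false] at hi hj
    subst hi
    -- Besides its children, the only neighbour of a child of the root is the root itself, which
    -- `hne` excludes.
    rcases hj with hj | rfl
    · simp only [List.cons.injEq] at hj
      exact absurd (Subtype.ext hj.2) hne
    · exact ⟨⟨⟨i, hv.1.2⟩, ⟨j, hv.2⟩⟩, rfl⟩

theorem ideg_treeRoot (N : List ℕ → ℕ) :
    ideg (treeGraph N) (treeRoot N) = (grandchildren N : ℕ∞) := by
  rw [ideg, Set.encard, ENat.card_congr (neighborSetTreeRootEquiv N),
    ENat.card_eq_coe_fintype_card]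
  simp [grandchildren]

/-- The limit of the `m`-th factorial moment of the degree. -/
def limFac (D₁ D₂ : Measure ℕ) (m : ℕ) : ℝ≥0∞ :=
  ∑ π : Setoid (Fin m), fmom D₁ (Fintype.card (Quotient π)) *
    ∏ q, ((natMoment D₂ 1)⁻¹ * fmom D₂ (blk π q + 1))

/-- All maps with kernel `π` give the same product because `φ 0 = 1`, and they correspond to the
injections of the blocks into `Fin r`. -/
theorem sum_prod_fib_eq {R : Type*} [CommSemiring R] (m r : ℕ) (φ : ℕ → R) (hφ : φ 0 = 1) :
    ∑ w : Fin m → Fin r, ∏ t, φ (fib w t) =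
      ∑ π : Setoid (Fin m), (r.descFactorial (Fintype.card (Quotient π)) : R) *
        ∏ q, φ (blk π q) := by
  classical
  rw [sum_fun_eq_sum_setoid]
  refine Finset.sum_congr rfl fun π _ => ?_
  have (e : Quotient π ↪ Fin r) : ∏ t, φ (fib (fun i => e (Quotient.mk π i)) t) =
      ∏ q, φ (blk π q) :=
    prod_fib_comp_embedding _ e (fun _ => φ) fun _ => hφ
  simp_rw [this]
  rw [Finset.sum_const, Finset.card_univ, Fintype.card_embedding_eq, Fintype.card_fin,
    nsmul_eq_mul]

theorem isProbabilityMeasure_offspringLaw {D₁ D₂ : Measure ℕ} [IsProbabilityMeasure D₁]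
    (h₁ : 0 < natMoment D₁ 1) (h₁' : natMoment D₁ 1 < ⊤)
    (h₂ : 0 < natMoment D₂ 1) (h₂' : natMoment D₂ 1 < ⊤) (u : List ℕ) :
    IsProbabilityMeasure (offspringLaw D₁ D₂ u) := by
  have := isProbabilityMeasure_sizeBiased h₁ h₁'
  have := isProbabilityMeasure_sizeBiased h₂ h₂'
  unfold offspringLaw
  split_ifs
  · infer_instance
  · exact Measure.isProbabilityMeasure_map (by fun_prop)
  · exact Measure.isProbabilityMeasure_map (by fun_prop)

/-- The root and the labels `[0], …, [r - 1]` are distinct nodes, so their offspring numbers are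
independent coordinates. -/
theorem lintegral_treeLaw_prod {D₁ D₂ : Measure ℕ}
    (h : ∀ u, IsProbabilityMeasure (offspringLaw D₁ D₂ u)) (r : ℕ) (f : ℕ → ℝ≥0∞)
    (g : Fin r → ℕ → ℝ≥0∞) :
    ∫⁻ N, f (N []) * ∏ t : Fin r, g t (N [(t : ℕ)]) ∂(treeLaw D₁ D₂) =
      (∫⁻ x, f x ∂D₁) * ∏ t, ∫⁻ x, g t x ∂((sizeBiased D₂).map fun x => x - 1) := by
  set X : Option (Fin r) → List ℕ := fun o => o.elim [] fun t => [(t : ℕ)]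
  set F : Option (Fin r) → ℕ → ℝ≥0∞ := fun o => o.elim f g
  have hX : Function.Injective X := by
    rintro (_ | t) (_ | t') hh
    · rfl
    · simp [X] at hh
    · simp [X] at hh
    · simpa [X, Fin.ext_iff] using hh
  have hind : iIndepFun (fun o (N : List ℕ → ℕ) => N (X o)) (treeLaw D₁ D₂) :=
    (iIndepFun_infinitePi (P := offspringLaw D₁ D₂) (X := fun _ x => x)
      (fun _ => measurable_id)).precomp hX
  have hind' := hind.comp (mγ := fun _ => inferInstance) F fun o => by fun_prop
  have := lintegral_prod_eq_prod_lintegral_of_indepFun Finset.univ _ hind' fun o => by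
    refine Measurable.comp (by fun_prop) (by fun_prop)
  have hmarg (o) : ∫⁻ N, F o (N (X o)) ∂(treeLaw D₁ D₂) = ∫⁻ x, F o x ∂(offspringLaw D₁ D₂ (X o)) := by
    rw [← Measure.infinitePi_map_eval (offspringLaw D₁ D₂) (X o),
      lintegral_map (by fun_prop) (by fun_prop), treeLaw]
  simp only [Function.comp_def, hmarg, Fintype.prod_option] at this
  simpa [X, F, offspringLaw] using this

/-- Given `r` children of the root, the grandchildren are a sum of `r` independent numbers. Its
falling factorial expands over maps `Fin m → Fin r`, hence over partitions, and averaging the factor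
for `|π|` over `r` gives `fmom D₁`. -/
theorem lintegral_descFactorial_grandchildren {D₁ D₂ : Measure ℕ} [IsProbabilityMeasure D₁]
    (h₁ : 0 < natMoment D₁ 1) (h₁' : natMoment D₁ 1 < ⊤)
    (h₂ : 0 < natMoment D₂ 1) (h₂' : natMoment D₂ 1 < ⊤) (m : ℕ) :
    ∫⁻ N, ((grandchildren N).descFactorial m : ℝ≥0∞) ∂(treeLaw D₁ D₂) = limFac D₁ D₂ m := by
  classical
  have hprob := isProbabilityMeasure_offspringLaw h₁ h₁' h₂ h₂'
  have := isProbabilityMeasure_sizeBiased h₂ h₂'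
  have : IsProbabilityMeasure ((sizeBiased D₂).map fun x => x - 1) :=
    Measure.isProbabilityMeasure_map (by fun_prop)
  set B := (sizeBiased D₂).map fun x => x - 1
  -- The index type `Fin (N [])` is random; summing over `r` with the indicator of `N [] = r`
  -- replaces it by fixed types.
  have hsplit (N : List ℕ → ℕ) : ((grandchildren N).descFactorial m : ℝ≥0∞) =
      ∑' r : ℕ, ∑ w : Fin m → Fin r, (if N [] = r then 1 else 0) *
        ∏ t : Fin r, ((N [(t : ℕ)]).descFactorial (fib w t) : ℝ≥0∞) := by
    rw [tsum_eq_single (N [])]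
    · have := descFactorial_sum (ι := Fin m) fun i : Fin (N []) => N [(i : ℕ)]
      rw [Fintype.card_fin] at this
      rw [grandchildren, this]
      push_cast
      refine Finset.sum_congr ?_ fun w _ => by simp
      congr!
    · intro r hr
      simp [hr.symm]
  have hmeas (r : ℕ) (w : Fin m → Fin r) : Measurable fun N : List ℕ → ℕ =>
      (if N [] = r then 1 else 0) *
        ∏ t : Fin r, ((N [(t : ℕ)]).descFactorial (fib w t) : ℝ≥0∞) :=
    ((measurable_of_countable fun x : ℕ => if x = r then (1 : ℝ≥0∞) else 0).comp
      (measurable_pi_apply [])).mul (by fun_prop)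
  simp_rw [hsplit]
  rw [lintegral_tsum fun r => (Finset.measurable_fun_sum _ fun w _ => hmeas r w).aemeasurable]
  have hr (r : ℕ) : ∫⁻ N, ∑ w : Fin m → Fin r, (if N [] = r then 1 else 0) *
        ∏ t : Fin r, ((N [(t : ℕ)]).descFactorial (fib w t) : ℝ≥0∞) ∂(treeLaw D₁ D₂) =
      ∑ π : Setoid (Fin m), ((r.descFactorial (Fintype.card (Quotient π)) : ℝ≥0∞) * D₁ {r}) *
        ∏ q, fmom B (blk π q) := by
    rw [lintegral_finsetSum _ fun w _ => hmeas r w]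
    have hw (w : Fin m → Fin r) : ∫⁻ N, (if N [] = r then 1 else 0) *
        ∏ t : Fin r, ((N [(t : ℕ)]).descFactorial (fib w t) : ℝ≥0∞) ∂(treeLaw D₁ D₂) =
        D₁ {r} * ∏ t, fmom B (fib w t) := by
      rw [lintegral_treeLaw_prod hprob r (fun x => if x = r then 1 else 0)
        fun t x => (x.descFactorial (fib w t) : ℝ≥0∞)]
      congr 1
      rw [← lintegral_indicator_one (MeasurableSet.singleton r)]
      refine lintegral_congr fun x => ?_
      simp [Set.indicator_apply]
    simp_rw [hw]
    rw [← Finset.mul_sum, sum_prod_fib_eq m r _ (fmom_zero B), Finset.mul_sum]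
    refine Finset.sum_congr rfl fun π _ => by ring
  simp_rw [hr]
  rw [Summable.tsum_finsetSum fun _ _ => ENNReal.summable]
  refine Finset.sum_congr rfl fun π _ => ?_
  rw [ENNReal.tsum_mul_right]
  congr 1
  · rw [fmom, lintegral_countable']
  · exact Finset.prod_congr rfl fun q _ => fmom_sizeBiased_map _ _

end TreeRoot

/-! ### Reduction of the moments to the factorial moments -/

section Reduction

theorem lintegral_withVertex₁ {n₁ n₂ : ℕ} [NeZero n₁] (μ : Measure (BipGraph (Fin n₁) (Fin n₂)))
    [IsFiniteMeasure μ] (f : BipGraph (Fin n₁) (Fin n₂) × Fin n₁ → ℝ≥0∞) :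
    ∫⁻ p, f p ∂(withVertex₁ μ) = (n₁ : ℝ≥0∞)⁻¹ * ∫⁻ H, ∑ u, f (H, u) ∂μ := by
  rw [withVertex₁, lintegral_prod _ (measurable_of_countable f).aemeasurable,
    ← lintegral_const_mul _ (measurable_of_countable _)]
  refine lintegral_congr fun H => ?_
  rw [lintegral_fintype, Finset.mul_sum]
  refine Finset.sum_congr rfl fun u _ => ?_
  rw [PMF.toMeasure_apply_singleton _ _ (MeasurableSet.singleton u), PMF.uniformOfFintype_apply,
    Fintype.card_fin, mul_comm]

theorem lintegral_withVertex₂ {n₁ n₂ : ℕ} [NeZero n₂] (μ : Measure (BipGraph (Fin n₁) (Fin n₂)))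
    [IsFiniteMeasure μ] (f : BipGraph (Fin n₁) (Fin n₂) × Fin n₂ → ℝ≥0∞) :
    ∫⁻ p, f p ∂(withVertex₂ μ) = (n₂ : ℝ≥0∞)⁻¹ * ∫⁻ H, ∑ u, f (H, u) ∂μ := by
  rw [withVertex₂, lintegral_prod _ (measurable_of_countable f).aemeasurable,
    ← lintegral_const_mul _ (measurable_of_countable _)]
  refine lintegral_congr fun H => ?_
  rw [lintegral_fintype, Finset.mul_sum]
  refine Finset.sum_congr rfl fun u _ => ?_
  rw [PMF.toMeasure_apply_singleton _ _ (MeasurableSet.singleton u), PMF.uniformOfFintype_apply,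
    Fintype.card_fin, mul_comm]

theorem facMom_nonneg {V W : Type*} [Fintype V] [Fintype W] (μ : Measure (BipGraph V W)) (m : ℕ) :
    0 ≤ facMom μ m :=
  mul_nonneg (by positivity) (integral_nonneg fun H => by positivity)

theorem ofReal_facMom {n₁ n₂ : ℕ} [NeZero n₁] (μ : Measure (BipGraph (Fin n₁) (Fin n₂)))
    [IsFiniteMeasure μ] (m : ℕ) :
    ENNReal.ofReal (facMom μ m) =
      (n₁ : ℝ≥0∞)⁻¹ * ∫⁻ H, ∑ u, ((natDeg H u).descFactorial m : ℝ≥0∞) ∂μ := by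
  have hn : (0 : ℝ) < n₁ := by exact_mod_cast NeZero.pos n₁
  rw [facMom, ENNReal.ofReal_mul (by positivity), Fintype.card_fin, ENNReal.ofReal_inv_of_pos hn,
    ENNReal.ofReal_natCast, ofReal_integral_eq_lintegral_ofReal .of_finite
      (.of_forall fun H => Finset.sum_nonneg fun _ _ => Nat.cast_nonneg _)]
  congr 1
  refine lintegral_congr fun H => ?_
  rw [ENNReal.ofReal_sum_of_nonneg fun _ _ => Nat.cast_nonneg _]
  simp

theorem facMom_zero {n₁ n₂ : ℕ} [NeZero n₁] (μ : Measure (BipGraph (Fin n₁) (Fin n₂)))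
    [IsProbabilityMeasure μ] : facMom μ 0 = 1 := by
  simp [facMom]

theorem degreeMoment_eq {n₁ n₂ : ℕ} [NeZero n₁] (μ : Measure (BipGraph (Fin n₁) (Fin n₂)))
    [IsFiniteMeasure μ] {k : ℕ} {c : ℕ → ℕ}
    (hc : ∀ x : ℕ, x ^ k = ∑ m ∈ Finset.range (k + 1), c m * x.descFactorial m) :
    degreeMoment μ k = ∑ m ∈ Finset.range (k + 1), c m * ENNReal.ofReal (facMom μ m) := by
  rw [degreeMoment, lintegral_withVertex₁]
  simp_rw [ofReal_facMom, ideg_eq_natDeg]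
  have hpow (x : ℕ) : (((x : ℕ∞) : ℝ≥0∞)) ^ k =
      ∑ m ∈ Finset.range (k + 1), (c m : ℝ≥0∞) * (x.descFactorial m : ℝ≥0∞) := by
    rw [ENat.toENNReal_coe]
    exact_mod_cast hc x
  simp_rw [hpow]
  have (H : BipGraph (Fin n₁) (Fin n₂)) : ∑ u, ∑ m ∈ Finset.range (k + 1),
      (c m : ℝ≥0∞) * ((natDeg H u).descFactorial m : ℝ≥0∞) =
      ∑ m ∈ Finset.range (k + 1), c m * ∑ u, ((natDeg H u).descFactorial m : ℝ≥0∞) := by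
    rw [Finset.sum_comm]
    simp_rw [Finset.mul_sum]
  simp_rw [this]
  rw [lintegral_finsetSum _ fun _ _ => measurable_of_countable _, Finset.mul_sum]
  refine Finset.sum_congr rfl fun m _ => ?_
  rw [lintegral_const_mul _ (measurable_of_countable _)]
  ring

theorem limitDegreeMoment_eq {D₁ D₂ : Measure ℕ} [IsProbabilityMeasure D₁]
    (h₁ : 0 < natMoment D₁ 1) (h₁' : natMoment D₁ 1 < ⊤)
    (h₂ : 0 < natMoment D₂ 1) (h₂' : natMoment D₂ 1 < ⊤) {k : ℕ} {c : ℕ → ℕ}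
    (hc : ∀ x : ℕ, x ^ k = ∑ m ∈ Finset.range (k + 1), c m * x.descFactorial m) :
    limitDegreeMoment D₁ D₂ k = ∑ m ∈ Finset.range (k + 1), c m * limFac D₁ D₂ m := by
  have hmeas : Measurable fun N : List ℕ → ℕ => grandchildren N := by
    have : grandchildren = fun N => ∑ i ∈ Finset.range (N []), N [i] := by
      funext N
      exact Fin.sum_univ_eq_sum_range (fun i => N [i]) _
    rw [this]
    -- The range of summation is random too; as it takes countably many values, a fixed range
    -- suffices.
    have hp : Measurable fun p : ℕ × (List ℕ → ℕ) => ∑ i ∈ Finset.range p.1, p.2 [i] :=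
      measurable_from_prod_countable_right fun x => by
        dsimp only
        fun_prop
    have := hp.comp ((measurable_pi_apply (X := fun _ => ℕ) ([] : List ℕ)).prodMk measurable_id)
    exact this
  simp_rw [← lintegral_descFactorial_grandchildren h₁ h₁' h₂ h₂', limitDegreeMoment, ideg_treeRoot]
  have hpow (x : ℕ) : (((x : ℕ∞) : ℝ≥0∞)) ^ k =
      ∑ m ∈ Finset.range (k + 1), (c m : ℝ≥0∞) * (x.descFactorial m : ℝ≥0∞) := by
    rw [ENat.toENNReal_coe]
    exact_mod_cast hc x
  have hm (m : ℕ) : Measurable fun N => ((grandchildren N).descFactorial m : ℝ≥0∞) :=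
    (measurable_of_countable fun x : ℕ => (x.descFactorial m : ℝ≥0∞)).comp hmeas
  simp_rw [hpow]
  rw [lintegral_finsetSum _ fun m _ => (hm m).const_mul _]
  exact Finset.sum_congr rfl fun m _ => lintegral_const_mul _ (hm m)

theorem limFac_lt_top {D₁ D₂ : Measure ℕ} [IsProbabilityMeasure D₁] [IsProbabilityMeasure D₂]
    (h₂ : 0 < natMoment D₂ 1) {m k : ℕ} (hmk : m ≤ k) (hk₁ : natMoment D₁ k < ⊤)
    (hk₂ : natMoment D₂ (k + 1) < ⊤) : limFac D₁ D₂ m < ⊤ := by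
  refine ENNReal.sum_lt_top.2 fun π _ => ENNReal.mul_lt_top ?_ (ENNReal.prod_lt_top fun q _ => ?_)
  · exact fmom_lt_top ((card_quotient_le π).trans hmk) hk₁
  · refine ENNReal.mul_lt_top (ENNReal.inv_lt_top.2 h₂) (fmom_lt_top ?_ hk₂)
    have := blk_le π q
    omega

theorem limFac_zero {D₁ D₂ : Measure ℕ} [IsProbabilityMeasure D₁]
    (h₁ : 0 < natMoment D₁ 1) (h₁' : natMoment D₁ 1 < ⊤)
    (h₂ : 0 < natMoment D₂ 1) (h₂' : natMoment D₂ 1 < ⊤) : limFac D₁ D₂ 0 = 1 := by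
  have := isProbabilityMeasure_offspringLaw h₁ h₁' h₂ h₂'
  rw [← lintegral_descFactorial_grandchildren h₁ h₁' h₂ h₂']
  simp [treeLaw]

/-- Convergence of the factorial moments implies convergence of the moments. -/
theorem tendsto_degreeMoment {n₁ n₂ : ℕ → ℕ} [∀ n, NeZero (n₁ n)]
    {μ : ∀ n, Measure (BipGraph (Fin (n₁ n)) (Fin (n₂ n)))} [∀ n, IsProbabilityMeasure (μ n)]
    {D₁ D₂ : Measure ℕ} [IsProbabilityMeasure D₁] [IsProbabilityMeasure D₂]
    (h₁ : 0 < natMoment D₁ 1) (h₂ : 0 < natMoment D₂ 1) {k : ℕ} (hk : 1 ≤ k)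
    (hk₁ : natMoment D₁ k < ⊤) (hk₂ : natMoment D₂ (k + 1) < ⊤)
    (h : ∀ m, 1 ≤ m → m ≤ k →
      Tendsto (fun n => facMom (μ n) m) atTop (𝓝 (limFac D₁ D₂ m).toReal)) :
    limitDegreeMoment D₁ D₂ k < ⊤ ∧
      Tendsto (fun n => degreeMoment (μ n) k) atTop (𝓝 (limitDegreeMoment D₁ D₂ k)) := by
  have h₁' := natMoment_lt_top_of_le hk hk₁
  have h₂' := natMoment_lt_top_of_le (by omega : 1 ≤ k + 1) hk₂
  obtain ⟨c, hc⟩ := exists_pow_eq_sum_descFactorial k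
  have hlt (m) (hm : m ∈ Finset.range (k + 1)) : limFac D₁ D₂ m < ⊤ :=
    limFac_lt_top h₂ (Finset.mem_range_succ_iff.1 hm) hk₁ hk₂
  rw [limitDegreeMoment_eq h₁ h₁' h₂ h₂' hc]
  simp_rw [degreeMoment_eq _ hc]
  refine ⟨ENNReal.sum_lt_top.2 fun m hm => ENNReal.mul_lt_top (by simp) (hlt m hm),
    tendsto_finsetSum _ fun m hm => ENNReal.Tendsto.const_mul ?_ (.inr (by simp))⟩
  rw [← ENNReal.ofReal_toReal (hlt m hm).ne]
  refine ENNReal.tendsto_ofReal ?_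
  rcases Nat.eq_zero_or_pos m with rfl | hm0
  · simp [facMom_zero, limFac_zero h₁ h₁' h₂ h₂']
  · exact h m hm0 (Finset.mem_range_succ_iff.1 hm)

/-- Leaves to each model one identity per partition, matching the normalisation of its tree counts
with the size-biasing factors. -/
theorem toReal_limFac {D₁ D₂ : Measure ℕ} {m : ℕ} {γ : Setoid (Fin m) → ℝ} {α₁ α₂ : ℕ → ℝ}
    (hlt : limFac D₁ D₂ m < ⊤)
    (h : ∀ π : Setoid (Fin m), γ π * (α₁ (Fintype.card (Quotient π)) * α₁ 1 ^ m) *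
      ∏ q, α₂ (blk π q + 1) = (fmom D₁ (Fintype.card (Quotient π))).toReal *
        ∏ q, ((natMoment D₂ 1).toReal⁻¹ * (fmom D₂ (blk π q + 1)).toReal)) :
    (limFac D₁ D₂ m).toReal = treeSum m γ α₁ α₂ := by
  rw [limFac, ENNReal.toReal_sum fun π hπ => ((ENNReal.sum_lt_top.1 hlt) π hπ).ne]
  refine Finset.sum_congr rfl fun π _ => ?_
  rw [h, ENNReal.toReal_mul, ENNReal.toReal_prod]
  simp_rw [ENNReal.toReal_mul, ENNReal.toReal_inv]

/-- Each truncation level `K` has its own lower bound and its own limit in `n`; no uniformity in `K`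
is needed. -/
theorem tendsto_of_eventually_le {u : ℕ → ℝ} {σ : ℝ} {s : ℕ → ℝ} (hs : Tendsto s atTop (𝓝 σ))
    (hu : ∀ b, σ < b → ∀ᶠ n in atTop, u n ≤ b)
    (hl : ∀ K b, b < s K → ∀ᶠ n in atTop, b ≤ u n) : Tendsto u atTop (𝓝 σ) := by
  refine tendsto_order.2 ⟨fun a ha => ?_, fun a ha => ?_⟩
  · obtain ⟨b, hab, hb⟩ := exists_between ha
    obtain ⟨K, hK⟩ := (hs.eventually_const_lt hb).exists
    filter_upwards [hl K b hK] with n hn using hab.trans_le hn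
  · obtain ⟨b, hab, hb⟩ := exists_between ha
    filter_upwards [hu b hab] with n hn using hn.trans_lt hb

end Reduction

/-! ### Convergence of moments of laws on the natural numbers -/

section NatLaws

/-- Fatou's lemma for the counting measure, applied to the point masses. -/
theorem eventually_le_add_of_tendsto_singleton {Q : ℕ → Measure ℕ} {D : Measure ℕ}
    (hQ : ∀ x, Tendsto (fun n => Q n {x}) atTop (𝓝 (D {x}))) {f : ℕ → ℝ≥0∞} (hf : ∀ x, f x ≠ ⊤)
    (hD : ∫⁻ x, f x ∂D ≠ ⊤) {ε : ℝ≥0∞} (hε : 0 < ε) :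
    ∀ᶠ n in atTop, ∫⁻ x, f x ∂D ≤ ∫⁻ x, f x ∂(Q n) + ε := by
  have hle : ∫⁻ x, f x ∂D ≤ liminf (fun n => ∫⁻ x, f x ∂(Q n)) atTop := by
    simp_rw [lintegral_countable' (f := f), ← lintegral_count]
    refine le_trans (lintegral_mono fun x => ?_) (lintegral_liminf_le fun n =>
      measurable_of_countable _)
    exact (ENNReal.Tendsto.const_mul (hQ x) (.inr (hf x))).liminf_eq.ge
  rcases eq_or_ne (∫⁻ x, f x ∂D) 0 with h0 | h0
  · simp [h0]
  have hlt : ∫⁻ x, f x ∂D - ε < liminf (fun n => ∫⁻ x, f x ∂(Q n)) atTop :=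
    (ENNReal.sub_lt_self hD h0 hε.ne').trans_le hle
  filter_upwards [eventually_lt_of_lt_liminf hlt] with n hn
  exact tsub_le_iff_right.1 hn.le

/-- Dominated convergence under varying laws: Fatou applies to `f` and to `g - f`, and since the
integrals of `g` converge, the lower bound for `g - f` is an upper bound for `f`. -/
theorem tendsto_lintegral_of_le {Q : ℕ → Measure ℕ} {D : Measure ℕ}
    (hQ : ∀ x, Tendsto (fun n => Q n {x}) atTop (𝓝 (D {x}))) {f g : ℕ → ℝ≥0∞} (hfg : f ≤ g)
    (hg : ∀ x, g x ≠ ⊤) (hD : ∫⁻ x, g x ∂D ≠ ⊤)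
    (hlim : Tendsto (fun n => ∫⁻ x, g x ∂(Q n)) atTop (𝓝 (∫⁻ x, g x ∂D))) :
    Tendsto (fun n => ∫⁻ x, f x ∂(Q n)) atTop (𝓝 (∫⁻ x, f x ∂D)) := by
  have hadd (P : Measure ℕ) : ∫⁻ x, g x ∂P = ∫⁻ x, f x ∂P + ∫⁻ x, (g x - f x) ∂P := by
    rw [← lintegral_add_left (measurable_of_countable f)]
    exact lintegral_congr fun x => (add_tsub_cancel_of_le (hfg x)).symm
  have hfD : ∫⁻ x, f x ∂D ≠ ⊤ := ne_top_of_le_ne_top hD (lintegral_mono hfg)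
  have hgD : ∫⁻ x, (g x - f x) ∂D ≠ ⊤ :=
    ne_top_of_le_ne_top hD (lintegral_mono fun x => tsub_le_self)
  rw [ENNReal.tendsto_nhds hfD]
  intro ε hε
  have hε2 : 0 < ε / 2 := ENNReal.half_pos hε.ne'
  filter_upwards [eventually_le_add_of_tendsto_singleton hQ (f := f)
      (fun x => ne_top_of_le_ne_top (hg x) (hfg x)) hfD hε,
    eventually_le_add_of_tendsto_singleton hQ (f := fun x => g x - f x)
      (fun x => ne_top_of_le_ne_top (hg x) tsub_le_self) hgD hε2,
    ((ENNReal.tendsto_nhds hD).1 hlim) (ε / 2) hε2] with n h₁ h₂ h₃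
  refine ⟨tsub_le_iff_right.2 h₁, ?_⟩
  refine (ENNReal.add_le_add_iff_right hgD).1 ?_
  calc ∫⁻ x, f x ∂(Q n) + ∫⁻ x, (g x - f x) ∂D
      ≤ ∫⁻ x, f x ∂(Q n) + (∫⁻ x, (g x - f x) ∂(Q n) + ε / 2) := by gcongr
    _ = ∫⁻ x, g x ∂(Q n) + ε / 2 := by rw [hadd, add_assoc]
    _ ≤ ∫⁻ x, g x ∂D + ε / 2 + ε / 2 := by
        gcongr
        exact h₃.2
    _ = _ := by
        rw [hadd, add_assoc, ENNReal.add_halves]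
        ring

theorem tendsto_fmom {Q : ℕ → Measure ℕ} {D : Measure ℕ} [∀ n, IsProbabilityMeasure (Q n)]
    [IsProbabilityMeasure D] (hQ : ∀ x, Tendsto (fun n => Q n {x}) atTop (𝓝 (D {x}))) {k : ℕ}
    (hD : natMoment D k < ⊤)
    (hlim : Tendsto (fun n => natMoment (Q n) k) atTop (𝓝 (natMoment D k))) {a : ℕ} (ha : a ≤ k) :
    Tendsto (fun n => (fmom (Q n) a).toReal) atTop (𝓝 (fmom D a).toReal) := by
  refine (ENNReal.tendsto_toReal (fmom_lt_top ha hD).ne).comp ?_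
  have hmarg (P : Measure ℕ) [IsProbabilityMeasure P] :
      ∫⁻ x, ((x : ℝ≥0∞) ^ k + 1) ∂P = natMoment P k + 1 := by
    rw [lintegral_add_right _ measurable_const]
    simp [natMoment]
  -- The summand `1` is needed at `x = 0`, where the falling factorial of order `0` is `1` but `x ^
  -- k` may vanish.
  refine tendsto_lintegral_of_le hQ (g := fun x => (x : ℝ≥0∞) ^ k + 1) (fun x => ?_)
    (fun x => by finiteness) ?_ ?_
  · refine le_trans (Nat.cast_le.2 (Nat.descFactorial_le_pow x a)) ?_
    rcases Nat.eq_zero_or_pos x with rfl | hx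
    · exact le_add_left (by exact_mod_cast pow_le_one₀ (n := a) (le_refl 0) zero_le_one)
    · exact le_add_right (by exact_mod_cast pow_le_pow_right₀ (by exact_mod_cast hx) ha)
  · rw [hmarg]
    exact ENNReal.add_ne_top.2 ⟨hD.ne, ENNReal.one_ne_top⟩
  · simp_rw [hmarg]
    exact hlim.add tendsto_const_nhds

/-- Numbers above `K` are replaced by `0`. -/
def cut (K x : ℕ) : ℕ := if x ≤ K then x else 0

/-- The factorial moments of the truncated law. -/
def cutMom (D : Measure ℕ) (K a : ℕ) : ℝ :=
  ∑ x ∈ Finset.range (K + 1), (x.descFactorial a : ℝ) * D.real {x}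

/-- Truncation moves mass to `0`, where falling factorials of positive order vanish. -/
theorem fmom_map_cut (D : Measure ℕ) [IsFiniteMeasure D] (K : ℕ) {a : ℕ} (ha : 1 ≤ a) :
    (fmom (D.map (cut K)) a).toReal = cutMom D K a := by
  have h₀ (x : ℕ) : (((cut K x).descFactorial a : ℝ≥0∞)) =
      if x ∈ Finset.range (K + 1) then (x.descFactorial a : ℝ≥0∞) else 0 := by
    simp only [cut, Finset.mem_range_succ_iff]
    split_ifs
    · rfl
    · rw [Nat.descFactorial_eq_zero_iff_lt.2 (by omega), Nat.cast_zero]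
  rw [fmom, lintegral_map (by fun_prop) (by fun_prop), lintegral_countable']
  simp_rw [h₀, ite_mul, zero_mul]
  rw [tsum_eq_sum (s := Finset.range (K + 1)) (fun x hx => if_neg hx),
    ENNReal.toReal_sum fun x hx => by rw [if_pos hx]; finiteness]
  refine Finset.sum_congr rfl fun x hx => ?_
  rw [if_pos hx, ENNReal.toReal_mul, ENNReal.toReal_natCast, Measure.real]

theorem tendsto_cutMom {Q : ℕ → Measure ℕ} {D : Measure ℕ} [IsProbabilityMeasure D]
    (hQ : ∀ x, Tendsto (fun n => Q n {x}) atTop (𝓝 (D {x}))) (K a : ℕ) :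
    Tendsto (fun n => cutMom (Q n) K a) atTop (𝓝 (cutMom D K a)) :=
  tendsto_finsetSum _ fun x _ => tendsto_const_nhds.mul
    ((ENNReal.tendsto_toReal (measure_ne_top D _)).comp (hQ x))

theorem tendsto_cutMom_atTop {D : Measure ℕ} [IsProbabilityMeasure D] {a : ℕ}
    (h : fmom D a ≠ ⊤) :
    Tendsto (fun K => cutMom D K a) atTop (𝓝 (fmom D a).toReal) := by
  have hs : fmom D a = ∑' x : ℕ, (x.descFactorial a : ℝ≥0∞) * D {x} := lintegral_countable' _
  have hsum := (ENNReal.hasSum_toReal (hs ▸ h)).tendsto_sum_nat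
  rw [← ENNReal.tsum_toReal_eq (fun x => by finiteness), ← hs] at hsum
  have := hsum.comp (tendsto_add_atTop_nat 1)
  refine this.congr fun K => Finset.sum_congr rfl fun x _ => ?_
  rw [ENNReal.toReal_mul, ENNReal.toReal_natCast, Measure.real]

theorem tendsto_singleton_of_tendstoInDistribution {Ω : ℕ → Type*} [∀ n, MeasurableSpace (Ω n)]
    {P : ∀ n, Measure (Ω n)} [∀ n, IsProbabilityMeasure (P n)] {X : ∀ n, Ω n → ℕ} {D : Measure ℕ}
    [IsProbabilityMeasure D] (h : TendstoInDistribution X atTop id P D) (x : ℕ) :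
    Tendsto (fun n => (P n).map (X n) {x}) atTop (𝓝 (D {x})) := by
  have := ProbabilityMeasure.tendsto_measure_of_null_frontier_of_tendsto' h.tendsto (E := {x})
    (by simp)
  simpa using this

end NatLaws

/-! ### Random subsets -/

section RandomSubset

variable {m : ℕ}

/-- The law of the size, as a law on `ℕ`. -/
def sizeLaw (P : PMF (Fin (m + 1))) : Measure ℕ := P.toMeasure.map Fin.val

instance (P : PMF (Fin (m + 1))) : IsProbabilityMeasure (sizeLaw P) :=
  Measure.isProbabilityMeasure_map (by fun_prop)

theorem lintegral_sizeLaw (P : PMF (Fin (m + 1))) (f : ℕ → ℝ≥0∞) :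
    ∫⁻ x, f x ∂(sizeLaw P) = ∑ x : Fin (m + 1), P x * f x := by
  rw [sizeLaw, lintegral_map (by fun_prop) (by fun_prop), lintegral_fintype]
  refine Finset.sum_congr rfl fun x _ => ?_
  rw [PMF.toMeasure_apply_singleton _ _ (MeasurableSet.singleton x), mul_comm]

/-- Removing `T` identifies these sets with the subsets of its complement of size `x - |T|`. In
probabilities: a uniform set of size `x` contains `T` with probability a quotient of falling
factorials, which is why factorial moments of the sizes appear. -/
theorem card_filter_superset (T : Finset (Fin m)) (x : ℕ) :
    ((Finset.powersetCard x (Finset.univ : Finset (Fin m))).filter fun S => T ⊆ S).card *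
      m.descFactorial T.card = x.descFactorial T.card * m.choose x := by
  rcases lt_or_ge x T.card with hx | hx
  · rw [Nat.descFactorial_eq_zero_iff_lt.2 hx, Finset.filter_false_of_mem]
    · simp
    · intro S hS hTS
      have := Finset.card_le_card hTS
      rw [(Finset.mem_powersetCard.1 hS).2] at this
      omega
  · have hT : T.card ≤ m := by simpa using Finset.card_le_univ T
    have hcard : ((Finset.powersetCard x (Finset.univ : Finset (Fin m))).filter
        fun S => T ⊆ S).card = (m - T.card).choose (x - T.card) := by
      have : (Finset.powersetCard (x - T.card) Tᶜ).card = (m - T.card).choose (x - T.card) := by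
        rw [Finset.card_powersetCard, Finset.card_compl, Fintype.card_fin]
      rw [← this]
      refine Finset.card_nbij' (fun S => S \ T) (fun S => S ∪ T) ?_ ?_ ?_ ?_
      · intro S hS
        obtain ⟨hS, hTS⟩ := Finset.mem_filter.1 hS
        refine Finset.mem_powersetCard.2 ⟨fun a ha => ?_, ?_⟩
        · simpa using (Finset.mem_sdiff.1 ha).2
        · rw [Finset.card_sdiff_of_subset hTS, (Finset.mem_powersetCard.1 hS).2]
      · intro S hS
        obtain ⟨hS, hSx⟩ := Finset.mem_powersetCard.1 hS
        refine Finset.mem_filter.2 ⟨Finset.mem_powersetCard.2 ⟨Finset.subset_univ _, ?_⟩,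
          Finset.subset_union_right⟩
        rw [Finset.card_union_of_disjoint, hSx]
        · omega
        · exact Finset.disjoint_left.2 fun a ha => by simpa using hS ha
      · intro S hS
        exact Finset.sdiff_union_of_subset (Finset.mem_filter.1 hS).2
      · intro S hS
        have := (Finset.mem_powersetCard.1 hS).1
        refine Finset.union_sdiff_cancel_right (Finset.disjoint_left.2 fun a ha => ?_)
        simpa using this ha
    rw [hcard, Nat.descFactorial_eq_factorial_mul_choose, Nat.descFactorial_eq_factorial_mul_choose]
    rcases le_or_gt x m with hxm | hxm
    · have := Nat.choose_mul (n := m) (k := x) (s := T.card) hx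
      calc _ = T.card.factorial * (m.choose T.card * (m - T.card).choose (x - T.card)) := by ring
        _ = _ := by rw [← this]; ring
    · rw [Nat.choose_eq_zero_of_lt hxm, Nat.choose_eq_zero_of_lt (by omega : m - T.card < x - T.card)]
      simp

theorem toMeasure_randomSubset_apply (P : PMF (Fin (m + 1))) (T : Finset (Fin m)) :
    (randomSubset P).toMeasure {S | ∀ w ∈ T, S w} =
      ∑ x, P x * (((x : ℕ).descFactorial T.card : ℝ≥0∞) / (m.descFactorial T.card : ℝ≥0∞)) := by
  classical
  rw [randomSubset, PMF.toMeasure_bind_apply _ _ _ (.of_discrete), tsum_fintype]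
  refine Finset.sum_congr rfl fun x _ => ?_
  congr 1
  let _ : MeasurableSpace (Finset (Fin m)) := ⊤
  rw [PMF.toMeasure_map_apply _ _ _ (by fun_prop) .of_discrete,
    PMF.toMeasure_uniformOfFinset_apply _ _ .of_discrete]
  have hT : T.card ≤ m := by simpa using Finset.card_le_univ T
  have hx : (x : ℕ) ≤ m := Nat.lt_succ_iff.1 x.2
  have h₁ : (m.descFactorial T.card : ℝ≥0∞) ≠ 0 := by
    exact_mod_cast (Nat.descFactorial_pos.2 hT).ne'
  have h₂ : (m.choose x : ℝ≥0∞) ≠ 0 := by exact_mod_cast (Nat.choose_pos hx).ne'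
  rw [ENNReal.div_eq_div_iff h₁ (by simp) (by simpa using h₂) (by simp)]
  have := card_filter_superset T (x : ℕ)
  simp only [Finset.subset_iff] at this
  simp only [Finset.card_powersetCard, Finset.card_univ, Fintype.card_fin]
  rw [mul_comm (m.descFactorial T.card : ℝ≥0∞), mul_comm (m.choose x : ℝ≥0∞)]
  simp only [Set.preimage_ofPred_eq, Set.mem_ofPred_eq]
  exact_mod_cast this

theorem measureReal_randomSubset (P : PMF (Fin (m + 1))) (T : Finset (Fin m)) :
    (randomSubset P).toMeasure.real {S | ∀ w ∈ T, S w} =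
      (fmom (sizeLaw P) T.card).toReal / m.descFactorial T.card := by
  rw [Measure.real, toMeasure_randomSubset_apply, fmom, lintegral_sizeLaw]
  simp_rw [← mul_div_assoc, div_eq_mul_inv]
  rw [← Finset.sum_mul, ENNReal.toReal_mul, ENNReal.toReal_inv, ENNReal.toReal_natCast]

/-- Factor by factor, `(x - i) / (n - i) ≤ x / n`. -/
theorem descFactorial_mul_pow_le {x n : ℕ} (h : x ≤ n) (t : ℕ) :
    x.descFactorial t * n ^ t ≤ x ^ t * n.descFactorial t := by
  induction t with
  | zero => simp
  | succ t ih =>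
    rw [Nat.descFactorial_succ, Nat.descFactorial_succ, pow_succ, pow_succ]
    have h₁ : (x - t) * n ≤ x * (n - t) := by
      rw [Nat.sub_mul, Nat.mul_sub]
      have : x * t ≤ t * n := by
        rw [mul_comm]
        exact Nat.mul_le_mul_left t h
      omega
    calc (x - t) * x.descFactorial t * (n ^ t * n)
        = (x - t) * n * (x.descFactorial t * n ^ t) := by ring
      _ ≤ x * (n - t) * (x ^ t * n.descFactorial t) := Nat.mul_le_mul h₁ ih
      _ = _ := by ring

theorem measureReal_randomSubset_le (P : PMF (Fin (m + 1))) {K : ℕ}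
    (hP : ∀ x, P x ≠ 0 → (x : ℕ) ≤ K) (T : Finset (Fin m)) :
    (randomSubset P).toMeasure.real {S | ∀ w ∈ T, S w} ≤ ((K : ℝ) / m) ^ T.card := by
  rcases Nat.eq_zero_or_pos T.card with h0 | h0
  · rw [h0, pow_zero]
    exact measureReal_le_one
  have hT : T.card ≤ m := by simpa using Finset.card_le_univ T
  have hm : 0 < m := by omega
  rw [Measure.real, toMeasure_randomSubset_apply]
  refine ENNReal.toReal_le_of_le_ofReal (by positivity) ?_
  have hb (x : Fin (m + 1)) :
      P x * (((x : ℕ).descFactorial T.card : ℝ≥0∞) / (m.descFactorial T.card : ℝ≥0∞)) ≤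
        P x * ENNReal.ofReal (((K : ℝ) / m) ^ T.card) := by
    by_cases hx : P x = 0
    · simp [hx]
    gcongr
    have hd : (0 : ℝ) < m.descFactorial T.card := by exact_mod_cast Nat.descFactorial_pos.2 hT
    rw [← ENNReal.ofReal_natCast ((x : ℕ).descFactorial T.card), ← ENNReal.ofReal_natCast,
      ← ENNReal.ofReal_div_of_pos hd]
    refine ENNReal.ofReal_le_ofReal ?_
    rw [div_pow, div_le_div_iff₀ hd (by positivity)]
    calc (((x : ℕ).descFactorial T.card : ℝ)) * (m : ℝ) ^ T.card
        ≤ (x : ℝ) ^ T.card * m.descFactorial T.card := by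
          exact_mod_cast descFactorial_mul_pow_le (Nat.lt_succ_iff.1 x.2) T.card
      _ ≤ _ := by
          gcongr
          exact_mod_cast hP x hx
  refine (Finset.sum_le_sum fun x _ => hb x).trans ?_
  rw [← Finset.sum_mul, ← tsum_fintype (L := .unconditional _), P.tsum_coe, one_mul]

/-- The truncated size law. -/
def cutPMF (K : ℕ) (P : PMF (Fin (m + 1))) : PMF (Fin (m + 1)) :=
  P.map fun x : Fin (m + 1) => ⟨cut K x, by unfold cut; split_ifs <;> omega⟩

theorem sizeLaw_cutPMF (K : ℕ) (P : PMF (Fin (m + 1))) :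
    sizeLaw (cutPMF K P) = (sizeLaw P).map (cut K) := by
  rw [sizeLaw, cutPMF, ← PMF.toMeasure_map _ P (measurable_of_countable _), Measure.map_map (by fun_prop)
    (by fun_prop), sizeLaw, Measure.map_map (by fun_prop) (by fun_prop)]
  rfl

theorem cutPMF_support (K : ℕ) (P : PMF (Fin (m + 1))) (x : Fin (m + 1))
    (hx : cutPMF K P x ≠ 0) : (x : ℕ) ≤ K := by
  rw [← PMF.mem_support_iff, cutPMF, PMF.support_map] at hx
  obtain ⟨y, -, rfl⟩ := hx
  simp only [cut]
  split_ifs <;> omega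

/-- Sets with more than `K` elements are replaced by the empty set. -/
def cutSet (K : ℕ) (S : Fin m → Prop) : Fin m → Prop := fun w => S w ∧ {w | S w}.ncard ≤ K

theorem cutSet_le (K : ℕ) (S : Fin m → Prop) : cutSet K S ≤ S := fun _ h => h.1

theorem pmf_map_congr {α γ : Type*} (p : PMF α) {f g : α → γ} (h : ∀ a ∈ p.support, f a = g a) :
    p.map f = p.map g := by
  classical
  ext b
  rw [PMF.map_apply, PMF.map_apply]
  refine tsum_congr fun a => ?_
  by_cases ha : a ∈ p.support
  · rw [h a ha]
  · simp [(PMF.apply_eq_zero_iff p a).2 ha]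

/-- The coupling behind truncation: cutting the size law amounts to emptying the sets that are too
large, so the truncated graph is a subgraph. -/
theorem randomSubset_cutPMF (K : ℕ) (P : PMF (Fin (m + 1))) :
    randomSubset (cutPMF K P) = (randomSubset P).map (cutSet K) := by
  classical
  rw [randomSubset, randomSubset, cutPMF, PMF.map_bind, PMF.bind_map]
  congr 1
  funext x
  rw [PMF.map_comp, Function.comp_apply]
  have hncard (S : Finset (Fin m)) : {w | w ∈ S}.ncard = S.card := by
    simp
  by_cases hx : (x : ℕ) ≤ K
  · simp only [cut, hx, if_true]
    refine pmf_map_congr _ fun S hS => ?_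
    rw [PMF.support_uniformOfFinset, Finset.mem_coe, Finset.mem_powersetCard] at hS
    funext w
    simp only [Function.comp_apply, cutSet, hncard, hS.2, hx, and_true]
  · have h₁ : ∀ (y : ℕ) (hy : (Finset.powersetCard y (Finset.univ : Finset (Fin m))).Nonempty)
        (g : Finset (Fin m) → Fin m → Prop),
        (∀ S : Finset (Fin m), S.card = y → g S = fun _ => False) →
        (PMF.uniformOfFinset _ hy).map g = PMF.pure fun _ => False := by
      intro y hy g hg
      rw [← PMF.map_const (PMF.uniformOfFinset _ hy)]
      refine pmf_map_congr _ fun S hS => ?_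
      rw [PMF.support_uniformOfFinset, Finset.mem_coe, Finset.mem_powersetCard] at hS
      exact hg S hS.2
    rw [h₁, h₁]
    · intro S hS
      funext w
      simp [cutSet, hS, hx]
    · intro S hS
      simp only [cut, hx, if_false, Finset.card_eq_zero] at hS
      simp [hS]

theorem lintegral_randomSubset_ncard (P : PMF (Fin (m + 1))) (f : ℕ → ℝ≥0∞) :
    ∫⁻ S, f {w | S w}.ncard ∂(randomSubset P).toMeasure = ∫⁻ x, f x ∂(sizeLaw P) := by
  classical
  have h : (randomSubset P).map (fun S => {w | S w}.ncard) = P.map Fin.val := by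
    rw [randomSubset, PMF.map_bind]
    change _ = P.bind fun x => PMF.pure x.val
    congr 1
    funext x
    rw [PMF.map_comp, ← PMF.map_const (PMF.uniformOfFinset _ _)]
    refine pmf_map_congr _ fun S hS => ?_
    rw [PMF.support_uniformOfFinset, Finset.mem_coe, Finset.mem_powersetCard] at hS
    simp [hS.2]
  have hf : Measurable f := by fun_prop
  rw [sizeLaw, PMF.toMeasure_map _ P (measurable_of_countable _), ← h,
    ← PMF.toMeasure_map _ _ (measurable_of_countable _),
    lintegral_map hf (by fun_prop)]

end RandomSubset

/-! ### The active and the passive model -/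

section ActivePassive

variable {n₁ n₂ : ℕ}

instance (P : PMF (Fin (n₂ + 1))) : IsProbabilityMeasure (activeLaw n₁ n₂ P) := by
  unfold activeLaw
  infer_instance

instance (P : PMF (Fin (n₁ + 1))) : IsProbabilityMeasure (passiveLaw n₁ n₂ P) := by
  unfold passiveLaw
  exact Measure.isProbabilityMeasure_map (measurable_of_countable _).aemeasurable

theorem passiveLaw_eq_map (P : PMF (Fin (n₁ + 1))) :
    passiveLaw n₁ n₂ P = (activeLaw n₂ n₁ P).map fun S v w => S w v := rfl

/-- Sorting the edges by their end in part 1 writes the event as a product over neighbourhoods,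
which are independent in the active model. -/
theorem incl_eq_pi {ι V W : Type*} [Finite W] (L : ι → V) (R : ι → W) :
    incl L R = Set.univ.pi fun v =>
      {S : W → Prop | ∀ w ∈ (Set.toFinite {w | ∃ i, L i = v ∧ R i = w}).toFinset, S w} := by
  ext H
  simp only [incl, Set.mem_pi, Set.mem_univ, Set.Finite.mem_toFinset, forall_true_left]
  constructor
  · rintro h v w ⟨i, rfl, rfl⟩
    exact h i
  · exact fun h i => h (L i) (R i) ⟨i, rfl, rfl⟩

theorem card_toFinset_eq_fib {ι V W : Type*} [Finite W] {L : ι → V} {R : ι → W}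
    (h : Function.Injective fun i => (L i, R i)) (v : V) :
    (Set.toFinite {w | ∃ i, L i = v ∧ R i = w}).toFinset.card = fib L v := by
  rw [← Set.ncard_eq_toFinset_card, ← Nat.card_coe_set_eq, fib]
  refine (Nat.card_congr (Equiv.ofBijective
    (fun i : {i // L i = v} => (⟨R i, i, i.2, rfl⟩ : {w | ∃ i, L i = v ∧ R i = w})) ⟨?_, ?_⟩)).symm
  · rintro ⟨i, hi⟩ ⟨j, hj⟩ hij
    refine Subtype.ext (h ?_)
    have : R i = R j := congrArg Subtype.val hij
    simp [hi, hj, this]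
  · rintro ⟨w, i, hi, rfl⟩
    exact ⟨⟨i, hi⟩, rfl⟩

theorem activeLaw_incl (P : PMF (Fin (n₂ + 1))) {ι : Type*} {L : ι → Fin n₁}
    {R : ι → Fin n₂} (h : Function.Injective fun i => (L i, R i)) :
    (activeLaw n₁ n₂ P).real (incl L R) =
      ∏ v, (fmom (sizeLaw P) (fib L v)).toReal / n₂.descFactorial (fib L v) := by
  rw [incl_eq_pi, activeLaw, Measure.real, Measure.pi_pi, ENNReal.toReal_prod]
  refine Finset.prod_congr rfl fun v _ => ?_
  rw [← card_toFinset_eq_fib h, ← measureReal_randomSubset, Measure.real]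

theorem edgesProb_eq_incl {V W : Type*} (μ : Measure (BipGraph V W)) (E : Finset (V × W)) :
    edgesProb μ E = μ.real (incl (fun e : E => e.1.1) fun e : E => e.1.2) := by
  simp [edgesProb, incl]

theorem edgesProb_activeLaw_le (P : PMF (Fin (n₂ + 1))) {K : ℕ}
    (hP : ∀ x, P x ≠ 0 → (x : ℕ) ≤ K) (E : Finset (Fin n₁ × Fin n₂)) :
    edgesProb (activeLaw n₁ n₂ P) E ≤ ((K : ℝ) / n₂) ^ E.card := by
  have hinj : Function.Injective fun e : E => (e.1.1, e.1.2) := fun e e' h => Subtype.ext h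
  rw [edgesProb_eq_incl, incl_eq_pi, activeLaw, Measure.real, Measure.pi_pi, ENNReal.toReal_prod]
  have hcard : E.card = ∑ v, fib (fun e : E => e.1.1) v := by
    rw [sum_fib, Fintype.card_coe]
  rw [hcard, ← Finset.prod_pow_eq_pow_sum]
  refine Finset.prod_le_prod (fun v _ => ENNReal.toReal_nonneg) fun v _ => ?_
  rw [← card_toFinset_eq_fib hinj]
  exact measureReal_randomSubset_le P hP _

theorem activeLaw_cutPMF (K : ℕ) (P : PMF (Fin (n₂ + 1))) :
    activeLaw n₁ n₂ (cutPMF K P) = (activeLaw n₁ n₂ P).map fun H v => cutSet K (H v) := by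
  have h : (randomSubset (cutPMF K P)).toMeasure = (randomSubset P).toMeasure.map (cutSet K) := by
    rw [randomSubset_cutPMF, ← PMF.toMeasure_map _ _ (measurable_of_countable _)]
  have := Measure.isProbabilityMeasure_map (μ := (randomSubset P).toMeasure)
    (measurable_of_countable (cutSet K)).aemeasurable
  rw [activeLaw, activeLaw, h]
  exact (Measure.pi_map_pi fun _ => (measurable_of_countable (cutSet K)).aemeasurable).symm

theorem integral_activeLaw_cutPMF_le (K : ℕ) (P : PMF (Fin (n₂ + 1)))
    (f : BipGraph (Fin n₁) (Fin n₂) → ℝ) (hf : Monotone f) :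
    ∫ H, f H ∂(activeLaw n₁ n₂ (cutPMF K P)) ≤ ∫ H, f H ∂(activeLaw n₁ n₂ P) := by
  rw [activeLaw_cutPMF, integral_map (measurable_of_countable _).aemeasurable
    (measurable_of_countable f).aestronglyMeasurable]
  exact integral_mono .of_finite .of_finite fun H => hf fun v => cutSet_le K (H v)

theorem passiveLaw_incl (P : PMF (Fin (n₁ + 1))) {ι : Type*} {L : ι → Fin n₁}
    {R : ι → Fin n₂} (h : Function.Injective fun i => (L i, R i)) :
    (passiveLaw n₁ n₂ P).real (incl L R) =
      ∏ w, (fmom (sizeLaw P) (fib R w)).toReal / n₁.descFactorial (fib R w) := by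
  have h' : Function.Injective fun i => (R i, L i) := Prod.swap_injective.comp h
  rw [← activeLaw_incl P h', passiveLaw_eq_map,
    map_measureReal_apply (measurable_of_countable _) .of_discrete]
  rfl

theorem edgesProb_passiveLaw_le (P : PMF (Fin (n₁ + 1))) {K : ℕ}
    (hP : ∀ x, P x ≠ 0 → (x : ℕ) ≤ K) (E : Finset (Fin n₁ × Fin n₂)) :
    edgesProb (passiveLaw n₁ n₂ P) E ≤ ((K : ℝ) / n₁) ^ E.card := by
  have := edgesProb_activeLaw_le P hP (E.map (Equiv.prodComm _ _).toEmbedding)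
  rw [Finset.card_map] at this
  refine le_of_eq_of_le ?_ this
  rw [edgesProb, edgesProb, passiveLaw_eq_map,
    map_measureReal_apply (measurable_of_countable _) .of_discrete]
  congr 1
  ext H
  simp [forall_comm (α := Fin n₁)]

theorem integral_passiveLaw_cutPMF_le (K : ℕ) (P : PMF (Fin (n₁ + 1)))
    (f : BipGraph (Fin n₁) (Fin n₂) → ℝ) (hf : Monotone f) :
    ∫ H, f H ∂(passiveLaw n₁ n₂ (cutPMF K P)) ≤ ∫ H, f H ∂(passiveLaw n₁ n₂ P) := by
  rw [passiveLaw_eq_map, passiveLaw_eq_map, integral_map (measurable_of_countable _).aemeasurable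
    (measurable_of_countable f).aestronglyMeasurable,
    integral_map (measurable_of_countable _).aemeasurable
    (measurable_of_countable f).aestronglyMeasurable]
  exact integral_activeLaw_cutPMF_le K P (fun S => f fun v w => S w v)
    fun S S' h => hf fun v w => h w v

theorem lintegral_activeLaw_eval (P : PMF (Fin (n₂ + 1))) (u : Fin n₁) (f : ℕ → ℝ≥0∞) :
    ∫⁻ H, f {w | H u w}.ncard ∂(activeLaw n₁ n₂ P) = ∫⁻ x, f x ∂(sizeLaw P) := by
  rw [← lintegral_randomSubset_ncard]
  exact (measurePreserving_eval (fun _ : Fin n₁ => (randomSubset P).toMeasure) u).lintegral_comp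
    (measurable_of_countable fun S : Fin n₂ → Prop => f {w | S w}.ncard)

theorem lintegral_X₁_activeLaw [NeZero n₁] (P : PMF (Fin (n₂ + 1))) (f : ℕ → ℝ≥0∞) :
    ∫⁻ p, f (X₁ p) ∂(withVertex₁ (activeLaw n₁ n₂ P)) = ∫⁻ x, f x ∂(sizeLaw P) := by
  rw [lintegral_withVertex₁, lintegral_finsetSum _ fun _ _ => measurable_of_countable _]
  simp only [X₁]
  simp_rw [lintegral_activeLaw_eval]
  rw [Finset.sum_const, Finset.card_univ, Fintype.card_fin, nsmul_eq_mul, ← mul_assoc,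
    ENNReal.inv_mul_cancel (by simp [NeZero.ne]) (by simp), one_mul]

theorem lintegral_X₂_passiveLaw [NeZero n₂] (P : PMF (Fin (n₁ + 1))) (f : ℕ → ℝ≥0∞) :
    ∫⁻ p, f (X₂ p) ∂(withVertex₂ (passiveLaw n₁ n₂ P)) = ∫⁻ x, f x ∂(sizeLaw P) := by
  rw [lintegral_withVertex₂, lintegral_finsetSum _ fun _ _ => measurable_of_countable _]
  simp only [X₂]
  simp_rw [passiveLaw_eq_map]
  have (u : Fin n₂) : ∫⁻ H : BipGraph (Fin n₁) (Fin n₂), f {v | H v u}.ncard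
      ∂((activeLaw n₂ n₁ P).map fun S v w => S w v) = ∫⁻ x, f x ∂(sizeLaw P) := by
    rw [lintegral_map (measurable_of_countable _) (measurable_of_countable _),
      ← lintegral_activeLaw_eval P u]
  simp_rw [this]
  rw [Finset.sum_const, Finset.card_univ, Fintype.card_fin, nsmul_eq_mul, ← mul_assoc,
    ENNReal.inv_mul_cancel (by simp [NeZero.ne]) (by simp), one_mul]

theorem map_apply_singleton_of_lintegral {Ω : Type*} [MeasurableSpace Ω] {P : Measure Ω}
    {X : Ω → ℕ} (hX : AEMeasurable X P) {Q : Measure ℕ}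
    (h : ∀ f : ℕ → ℝ≥0∞, ∫⁻ ω, f (X ω) ∂P = ∫⁻ x, f x ∂Q) (x : ℕ) : P.map X {x} = Q {x} := by
  rw [← lintegral_indicator_one (MeasurableSet.singleton x),
    lintegral_map' (measurable_of_countable _).aemeasurable hX, h,
    lintegral_indicator_one (MeasurableSet.singleton x)]

end ActivePassive

/-! ### Limits of normalising factors -/

section Ratios

theorem tendsto_descFactorial_div_pow {I : Type*} {l : Filter I} {N : I → ℕ}
    (hN : Tendsto N l atTop) (j : ℕ) :
    Tendsto (fun i => ((N i).descFactorial j : ℝ) / (N i : ℝ) ^ j) l (𝓝 1) := by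
  have hN' := (tendsto_natCast_atTop_atTop (R := ℝ)).comp hN
  have h₁ : Tendsto (fun i => 1 - (j : ℝ) ^ 2 / (N i : ℝ)) l (𝓝 1) := by
    simpa using tendsto_const_nhds.sub (Tendsto.div_atTop (tendsto_const_nhds
      (x := (j : ℝ) ^ 2)) hN')
  refine tendsto_of_tendsto_of_tendsto_of_le_of_le' h₁ tendsto_const_nhds ?_ ?_
  · filter_upwards [hN.eventually_ge_atTop 1] with i hi
    have hpos : (0 : ℝ) < N i := by exact_mod_cast hi
    rw [le_div_iff₀ (by positivity), sub_mul, div_mul_eq_mul_div, one_mul, sub_le_iff_le_add,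
      ← sub_le_iff_le_add', le_div_iff₀ hpos, sub_mul]
    have := pow_mul_le_descFactorial (N i) j
    linarith
  · refine .of_forall fun i => div_le_one_of_le₀ ?_ (by positivity)
    exact_mod_cast Nat.descFactorial_le_pow _ _

theorem tendsto_pow_div_descFactorial {I : Type*} {l : Filter I} {N : I → ℕ}
    (hN : Tendsto N l atTop) (j : ℕ) :
    Tendsto (fun i => (N i : ℝ) ^ j / ((N i).descFactorial j : ℝ)) l (𝓝 1) := by
  simpa using (tendsto_descFactorial_div_pow hN j).inv₀ one_ne_zero

end Ratios

/-! ### Factorial moments of Poisson laws -/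

section Poisson

/-- Terms with `j < a` vanish. After a shift by `a` the falling factorial cancels against the
factorial and leaves `x ^ a` times the total mass. -/
theorem tsum_poisson_mul_descFactorial (x : ℝ≥0) (a : ℕ) :
    ∑' j : ℕ, ENNReal.ofReal (Real.exp (-x) * (x : ℝ) ^ j / (j.factorial : ℝ)) *
      (j.descFactorial a : ℝ≥0∞) = (x : ℝ≥0∞) ^ a := by
  rw [← Summable.sum_add_tsum_nat_add' (k := a) ENNReal.summable, Finset.sum_eq_zero, zero_add]
  · have hterm (i : ℕ) : ENNReal.ofReal
        (Real.exp (-x) * (x : ℝ) ^ (i + a) / ((i + a).factorial : ℝ)) *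
        ((i + a).descFactorial a : ℝ≥0∞) =
        (x : ℝ≥0∞) ^ a * ENNReal.ofReal (Real.exp (-x) * (x : ℝ) ^ i / (i.factorial : ℝ)) := by
      rw [← ENNReal.ofReal_natCast ((i + a).descFactorial a), ← ENNReal.ofReal_mul (by positivity),
        ← ENNReal.ofReal_coe_nnreal, ← ENNReal.ofReal_pow (by positivity),
        ← ENNReal.ofReal_mul (by positivity)]
      congr 1
      have hf : (i.factorial : ℝ) * (i + a).descFactorial a = (i + a).factorial := by
        have := Nat.factorial_mul_descFactorial (n := i + a) (k := a) (by omega)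
        rw [Nat.add_sub_cancel] at this
        exact_mod_cast this
      have h1 : (i.factorial : ℝ) ≠ 0 := by positivity
      have h2 : ((i + a).descFactorial a : ℝ) ≠ 0 := by
        exact_mod_cast (Nat.descFactorial_pos.2 (by omega)).ne'
      rw [← hf, pow_add]
      field_simp
    simp_rw [hterm]
    rw [ENNReal.tsum_mul_left]
    have hs := hasSum_one_poissonMeasure x
    rw [← ENNReal.ofReal_tsum_of_nonneg (fun i => by positivity) hs.summable, hs.tsum_eq]
    simp
  · intro j hj
    rw [Nat.descFactorial_eq_zero_iff_lt.2 (Finset.mem_range.1 hj)]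
    simp

theorem fmom_poissonMeasure (r : ℝ≥0) (a : ℕ) : fmom (poissonMeasure r) a = (r : ℝ≥0∞) ^ a := by
  rw [fmom, poissonMeasure, lintegral_sum_measure, ← tsum_poisson_mul_descFactorial]
  refine tsum_congr fun j => ?_
  rw [lintegral_smul_measure, lintegral_dirac, smul_eq_mul]

theorem fmom_mixedPoisson (ν : Measure ℝ≥0) (a : ℕ) :
    fmom (mixedPoisson ν) a = weightMoment ν a := by
  rw [fmom, mixedPoisson, lintegral_sum_measure, weightMoment]
  simp_rw [lintegral_smul_measure, lintegral_dirac, smul_eq_mul, ← tsum_poisson_mul_descFactorial]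
  rw [lintegral_tsum fun j => by fun_prop]
  refine tsum_congr fun j => ?_
  rw [lintegral_mul_const _ (by fun_prop)]

theorem natMoment_lt_top_of_fmom {D : Measure ℕ} {k : ℕ} (h : ∀ m ≤ k, fmom D m < ⊤) :
    natMoment D k < ⊤ := by
  obtain ⟨c, hc⟩ := exists_pow_eq_sum_descFactorial k
  have : natMoment D k = ∑ m ∈ Finset.range (k + 1), c m * fmom D m := by
    have hpow (x : ℕ) : (x : ℝ≥0∞) ^ k =
        ∑ m ∈ Finset.range (k + 1), (c m : ℝ≥0∞) * (x.descFactorial m : ℝ≥0∞) := by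
      exact_mod_cast hc x
    simp_rw [natMoment, hpow]
    rw [lintegral_finsetSum _ fun _ _ => by fun_prop]
    exact Finset.sum_congr rfl fun m _ => lintegral_const_mul _ (by fun_prop)
  rw [this]
  exact ENNReal.sum_lt_top.2 fun m hm =>
    ENNReal.mul_lt_top (by simp) (h m (Finset.mem_range_succ_iff.1 hm))

theorem natMoment_poissonMeasure_lt_top (r : ℝ≥0) (k : ℕ) : natMoment (poissonMeasure r) k < ⊤ :=
  natMoment_lt_top_of_fmom fun m _ => by
    rw [fmom_poissonMeasure]
    finiteness

theorem natMoment_poissonMeasure_one (r : ℝ≥0) : natMoment (poissonMeasure r) 1 = r := by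
  rw [← fmom_one, fmom_poissonMeasure, pow_one]

end Poisson

/-! ### The limits in the active and the passive model -/

section ActivePassiveLimit

/-- All weight sits in part 1: the root chooses `|π|` prescribed neighbours and each leaf one,
independently. -/
theorem activeLaw_tree {n₁ n₂ m : ℕ} (P : PMF (Fin (n₂ + 1))) (π : Setoid (Fin m))
    (x : Option (Fin m) ↪ Fin n₁) (e : Quotient π ↪ Fin n₂) :
    (activeLaw n₁ n₂ P).real (incl (treeL π x) (treeR π e)) =
      ((n₂.descFactorial (Fintype.card (Quotient π)) : ℝ) * (n₂ : ℝ) ^ m)⁻¹ *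
        (∏ o, rootWeight π (fun a (_ : Fin n₁) => (fmom (sizeLaw P) a).toReal) o (x o)) *
        ∏ q, midWeight π (fun _ (_ : Fin n₂) => 1) q (e q) := by
  rw [activeLaw_incl P (treeL_treeR_injective π x e), prod_fib_treeL π x (fun _ a =>
    (fmom (sizeLaw P) a).toReal / (n₂.descFactorial a : ℝ)) (fun _ => by simp [fmom_zero]),
    prod_rootWeight]
  simp only [midWeight, Finset.prod_const, Finset.card_univ, Fintype.card_fin, one_pow, mul_one,
    Nat.descFactorial_one, div_pow]
  rw [mul_inv]
  ring

theorem passiveLaw_tree {n₁ n₂ m : ℕ} (P : PMF (Fin (n₁ + 1))) (π : Setoid (Fin m))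
    (x : Option (Fin m) ↪ Fin n₁) (e : Quotient π ↪ Fin n₂) :
    (passiveLaw n₁ n₂ P).real (incl (treeL π x) (treeR π e)) =
      (∏ q, (n₁.descFactorial (blk π q + 1) : ℝ))⁻¹ *
        (∏ o, rootWeight π (fun _ (_ : Fin n₁) => 1) o (x o)) *
        ∏ q, midWeight π (fun a (_ : Fin n₂) => (fmom (sizeLaw P) a).toReal) q (e q) := by
  rw [passiveLaw_incl P (treeL_treeR_injective π x e), prod_fib_treeR π e (fun _ a =>
    (fmom (sizeLaw P) a).toReal / (n₁.descFactorial a : ℝ)) (fun _ => by simp [fmom_zero]),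
    prod_rootWeight]
  simp only [midWeight, Finset.prod_const_one, mul_one, Finset.prod_div_distrib]
  rw [inv_mul_eq_div]

theorem fmom_sizeLaw_le {m : ℕ} (P : PMF (Fin (m + 1))) (K : ℕ) {a k : ℕ} (hak : a ≤ k) : (fmom (sizeLaw (cutPMF K P)) a).toReal ≤ ((K : ℝ) + 1) ^ k := by
  refine ENNReal.toReal_le_of_le_ofReal (by positivity) ?_
  rw [fmom, lintegral_sizeLaw]
  have h : ∀ x : Fin (m + 1), cutPMF K P x * ((x : ℕ).descFactorial a : ℝ≥0∞) ≤
      cutPMF K P x * ENNReal.ofReal (((K : ℝ) + 1) ^ k) := by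
    intro x
    by_cases hx : cutPMF K P x = 0
    · simp [hx]
    gcongr
    rw [← ENNReal.ofReal_natCast]
    refine ENNReal.ofReal_le_ofReal ?_
    have h₁ : (((x : ℕ).descFactorial a : ℕ) : ℝ) ≤ (x : ℝ) ^ a := by
      exact_mod_cast Nat.descFactorial_le_pow _ _
    have h₂ : (x : ℝ) ≤ K := by exact_mod_cast cutPMF_support K P x hx
    calc _ ≤ (x : ℝ) ^ a := h₁
      _ ≤ ((K : ℝ) + 1) ^ a := by
          gcongr
          linarith
      _ ≤ _ := pow_le_pow_right₀ (by linarith [K.cast_nonneg (α := ℝ)]) hak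
  refine (Finset.sum_le_sum fun x _ => h x).trans ?_
  rw [← Finset.sum_mul, ← tsum_fintype (L := .unconditional _), PMF.tsum_coe, one_mul]

theorem tendsto_ratio_inv {n₁ n₂ : ℕ → ℕ} {β : ℝ≥0} (hβ : 0 < β)
    (hratio : Tendsto (fun n => (n₂ n : ℝ) / n₁ n) atTop (𝓝 β)) :
    Tendsto (fun n => (n₁ n : ℝ) / n₂ n) atTop (𝓝 (β : ℝ)⁻¹) := by
  simpa using hratio.inv₀ (by exact_mod_cast hβ.ne')

variable {k : ℕ} {n₁ n₂ : ℕ → ℕ} [∀ n, NeZero (n₁ n)] [∀ n, NeZero (n₂ n)] {β : ℝ≥0}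

theorem tendsto_facMom_activeLaw (hn₁ : Tendsto n₁ atTop atTop) (hn₂ : Tendsto n₂ atTop atTop)
    (hβ : 0 < β) (hratio : Tendsto (fun n => (n₂ n : ℝ) / n₁ n) atTop (𝓝 β))
    (P : ∀ n, PMF (Fin (n₂ n + 1))) {D : Measure ℕ} [IsProbabilityMeasure D]
    (hQ : ∀ x, Tendsto (fun n => sizeLaw (P n) {x}) atTop (𝓝 (D {x})))
    (hD : natMoment D k < ⊤)
    (hlim : Tendsto (fun n => natMoment (sizeLaw (P n)) k) atTop (𝓝 (natMoment D k)))
    {m : ℕ} (hm : 1 ≤ m) (hmk : m ≤ k) :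
    Tendsto (fun n => facMom (activeLaw (n₁ n) (n₂ n) (P n)) m) atTop
      (𝓝 (treeSum m (fun _ => (β : ℝ)⁻¹ ^ m) (fun a => (fmom D a).toReal) fun _ => 1)) := by
  have hinv := tendsto_ratio_inv hβ hratio
  -- The falling factorial of `n₂` cancels the number of choices of the middle vertices; the leaves
  -- give `(n₁ / n₂) ^ m`.
  have hc (π : Setoid (Fin m)) : Tendsto (fun n =>
      (((n₂ n).descFactorial (Fintype.card (Quotient π)) : ℝ) * (n₂ n : ℝ) ^ m)⁻¹ *
        (n₁ n : ℝ) ^ m * (n₂ n : ℝ) ^ Fintype.card (Quotient π)) atTop (𝓝 ((β : ℝ)⁻¹ ^ m)) := by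
    have := (tendsto_pow_div_descFactorial hn₂ (Fintype.card (Quotient π))).mul (hinv.pow m)
    rw [one_mul] at this
    refine this.congr fun n => ?_
    rw [div_pow, mul_inv]
    ring
  refine tendsto_of_eventually_le (s := fun K => treeSum m (fun _ => (β : ℝ)⁻¹ ^ m)
    (fun a => cutMom D K a) fun _ => 1) ?_ (fun b hb => ?_) (fun K b hb => ?_)
  · exact tendsto_treeSum hm (fun a _ ha => tendsto_cutMom_atTop
      (fmom_lt_top (ha.trans hmk) hD).ne) fun a _ _ => tendsto_const_nhds
  · refine eventually_facMom_le hm (fun n => activeLaw (n₁ n) (n₂ n) (P n))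
      (c := fun n π => (((n₂ n).descFactorial (Fintype.card (Quotient π)) : ℝ) *
        (n₂ n : ℝ) ^ m)⁻¹) (fun n π => by positivity)
      (φ₁ := fun n a _ => (fmom (sizeLaw (P n)) a).toReal) (fun _ _ _ => ENNReal.toReal_nonneg)
      (φ₂ := fun _ _ _ => 1) (fun _ _ _ => zero_le_one)
      (.of_forall fun n π x e => (activeLaw_tree (P n) π x e).le) hc ?_ ?_ hb
    · intro a _ ha
      simp_rw [avg_const]
      exact tendsto_fmom hQ hD hlim (ha.trans hmk)
    · intro a _ _
      simp_rw [avg_const]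
      exact tendsto_const_nhds
  · have hyC : Tendsto (fun n => (n₁ n : ℝ) * ((K : ℝ) / n₂ n)) atTop (𝓝 (K * (β : ℝ)⁻¹)) := by
      refine (hinv.const_mul (K : ℝ)).congr fun n => by ring
    refine eventually_le_facMom hm hn₁ hn₂ (fun n => activeLaw (n₁ n) (n₂ n) (P n))
      (fun n => activeLaw (n₁ n) (n₂ n) (cutPMF K (P n)))
      (fun n f hf _ => integral_activeLaw_cutPMF_le K (P n) f hf) (y := fun n => (K : ℝ) / n₂ n)
      (fun n => by positivity) (C := max (K * (β : ℝ)⁻¹ + 1) K) ?_ ?_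
      (.of_forall fun n E _ => edgesProb_activeLaw_le _ (cutPMF_support K (P n)) E)
      (c := fun n π => (((n₂ n).descFactorial (Fintype.card (Quotient π)) : ℝ) *
        (n₂ n : ℝ) ^ m)⁻¹) (δ := fun _ _ => 0)
      (φ₁ := fun n a _ => (fmom (sizeLaw (cutPMF K (P n))) a).toReal)
      (fun _ _ _ => ENNReal.toReal_nonneg)
      (φ₂ := fun _ _ _ => 1) (fun _ _ _ => zero_le_one) (M := ((K : ℝ) + 1) ^ m) (by positivity)
      (.of_forall fun n a ha ham _ => fmom_sizeLaw_le _ _ ham)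
      (.of_forall fun n a ha ham _ => one_le_pow₀ (by linarith [K.cast_nonneg (α := ℝ)]))
      (.of_forall fun n π x e => by
        rw [sub_zero]
        exact (activeLaw_tree (cutPMF K (P n)) π x e).ge) hc (fun _ _ => le_rfl)
        (fun π => by simp) ?_ ?_ hb
    · filter_upwards [hyC.eventually_le_const (lt_add_one _)] with n hn
      exact hn.trans (le_max_left _ _)
    · refine .of_forall fun n => le_of_eq_of_le ?_ (le_max_right _ _)
      have : (n₂ n : ℝ) ≠ 0 := by simp [NeZero.ne]
      field_simp
    · intro a ha _
      simp_rw [avg_const, sizeLaw_cutPMF, fmom_map_cut _ K ha]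
      exact tendsto_cutMom hQ K a
    · intro a _ _
      simp_rw [avg_const]
      exact tendsto_const_nhds

theorem tendsto_facMom_passiveLaw (hn₁ : Tendsto n₁ atTop atTop) (hn₂ : Tendsto n₂ atTop atTop)
    (hratio : Tendsto (fun n => (n₂ n : ℝ) / n₁ n) atTop (𝓝 β))
    (P : ∀ n, PMF (Fin (n₁ n + 1))) {D : Measure ℕ} [IsProbabilityMeasure D]
    (hQ : ∀ x, Tendsto (fun n => sizeLaw (P n) {x}) atTop (𝓝 (D {x})))
    (hD : natMoment D (k + 1) < ⊤)
    (hlim : Tendsto (fun n => natMoment (sizeLaw (P n)) (k + 1)) atTop (𝓝 (natMoment D (k + 1))))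
    {m : ℕ} (hm : 1 ≤ m) (hmk : m ≤ k) :
    Tendsto (fun n => facMom (passiveLaw (n₁ n) (n₂ n) (P n)) m) atTop
      (𝓝 (treeSum m (fun π => (β : ℝ) ^ Fintype.card (Quotient π)) (fun _ => 1)
        fun a => (fmom D a).toReal)) := by
  have hc (π : Setoid (Fin m)) : Tendsto (fun n =>
      (∏ q, ((n₁ n).descFactorial (blk π q + 1) : ℝ))⁻¹ *
        (n₁ n : ℝ) ^ m * (n₂ n : ℝ) ^ Fintype.card (Quotient π)) atTop
        (𝓝 ((β : ℝ) ^ Fintype.card (Quotient π))) := by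
    have := (tendsto_finsetProd Finset.univ fun q _ =>
      tendsto_pow_div_descFactorial hn₁ (blk π q + 1)).mul
      (hratio.pow (Fintype.card (Quotient π)))
    rw [Finset.prod_const_one, one_mul] at this
    refine this.congr fun n => ?_
    -- The block sizes add up to `m`, and each block contributes one further edge to the root.
    have hpow : ∏ q, (n₁ n : ℝ) ^ (blk π q + 1) =
        (n₁ n : ℝ) ^ m * (n₁ n : ℝ) ^ Fintype.card (Quotient π) := by
      rw [Finset.prod_pow_eq_pow_sum, Finset.sum_add_distrib, sum_blk, pow_add]
      simp
    have h0 : (n₁ n : ℝ) ≠ 0 := by simp [NeZero.ne]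
    rw [Finset.prod_div_distrib, hpow, div_pow]
    field_simp
  refine tendsto_of_eventually_le (s := fun K => treeSum m
    (fun π => (β : ℝ) ^ Fintype.card (Quotient π)) (fun _ => 1) fun a => cutMom D K a) ?_
    (fun b hb => ?_) (fun K b hb => ?_)
  · exact tendsto_treeSum hm (fun a _ _ => tendsto_const_nhds) fun a _ ha => tendsto_cutMom_atTop
      (fmom_lt_top (ha.trans (by omega)) hD).ne
  · refine eventually_facMom_le hm (fun n => passiveLaw (n₁ n) (n₂ n) (P n))
      (c := fun n π => (∏ q, ((n₁ n).descFactorial (blk π q + 1) : ℝ))⁻¹)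
      (fun n π => by positivity)
      (φ₁ := fun _ _ _ => 1) (fun _ _ _ => zero_le_one)
      (φ₂ := fun n a _ => (fmom (sizeLaw (P n)) a).toReal) (fun _ _ _ => ENNReal.toReal_nonneg)
      (.of_forall fun n π x e => (passiveLaw_tree (P n) π x e).le) hc ?_ ?_ hb
    · intro a _ _
      simp_rw [avg_const]
      exact tendsto_const_nhds
    · intro a _ ha
      simp_rw [avg_const]
      exact tendsto_fmom hQ hD hlim (ha.trans (by omega))
  · have hyC : Tendsto (fun n => (n₂ n : ℝ) * ((K : ℝ) / n₁ n)) atTop (𝓝 (K * (β : ℝ))) := by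
      refine (hratio.const_mul (K : ℝ)).congr fun n => by ring
    refine eventually_le_facMom hm hn₁ hn₂ (fun n => passiveLaw (n₁ n) (n₂ n) (P n))
      (fun n => passiveLaw (n₁ n) (n₂ n) (cutPMF K (P n)))
      (fun n f hf _ => integral_passiveLaw_cutPMF_le K (P n) f hf) (y := fun n => (K : ℝ) / n₁ n)
      (fun n => by positivity) (C := max (K * (β : ℝ) + 1) K) ?_ ?_
      (.of_forall fun n E _ => edgesProb_passiveLaw_le _ (cutPMF_support K (P n)) E)
      (c := fun n π => (∏ q, ((n₁ n).descFactorial (blk π q + 1) : ℝ))⁻¹) (δ := fun _ _ => 0)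
      (φ₁ := fun _ _ _ => 1) (fun _ _ _ => zero_le_one)
      (φ₂ := fun n a _ => (fmom (sizeLaw (cutPMF K (P n))) a).toReal)
      (fun _ _ _ => ENNReal.toReal_nonneg) (M := ((K : ℝ) + 1) ^ (m + 1)) (by positivity)
      (.of_forall fun n a ha ham _ => one_le_pow₀ (by linarith [K.cast_nonneg (α := ℝ)]))
      (.of_forall fun n a ha ham _ => fmom_sizeLaw_le _ _ ham)
      (.of_forall fun n π x e => by
        rw [sub_zero]
        exact (passiveLaw_tree (cutPMF K (P n)) π x e).ge) hc (fun _ _ => le_rfl)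
        (fun π => by simp) ?_ ?_ hb
    · refine .of_forall fun n => le_of_eq_of_le ?_ (le_max_right _ _)
      have : (n₁ n : ℝ) ≠ 0 := by simp [NeZero.ne]
      field_simp
    · filter_upwards [hyC.eventually_le_const (lt_add_one _)] with n hn
      exact hn.trans (le_max_left _ _)
    · intro a _ _
      simp_rw [avg_const]
      exact tendsto_const_nhds
    · intro a ha _
      simp_rw [avg_const, sizeLaw_cutPMF, fmom_map_cut _ K ha]
      exact tendsto_cutMom hQ K a

variable {D₁ D₂ : Measure ℕ} [IsProbabilityMeasure D₁] [IsProbabilityMeasure D₂]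
  {μ : ∀ n, Measure (BipGraph (Fin (n₁ n)) (Fin (n₂ n)))} [∀ n, IsProbabilityMeasure (μ n)]

theorem ActiveCase.tendsto (h : ActiveCase k n₁ n₂ β μ D₁ D₂) (hk : 1 ≤ k)
    (hn₁ : Tendsto n₁ atTop atTop) (hn₂ : Tendsto n₂ atTop atTop)
    (hβ : 0 < β) (hratio : Tendsto (fun n => (n₂ n : ℝ) / n₁ n) atTop (𝓝 β)) :
    limitDegreeMoment D₁ D₂ k < ⊤ ∧
      Tendsto (fun n => degreeMoment (μ n) k) atTop (𝓝 (limitDegreeMoment D₁ D₂ k)) := by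
  obtain ⟨P, hP⟩ := h.model
  obtain rfl : μ = fun n => activeLaw (n₁ n) (n₂ n) (P n) := funext hP
  have hQ (x : ℕ) : Tendsto (fun n => sizeLaw (P n) {x}) atTop (𝓝 (D₁ {x})) := by
    refine (tendsto_singleton_of_tendstoInDistribution h.tendsto_law x).congr fun n => ?_
    exact map_apply_singleton_of_lintegral (measurable_of_countable _).aemeasurable
      (lintegral_X₁_activeLaw (P n)) x
  have hlim : Tendsto (fun n => natMoment (sizeLaw (P n)) k) atTop (𝓝 (natMoment D₁ k)) := by
    refine h.tendsto_moment.congr fun n => ?_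
    exact lintegral_X₁_activeLaw (P n) fun x => (x : ℝ≥0∞) ^ k
  set r : ℝ≥0 := β⁻¹ * (natMoment D₁ 1).toNNReal with hr
  have hr0 : 0 < r := mul_pos (inv_pos.2 hβ)
    (ENNReal.toNNReal_pos h.mean_pos.ne' h.mean_lt_top.ne)
  have hD₂ : natMoment D₂ 1 = r := by rw [h.law₂, natMoment_poissonMeasure_one]
  have hD₂' : natMoment D₂ (k + 1) < ⊤ := by
    rw [h.law₂]
    exact natMoment_poissonMeasure_lt_top _ _
  have hpos : 0 < natMoment D₂ 1 := by rw [hD₂]; exact_mod_cast hr0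
  refine tendsto_degreeMoment h.mean_pos hpos hk h.moment_lt_top hD₂' fun m hm hmk => ?_
  rw [toReal_limFac (γ := fun _ => (β : ℝ)⁻¹ ^ m) (α₁ := fun a => (fmom D₁ a).toReal)
    (α₂ := fun _ => 1) (limFac_lt_top hpos hmk h.moment_lt_top hD₂')]
  · exact tendsto_facMom_activeLaw hn₁ hn₂ hβ hratio P hQ h.moment_lt_top hlim hm hmk
  · intro π
    have hr0' : (r : ℝ) ≠ 0 := by exact_mod_cast hr0.ne'
    -- The size-biased Poisson law minus one is the same Poisson law, so its factorial moments are
    -- powers of `r`. The product over the blocks is `r ^ m`, matching the `m` leaf factors.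
    have hq (q : Quotient π) : (natMoment D₂ 1).toReal⁻¹ * (fmom D₂ (blk π q + 1)).toReal =
        (r : ℝ) ^ blk π q := by
      rw [hD₂, h.law₂, fmom_poissonMeasure, ENNReal.toReal_pow, ENNReal.coe_toReal, pow_succ]
      field_simp
    simp_rw [hq]
    rw [Finset.prod_pow_eq_pow_sum, sum_blk, fmom_one, hr]
    push_cast
    rw [mul_pow, Finset.prod_const_one]
    ring

theorem PassiveCase.tendsto (h : PassiveCase k n₁ n₂ β μ D₁ D₂) (hk : 1 ≤ k)
    (hn₁ : Tendsto n₁ atTop atTop) (hn₂ : Tendsto n₂ atTop atTop)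
    (hβ : 0 < β) (hratio : Tendsto (fun n => (n₂ n : ℝ) / n₁ n) atTop (𝓝 β)) :
    limitDegreeMoment D₁ D₂ k < ⊤ ∧
      Tendsto (fun n => degreeMoment (μ n) k) atTop (𝓝 (limitDegreeMoment D₁ D₂ k)) := by
  obtain ⟨P, hP⟩ := h.model
  obtain rfl : μ = fun n => passiveLaw (n₁ n) (n₂ n) (P n) := funext hP
  have hQ (x : ℕ) : Tendsto (fun n => sizeLaw (P n) {x}) atTop (𝓝 (D₂ {x})) := by
    refine (tendsto_singleton_of_tendstoInDistribution h.tendsto_law x).congr fun n => ?_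
    exact map_apply_singleton_of_lintegral (measurable_of_countable _).aemeasurable
      (lintegral_X₂_passiveLaw (P n)) x
  have hlim : Tendsto (fun n => natMoment (sizeLaw (P n)) (k + 1)) atTop
      (𝓝 (natMoment D₂ (k + 1))) := by
    refine h.tendsto_moment.congr fun n => ?_
    exact lintegral_X₂_passiveLaw (P n) fun x => (x : ℝ≥0∞) ^ (k + 1)
  set r : ℝ≥0 := β * (natMoment D₂ 1).toNNReal
  have hpos : 0 < (natMoment D₂ 1).toNNReal :=
    ENNReal.toNNReal_pos h.mean_pos.ne' h.mean_lt_top.ne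
  have hr0 : 0 < r := mul_pos hβ hpos
  have hD₁ : 0 < natMoment D₁ 1 := by
    rw [h.law₁, natMoment_poissonMeasure_one]
    exact_mod_cast hr0
  have hD₁' : natMoment D₁ k < ⊤ := by
    rw [h.law₁]
    exact natMoment_poissonMeasure_lt_top _ _
  refine tendsto_degreeMoment hD₁ h.mean_pos hk hD₁' h.moment_lt_top fun m hm hmk => ?_
  rw [toReal_limFac (γ := fun π => (β : ℝ) ^ Fintype.card (Quotient π)) (α₁ := fun _ => 1)
    (α₂ := fun a => (fmom D₂ a).toReal) (limFac_lt_top h.mean_pos hmk hD₁' h.moment_lt_top)]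
  · exact tendsto_facMom_passiveLaw hn₁ hn₂ hratio P hQ h.moment_lt_top hlim hm hmk
  · intro π
    have hpos' : (natMoment D₂ 1).toReal ≠ 0 := by
      rw [← ENNReal.coe_toNNReal_eq_toReal]
      exact_mod_cast hpos.ne'
    -- The Poisson moment `(β * E D₂) ^ |π|` cancels the factors `1 / E D₂`, one per block, and
    -- leaves `β ^ |π|`.
    rw [h.law₁, fmom_poissonMeasure, ENNReal.toReal_pow, ENNReal.coe_toReal,
      Finset.prod_mul_distrib, Finset.prod_const, Finset.card_univ]
    push_cast
    rw [mul_pow, inv_pow, one_pow]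
    field_simp

end ActivePassiveLimit

/-! ### The inhomogeneous model -/

section Inhomog

variable {n₁ n₂ : ℕ}

instance (p : (Fin n₁ → ℝ≥0) × (Fin n₂ → ℝ≥0)) : IsProbabilityMeasure (inhomogGiven p) := by
  unfold inhomogGiven
  infer_instance

theorem measurable_toNNReal_edgeProb :
    Measurable fun q : ℝ≥0 × ℝ≥0 => unitInterval.toNNReal (edgeProb n₁ n₂ q.1 q.2) := by
  refine Measurable.subtype_mk ?_
  simp only [edgeProb]
  fun_prop

theorem measurable_bernoulliMeasure_edgeProb (s : Set Prop) :
    Measurable fun q : ℝ≥0 × ℝ≥0 => bernoulliMeasure True False (edgeProb n₁ n₂ q.1 q.2) s := by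
  classical
  have h₁ := measurable_toNNReal_edgeProb (n₁ := n₁) (n₂ := n₂)
  have h₂ : Measurable fun q : ℝ≥0 × ℝ≥0 =>
      unitInterval.toNNReal (unitInterval.symm (edgeProb n₁ n₂ q.1 q.2)) := by
    refine Measurable.subtype_mk ?_
    simp only [edgeProb, unitInterval.coe_symm_eq]
    fun_prop
  simp_rw [bernoulliMeasure_apply _ (MeasurableSet.of_discrete (s := s))]
  split_ifs <;> fun_prop

theorem inhomogGiven_singleton (p : (Fin n₁ → ℝ≥0) × (Fin n₂ → ℝ≥0))
    (H : BipGraph (Fin n₁) (Fin n₂)) : inhomogGiven p {H} =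
      ∏ v, ∏ w, bernoulliMeasure True False (edgeProb n₁ n₂ (p.1 v) (p.2 w)) {H v w} := by
  unfold inhomogGiven
  rw [Measure.pi_singleton]
  exact Finset.prod_congr rfl fun v _ => Measure.pi_singleton _ _

theorem measurable_comp_weights {f : ℝ≥0 × ℝ≥0 → ℝ≥0∞} (hf : Measurable f) (v : Fin n₁)
    (w : Fin n₂) : Measurable fun p : (Fin n₁ → ℝ≥0) × (Fin n₂ → ℝ≥0) => f (p.1 v, p.2 w) :=
  hf.comp (by fun_prop)

theorem measurable_inhomogGiven_singleton (H : BipGraph (Fin n₁) (Fin n₂)) :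
    Measurable fun p : (Fin n₁ → ℝ≥0) × (Fin n₂ → ℝ≥0) => inhomogGiven p {H} := by
  have h : (fun p : (Fin n₁ → ℝ≥0) × (Fin n₂ → ℝ≥0) => inhomogGiven p {H}) = fun p =>
      ∏ v, ∏ w, bernoulliMeasure True False (edgeProb n₁ n₂ (p.1 v) (p.2 w)) {H v w} :=
    funext fun p => inhomogGiven_singleton p H
  rw [h]
  exact Finset.measurable_fun_prod _ fun v _ => Finset.measurable_fun_prod _ fun w _ =>
    measurable_comp_weights (measurable_bernoulliMeasure_edgeProb {H v w}) v w

theorem measurable_measure_of_finite {α Ω : Type*} [MeasurableSpace α] [MeasurableSpace Ω]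
    [Finite Ω] [MeasurableSingletonClass Ω] {κ : α → Measure Ω}
    (h : ∀ ω, Measurable fun x => κ x {ω}) : Measurable κ := by
  refine Measure.measurable_of_measurable_coe _ fun s _ => ?_
  have hs (x : α) : κ x s = ∑ ω ∈ (Set.toFinite s).toFinset, κ x {ω} := by
    rw [sum_measure_singleton, Set.Finite.coe_toFinset]
  simp_rw [hs]
  exact Finset.measurable_fun_sum _ fun ω _ => h ω

theorem measurable_inhomogGiven :
    Measurable (inhomogGiven : (Fin n₁ → ℝ≥0) × (Fin n₂ → ℝ≥0) →
      Measure (BipGraph (Fin n₁) (Fin n₂))) :=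
  measurable_measure_of_finite measurable_inhomogGiven_singleton

theorem inhomogGiven_incl (p : (Fin n₁ → ℝ≥0) × (Fin n₂ → ℝ≥0)) {ι : Type*} [Fintype ι]
    {L : ι → Fin n₁} {R : ι → Fin n₂} (h : Function.Injective fun i => (L i, R i)) :
    inhomogGiven p (incl L R) =
      ∏ i, (unitInterval.toNNReal (edgeProb n₁ n₂ (p.1 (L i)) (p.2 (R i))) : ℝ≥0∞) := by
  classical
  have hset : incl L R = Set.univ.pi fun v => Set.univ.pi fun w =>
      {b : Prop | (∃ i, L i = v ∧ R i = w) → b} := by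
    ext H
    simp only [incl, Set.mem_pi, Set.mem_univ, forall_true_left]
    constructor
    · rintro hH v w ⟨i, rfl, rfl⟩
      exact hH i
    · exact fun hH i => hH (L i) (R i) ⟨i, rfl, rfl⟩
  rw [hset, inhomogGiven, Measure.pi_pi]
  simp_rw [Measure.pi_pi]
  rw [← Fintype.prod_prod_type' (f := fun v w =>
    bernoulliMeasure True False (edgeProb n₁ n₂ (p.1 v) (p.2 w))
      {b : Prop | (∃ i, L i = v ∧ R i = w) → b})]
  rw [← Finset.prod_subset (Finset.subset_univ (Finset.univ.map ⟨_, h⟩)), Finset.prod_map]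
  · refine Finset.prod_congr rfl fun i _ => ?_
    refine bernoulliMeasure_apply_of_mem_of_notMem _ .of_discrete ?_ ?_
    · exact fun _ => trivial
    · exact fun hf => hf ⟨i, rfl, rfl⟩
  · intro q _ hq
    refine bernoulliMeasure_apply_of_mem_of_mem _ .of_discrete ?_ ?_
    · exact fun _ => trivial
    · rintro ⟨i, h₁, h₂⟩
      exact hq (Finset.mem_map.2 ⟨i, Finset.mem_univ _, Prod.ext h₁ h₂⟩)

/-- The normalising factor `√(n₁ n₂)`. -/
def scale (n₁ n₂ : ℕ) : ℝ≥0 := NNReal.sqrt (n₁ * n₂)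

theorem coe_scale (n₁ n₂ : ℕ) : (scale n₁ n₂ : ℝ) = √((n₁ : ℝ) * n₂) := by
  simp [scale]

theorem toNNReal_edgeProb (x y : ℝ≥0) :
    unitInterval.toNNReal (edgeProb n₁ n₂ x y) = min (x * y / scale n₁ n₂) 1 := by
  ext
  simp [edgeProb, coe_scale]

theorem prod_comp_eq_prod_fib {ι T M : Type*} [Fintype ι] [Fintype T] [CommMonoid M]
    (f : ι → T) (g : T → M) : ∏ i, g (f i) = ∏ t, g t ^ fib f t := by
  classical
  rw [← Finset.prod_fiberwise' Finset.univ f g]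
  refine Finset.prod_congr rfl fun t _ => ?_
  rw [Finset.prod_const, fib, Nat.card_eq_fintype_card, Fintype.card_subtype]

theorem lintegral_pi_prod_pow {n : ℕ} (ν : Measure ℝ≥0) [IsProbabilityMeasure ν] (a : Fin n → ℕ) :
    ∫⁻ p, ∏ v, (p v : ℝ≥0∞) ^ a v ∂(Measure.pi fun _ : Fin n => ν) =
      ∏ v, weightMoment ν (a v) := by
  have hind := iIndepFun_pi (μ := fun _ : Fin n => ν)
    (X := fun v (x : ℝ≥0) => (x : ℝ≥0∞) ^ a v) fun v => by fun_prop
  rw [lintegral_prod_eq_prod_lintegral_of_indepFun Finset.univ _ hind fun v => by fun_prop]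
  refine Finset.prod_congr rfl fun v _ => ?_
  exact (measurePreserving_eval (fun _ : Fin n => ν) v).lintegral_comp
    (f := fun x : ℝ≥0 => (x : ℝ≥0∞) ^ a v) (by fun_prop)

variable (ν₁ ν₂ : Measure ℝ≥0) [IsProbabilityMeasure ν₁] [IsProbabilityMeasure ν₂]

instance : IsProbabilityMeasure (inhomogLaw n₁ n₂ ν₁ ν₂) := by
  constructor
  rw [inhomogLaw, Measure.bind_apply .univ measurable_inhomogGiven.aemeasurable]
  simp

theorem lintegral_weights {ι : Type*} [Fintype ι] (L : ι → Fin n₁) (R : ι → Fin n₂) :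
    ∫⁻ p, ∏ i, ((p.1 (L i) * p.2 (R i) / scale n₁ n₂ : ℝ≥0) : ℝ≥0∞)
      ∂((Measure.pi fun _ : Fin n₁ => ν₁).prod (Measure.pi fun _ : Fin n₂ => ν₂)) =
      (((scale n₁ n₂)⁻¹ ^ Fintype.card ι : ℝ≥0) : ℝ≥0∞) *
        ((∏ v, weightMoment ν₁ (fib L v)) * ∏ w, weightMoment ν₂ (fib R w)) := by
  have h (p : (Fin n₁ → ℝ≥0) × (Fin n₂ → ℝ≥0)) :
      ∏ i, ((p.1 (L i) * p.2 (R i) / scale n₁ n₂ : ℝ≥0) : ℝ≥0∞) =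
      (((scale n₁ n₂)⁻¹ ^ Fintype.card ι : ℝ≥0) : ℝ≥0∞) *
        ((∏ v, (p.1 v : ℝ≥0∞) ^ fib L v) * ∏ w, (p.2 w : ℝ≥0∞) ^ fib R w) := by
    rw [← prod_comp_eq_prod_fib L fun v => (p.1 v : ℝ≥0∞),
      ← prod_comp_eq_prod_fib R fun w => (p.2 w : ℝ≥0∞)]
    simp_rw [div_eq_mul_inv]
    push_cast
    rw [Finset.prod_mul_distrib, Finset.prod_mul_distrib, Finset.prod_const, Finset.card_univ,
      mul_comm]
  simp_rw [h]
  rw [lintegral_const_mul _ (by fun_prop), lintegral_prod_mul (f := fun p : Fin n₁ → ℝ≥0 =>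
    ∏ v, (p v : ℝ≥0∞) ^ fib L v) (g := fun p : Fin n₂ → ℝ≥0 => ∏ w, (p w : ℝ≥0∞) ^ fib R w)
    (Measurable.aemeasurable (by fun_prop)) (Measurable.aemeasurable (by fun_prop)),
    lintegral_pi_prod_pow, lintegral_pi_prod_pow]

/-- Dropping the minimum with `1` bounds the edge probabilities by products of weights, which
integrate to products of moments. -/
theorem inhomogLaw_incl_le {ι : Type*} [Fintype ι]
    {L : ι → Fin n₁} {R : ι → Fin n₂} (h : Function.Injective fun i => (L i, R i)) :
    inhomogLaw n₁ n₂ ν₁ ν₂ (incl L R) ≤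
      (((scale n₁ n₂)⁻¹ ^ Fintype.card ι : ℝ≥0) : ℝ≥0∞) *
        ((∏ v, weightMoment ν₁ (fib L v)) * ∏ w, weightMoment ν₂ (fib R w)) := by
  rw [inhomogLaw, Measure.bind_apply .of_discrete measurable_inhomogGiven.aemeasurable,
    ← lintegral_weights]
  refine lintegral_mono fun p => ?_
  rw [inhomogGiven_incl p h]
  refine Finset.prod_le_prod' fun i _ => ?_
  rw [toNNReal_edgeProb]
  exact ENNReal.coe_le_coe.2 (min_le_left _ _)

/-- Weights above `K` are replaced by `0`. -/
def cutWeight (K : ℕ) (x : ℝ≥0) : ℝ≥0 := if x ≤ K then x else 0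

theorem measurable_cutWeight (K : ℕ) : Measurable (cutWeight K) :=
  Measurable.ite measurableSet_Iic measurable_id measurable_const

theorem cutWeight_le (K : ℕ) (x : ℝ≥0) : cutWeight K x ≤ K := by
  unfold cutWeight
  split_ifs with h
  · exact h
  · exact zero_le

/-- Truncation of all the weights. -/
def cutWeights (K : ℕ) (p : (Fin n₁ → ℝ≥0) × (Fin n₂ → ℝ≥0)) :
    (Fin n₁ → ℝ≥0) × (Fin n₂ → ℝ≥0) :=
  (fun v => cutWeight K (p.1 v), fun w => cutWeight K (p.2 w))

theorem measurable_cutWeights (K : ℕ) :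
    Measurable (cutWeights K : (Fin n₁ → ℝ≥0) × (Fin n₂ → ℝ≥0) → _) := by
  have := measurable_cutWeight K
  unfold cutWeights
  fun_prop

theorem measurable_inhomogGiven_cutWeights (K : ℕ) :
    Measurable fun p : (Fin n₁ → ℝ≥0) × (Fin n₂ → ℝ≥0) => inhomogGiven (cutWeights K p) :=
  measurable_inhomogGiven.comp (measurable_cutWeights K)

instance (K : ℕ) (ν : Measure ℝ≥0) [IsProbabilityMeasure ν] :
    IsProbabilityMeasure (ν.map (cutWeight K)) :=
  Measure.isProbabilityMeasure_map (measurable_cutWeight K).aemeasurable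

theorem inhomogLaw_cutWeight (K : ℕ) :
    inhomogLaw n₁ n₂ (ν₁.map (cutWeight K)) (ν₂.map (cutWeight K)) =
      ((Measure.pi fun _ : Fin n₁ => ν₁).prod (Measure.pi fun _ : Fin n₂ => ν₂)).bind
        fun p => inhomogGiven (cutWeights K p) := by
  have hK := measurable_cutWeight K
  rw [inhomogLaw, ← Measure.pi_map_pi fun _ => hK.aemeasurable,
    ← Measure.pi_map_pi fun _ => hK.aemeasurable, Measure.map_prod_map _ _ (by fun_prop)
      (by fun_prop)]
  ext s hs
  rw [Measure.bind_apply hs measurable_inhomogGiven.aemeasurable,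
    Measure.bind_apply hs (measurable_inhomogGiven_cutWeights K).aemeasurable,
    lintegral_map ((Measure.measurable_measure.1 measurable_inhomogGiven) s hs) (by fun_prop)]
  rfl

/-- Setting a weight to `0` deletes the edge, so truncating weights is a coupling with a subgraph.
-/
theorem bernoulliMeasure_cutWeight (K : ℕ) (x y : ℝ≥0) :
    bernoulliMeasure True False (edgeProb n₁ n₂ (cutWeight K x) (cutWeight K y)) =
      (bernoulliMeasure True False (edgeProb n₁ n₂ x y)).map fun b => b ∧ x ≤ K ∧ y ≤ K := by
  by_cases h : x ≤ K ∧ y ≤ K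
  · simp [cutWeight, h.1, h.2]
  · have h₁ : edgeProb n₁ n₂ (cutWeight K x) (cutWeight K y) = 0 := by
      have : (cutWeight K x : ℝ) * cutWeight K y = 0 := by
        rw [not_and_or] at h
        rcases h with h | h <;> simp [cutWeight, h]
      ext
      simp [edgeProb, this]
    simp only [h₁, bernoulliMeasure_zero, h, and_false]
    rw [Measure.map_const]
    simp

theorem inhomogGiven_cutWeights (K : ℕ) (p : (Fin n₁ → ℝ≥0) × (Fin n₂ → ℝ≥0)) :
    inhomogGiven (cutWeights K p) =
      (inhomogGiven p).map fun H v w => H v w ∧ p.1 v ≤ K ∧ p.2 w ≤ K := by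
  have h₁ (v : Fin n₁) : (Measure.pi fun w =>
      bernoulliMeasure True False (edgeProb n₁ n₂ (p.1 v) (p.2 w))).map
        (fun (S : Fin n₂ → Prop) w => S w ∧ p.1 v ≤ K ∧ p.2 w ≤ K) =
      Measure.pi fun w => bernoulliMeasure True False
        (edgeProb n₁ n₂ (cutWeight K (p.1 v)) (cutWeight K (p.2 w))) := by
    simp_rw [bernoulliMeasure_cutWeight]
    exact Measure.pi_map_pi (f := fun w (b : Prop) => b ∧ p.1 v ≤ K ∧ p.2 w ≤ K)
      fun w => (measurable_of_countable _).aemeasurable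
  simp only [inhomogGiven, cutWeights]
  simp_rw [← h₁]
  have (v : Fin n₁) : IsProbabilityMeasure ((Measure.pi fun w =>
      bernoulliMeasure True False (edgeProb n₁ n₂ (p.1 v) (p.2 w))).map
        (fun (S : Fin n₂ → Prop) w => S w ∧ p.1 v ≤ K ∧ p.2 w ≤ K)) :=
    Measure.isProbabilityMeasure_map (measurable_of_countable _).aemeasurable
  exact (Measure.pi_map_pi (f := fun v (S : Fin n₂ → Prop) w => S w ∧ p.1 v ≤ K ∧ p.2 w ≤ K)
      fun v => (measurable_of_countable _).aemeasurable).symm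

theorem integral_inhomogLaw_cutWeight_le (K : ℕ) (f : BipGraph (Fin n₁) (Fin n₂) → ℝ)
    (hf : Monotone f) (hf₀ : 0 ≤ f) :
    ∫ H, f H ∂(inhomogLaw n₁ n₂ (ν₁.map (cutWeight K)) (ν₂.map (cutWeight K))) ≤
      ∫ H, f H ∂(inhomogLaw n₁ n₂ ν₁ ν₂) := by
  -- Non-negativity of `f` permits passing to `lintegral`, where the mixture over the weights can be
  -- disintegrated.
  rw [← ENNReal.ofReal_le_ofReal_iff (integral_nonneg hf₀),
    ofReal_integral_eq_lintegral_ofReal .of_finite (.of_forall hf₀),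
    ofReal_integral_eq_lintegral_ofReal .of_finite (.of_forall hf₀), inhomogLaw_cutWeight,
    inhomogLaw, Measure.lintegral_bind
      (measurable_inhomogGiven_cutWeights K).aemeasurable
      (measurable_of_countable _).aemeasurable,
    Measure.lintegral_bind measurable_inhomogGiven.aemeasurable
      (measurable_of_countable _).aemeasurable]
  refine lintegral_mono fun p => ?_
  dsimp only
  rw [inhomogGiven_cutWeights, lintegral_map (measurable_of_countable _)
    (measurable_of_countable _)]
  exact lintegral_mono fun H => ENNReal.ofReal_le_ofReal (hf fun v w h => h.1)

theorem edgesProb_inhomogLaw_le (K : ℕ) (E : Finset (Fin n₁ × Fin n₂)) :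
    edgesProb (inhomogLaw n₁ n₂ (ν₁.map (cutWeight K)) (ν₂.map (cutWeight K))) E ≤
      ((K : ℝ) * K / scale n₁ n₂) ^ E.card := by
  have hinj : Function.Injective fun e : E => (e.1.1, e.1.2) := fun e e' h => Subtype.ext h
  rw [edgesProb_eq_incl, Measure.real, inhomogLaw_cutWeight,
    Measure.bind_apply .of_discrete
      (measurable_inhomogGiven_cutWeights K).aemeasurable]
  have hb (p : (Fin n₁ → ℝ≥0) × (Fin n₂ → ℝ≥0)) : inhomogGiven (cutWeights K p)
      (incl (fun e : E => e.1.1) fun e : E => e.1.2) ≤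
      (((K : ℝ≥0) * K / scale n₁ n₂ : ℝ≥0) : ℝ≥0∞) ^ E.card := by
    rw [inhomogGiven_incl _ hinj, ← Fintype.card_coe, ← Finset.card_univ, ← Finset.prod_const]
    refine Finset.prod_le_prod' fun e _ => ?_
    rw [toNNReal_edgeProb]
    refine ENNReal.coe_le_coe.2 ((min_le_left _ _).trans ?_)
    simp only [cutWeights]
    gcongr <;> exact cutWeight_le _ _
  refine ENNReal.toReal_le_of_le_ofReal (by positivity) ((lintegral_mono hb).trans ?_)
  rw [lintegral_const, measure_univ, mul_one, ENNReal.ofReal_pow (by positivity)]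
  refine le_of_eq ?_
  congr 1
  rw [← ENNReal.ofReal_coe_nnreal]
  simp

/-- For weights at most `K` with `K * K ≤ scale n₁ n₂` the minimum with `1` is never active, so the
product bound becomes an equality. -/
theorem inhomogLaw_incl_cutWeight {K : ℕ} (hK : (K : ℝ≥0) * K ≤ scale n₁ n₂)
    {ι : Type*} [Fintype ι]
    {L : ι → Fin n₁} {R : ι → Fin n₂} (h : Function.Injective fun i => (L i, R i)) :
    inhomogLaw n₁ n₂ (ν₁.map (cutWeight K)) (ν₂.map (cutWeight K)) (incl L R) =
      (((scale n₁ n₂)⁻¹ ^ Fintype.card ι : ℝ≥0) : ℝ≥0∞) *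
        ((∏ v, weightMoment (ν₁.map (cutWeight K)) (fib L v)) *
          ∏ w, weightMoment (ν₂.map (cutWeight K)) (fib R w)) := by
  have hcut := measurable_cutWeight K
  rw [← lintegral_weights, inhomogLaw_cutWeight, ← Measure.pi_map_pi fun _ => hcut.aemeasurable,
    ← Measure.pi_map_pi fun _ => hcut.aemeasurable, Measure.map_prod_map _ _ (by fun_prop)
      (by fun_prop), lintegral_map (by fun_prop) (by fun_prop), Measure.bind_apply .of_discrete
      (measurable_inhomogGiven_cutWeights K).aemeasurable]
  refine lintegral_congr fun p => ?_
  rw [inhomogGiven_incl _ h]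
  refine Finset.prod_congr rfl fun i _ => ?_
  rw [toNNReal_edgeProb, min_eq_left]
  · rfl
  · refine div_le_one_of_le₀ (le_trans ?_ hK) zero_le
    simp only [cutWeights]
    gcongr <;> exact cutWeight_le _ _

end Inhomog

/-! ### Moments of truncated weights and tree probabilities in the inhomogeneous model -/

section InhomogLimit

theorem weightMoment_lt_top_of_le {ν : Measure ℝ≥0} [IsProbabilityMeasure ν] {a k : ℕ}
    (hak : a ≤ k) (h : weightMoment ν k < ⊤) : weightMoment ν a < ⊤ := by
  have hle : weightMoment ν a ≤ ∫⁻ x, (1 + (x : ℝ≥0∞) ^ k) ∂ν := by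
    refine lintegral_mono fun x => ?_
    rcases le_total (x : ℝ≥0∞) 1 with hx | hx
    · exact (pow_le_one₀ zero_le hx).trans le_self_add
    · exact (pow_le_pow_right₀ hx hak).trans le_add_self
  refine hle.trans_lt ?_
  rw [lintegral_add_left measurable_const, lintegral_const, measure_univ, mul_one]
  exact ENNReal.add_lt_top.2 ⟨ENNReal.one_lt_top, h⟩

theorem weightMoment_zero (ν : Measure ℝ≥0) [IsProbabilityMeasure ν] : weightMoment ν 0 = 1 := by
  simp [weightMoment]

theorem weightMoment_map_mul (ν : Measure ℝ≥0) (r s : ℝ≥0) (a : ℕ) :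
    weightMoment (ν.map fun x => r * x * s) a = ((r * s : ℝ≥0) : ℝ≥0∞) ^ a * weightMoment ν a := by
  rw [weightMoment, lintegral_map (by fun_prop) (by fun_prop), weightMoment,
    ← lintegral_const_mul _ (by fun_prop)]
  refine lintegral_congr fun x => ?_
  push_cast
  ring

theorem weightMoment_cutWeight (ν : Measure ℝ≥0) (K a : ℕ) :
    weightMoment (ν.map (cutWeight K)) a = ∫⁻ x, (cutWeight K x : ℝ≥0∞) ^ a ∂ν := by
  rw [weightMoment, lintegral_map (by fun_prop) (measurable_cutWeight K)]

theorem weightMoment_cutWeight_le (ν : Measure ℝ≥0) [IsProbabilityMeasure ν] (K a : ℕ) :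
    weightMoment (ν.map (cutWeight K)) a ≤ (K : ℝ≥0∞) ^ a := by
  rw [weightMoment_cutWeight]
  refine (lintegral_mono fun x => ?_).trans (by rw [lintegral_const, measure_univ, mul_one])
  gcongr
  exact_mod_cast cutWeight_le K x

theorem tendsto_weightMoment_cutWeight (ν : Measure ℝ≥0) (a : ℕ) :
    Tendsto (fun K => weightMoment (ν.map (cutWeight K)) a) atTop (𝓝 (weightMoment ν a)) := by
  simp_rw [weightMoment_cutWeight]
  refine lintegral_tendsto_of_tendsto_of_monotone (fun K => ?_) (.of_forall fun x => ?_)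
    (.of_forall fun x => ?_)
  · have := measurable_cutWeight K
    exact Measurable.aemeasurable (by fun_prop)
  · intro K K' hK
    dsimp only
    gcongr
    unfold cutWeight
    split_ifs with h h'
    · exact le_rfl
    · exact absurd (h.trans (by exact_mod_cast hK)) h'
    · exact zero_le
    · exact le_rfl
  · obtain ⟨K₀, hK₀⟩ := exists_nat_ge x
    refine tendsto_const_nhds.congr' ?_
    filter_upwards [eventually_ge_atTop K₀] with K hK
    rw [cutWeight, if_pos (hK₀.trans (by exact_mod_cast hK))]

variable {n₁ n₂ m : ℕ}

theorem weights_tree (ν₁ ν₂ : Measure ℝ≥0) [IsProbabilityMeasure ν₁] [IsProbabilityMeasure ν₂]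
    (π : Setoid (Fin m)) (x : Option (Fin m) ↪ Fin n₁) (e : Quotient π ↪ Fin n₂) :
    ((((scale n₁ n₂)⁻¹ ^ Fintype.card (Quotient π ⊕ Fin m) : ℝ≥0) : ℝ≥0∞) *
      ((∏ v, weightMoment ν₁ (fib (treeL π x) v)) *
        ∏ w, weightMoment ν₂ (fib (treeR π e) w))).toReal =
      ((scale n₁ n₂ : ℝ)⁻¹ ^ (Fintype.card (Quotient π) + m)) *
        (∏ o, rootWeight π (fun a (_ : Fin n₁) => (weightMoment ν₁ a).toReal) o (x o)) *
        ∏ q, midWeight π (fun a (_ : Fin n₂) => (weightMoment ν₂ a).toReal) q (e q) := by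
  rw [prod_fib_treeL π x (fun _ a => weightMoment ν₁ a) fun _ => weightMoment_zero ν₁,
    prod_fib_treeR π e (fun _ a => weightMoment ν₂ a) fun _ => weightMoment_zero ν₂,
    prod_rootWeight, ENNReal.toReal_mul, ENNReal.toReal_mul, ENNReal.toReal_mul,
    ENNReal.toReal_prod, ENNReal.toReal_prod, ENNReal.coe_toReal, Fintype.card_sum,
    Fintype.card_fin]
  simp only [midWeight]
  push_cast
  ring

theorem inhomogLaw_tree_le {ν₁ ν₂ : Measure ℝ≥0} [IsProbabilityMeasure ν₁]
    [IsProbabilityMeasure ν₂] (h₁ : ∀ a ≤ m, weightMoment ν₁ a < ⊤) (hm : 1 ≤ m)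
    (h₂ : ∀ a ≤ m + 1, weightMoment ν₂ a < ⊤)
    (π : Setoid (Fin m)) (x : Option (Fin m) ↪ Fin n₁) (e : Quotient π ↪ Fin n₂) :
    (inhomogLaw n₁ n₂ ν₁ ν₂).real (incl (treeL π x) (treeR π e)) ≤
      ((scale n₁ n₂ : ℝ)⁻¹ ^ (Fintype.card (Quotient π) + m)) *
        (∏ o, rootWeight π (fun a (_ : Fin n₁) => (weightMoment ν₁ a).toReal) o (x o)) *
        ∏ q, midWeight π (fun a (_ : Fin n₂) => (weightMoment ν₂ a).toReal) q (e q) := by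
  rw [← weights_tree]
  refine ENNReal.toReal_mono (ne_of_lt ?_)
    (inhomogLaw_incl_le ν₁ ν₂ (treeL_treeR_injective π x e))
  rw [prod_fib_treeL π x (fun _ a => weightMoment ν₁ a) fun _ => weightMoment_zero ν₁,
    prod_fib_treeR π e (fun _ a => weightMoment ν₂ a) fun _ => weightMoment_zero ν₂]
  refine ENNReal.mul_lt_top ENNReal.coe_lt_top (ENNReal.mul_lt_top (ENNReal.mul_lt_top ?_ ?_) ?_)
  · exact h₁ _ (card_quotient_le π)
  · exact ENNReal.prod_lt_top fun _ _ => h₁ _ hm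
  · exact ENNReal.prod_lt_top fun q _ => h₂ _ (by have := blk_le π q; omega)

theorem inhomogLaw_tree_cutWeight (ν₁ ν₂ : Measure ℝ≥0) [IsProbabilityMeasure ν₁]
    [IsProbabilityMeasure ν₂] {K : ℕ} (hK : (K : ℝ≥0) * K ≤ scale n₁ n₂)
    (π : Setoid (Fin m)) (x : Option (Fin m) ↪ Fin n₁) (e : Quotient π ↪ Fin n₂) :
    (inhomogLaw n₁ n₂ (ν₁.map (cutWeight K)) (ν₂.map (cutWeight K))).real
        (incl (treeL π x) (treeR π e)) =
      ((scale n₁ n₂ : ℝ)⁻¹ ^ (Fintype.card (Quotient π) + m)) *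
        (∏ o, rootWeight π
          (fun a (_ : Fin n₁) => (weightMoment (ν₁.map (cutWeight K)) a).toReal) o (x o)) *
        ∏ q, midWeight π
          (fun a (_ : Fin n₂) => (weightMoment (ν₂.map (cutWeight K)) a).toReal) q (e q) := by
  rw [← weights_tree, Measure.real, inhomogLaw_incl_cutWeight ν₁ ν₂ hK
    (treeL_treeR_injective π x e)]

end InhomogLimit

/-! ### The limit in the inhomogeneous model -/

section InhomogTendsto

theorem tendsto_scale {n₁ n₂ : ℕ → ℕ} (hn₁ : Tendsto n₁ atTop atTop) (hn₂ : Tendsto n₂ atTop atTop) :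
    Tendsto (fun n => (scale (n₁ n) (n₂ n) : ℝ)) atTop atTop := by
  simp_rw [coe_scale]
  exact Real.tendsto_sqrt_atTop.comp
    ((tendsto_natCast_atTop_atTop.comp hn₁).atTop_mul_atTop₀
      (tendsto_natCast_atTop_atTop.comp hn₂))

variable {k : ℕ} {n₁ n₂ : ℕ → ℕ} [∀ n, NeZero (n₁ n)] [∀ n, NeZero (n₂ n)] {β : ℝ≥0}

theorem tendsto_div_scale₁ (hβ : 0 < β)
    (hratio : Tendsto (fun n => (n₂ n : ℝ) / n₁ n) atTop (𝓝 β)) :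
    Tendsto (fun n => (n₁ n : ℝ) / scale (n₁ n) (n₂ n)) atTop (𝓝 (√β)⁻¹) := by
  have := (Real.continuous_sqrt.tendsto _).comp (tendsto_ratio_inv hβ hratio)
  rw [Real.sqrt_inv] at this
  refine this.congr fun n => ?_
  have h₁ : 0 < √(n₁ n : ℝ) := Real.sqrt_pos.2 (by exact_mod_cast NeZero.pos (n₁ n))
  have h₂ : 0 < √(n₂ n : ℝ) := Real.sqrt_pos.2 (by exact_mod_cast NeZero.pos (n₂ n))
  rw [Function.comp_apply, coe_scale, Real.sqrt_mul (by positivity), Real.sqrt_div (by positivity)]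
  nth_rw 2 [← Real.mul_self_sqrt (n₁ n).cast_nonneg]
  field_simp

theorem tendsto_div_scale₂ (hratio : Tendsto (fun n => (n₂ n : ℝ) / n₁ n) atTop (𝓝 β)) :
    Tendsto (fun n => (n₂ n : ℝ) / scale (n₁ n) (n₂ n)) atTop (𝓝 (√β)) := by
  refine ((Real.continuous_sqrt.tendsto _).comp hratio).congr fun n => ?_
  have h₁ : 0 < √(n₁ n : ℝ) := Real.sqrt_pos.2 (by exact_mod_cast NeZero.pos (n₁ n))
  have h₂ : 0 < √(n₂ n : ℝ) := Real.sqrt_pos.2 (by exact_mod_cast NeZero.pos (n₂ n))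
  rw [Function.comp_apply, coe_scale, Real.sqrt_mul (by positivity), Real.sqrt_div (by positivity)]
  nth_rw 2 [← Real.mul_self_sqrt (n₂ n).cast_nonneg]
  field_simp

theorem tendsto_facMom_inhomogLaw (hn₁ : Tendsto n₁ atTop atTop) (hn₂ : Tendsto n₂ atTop atTop)
    (hβ : 0 < β) (hratio : Tendsto (fun n => (n₂ n : ℝ) / n₁ n) atTop (𝓝 β))
    {ν₁ ν₂ : Measure ℝ≥0} [IsProbabilityMeasure ν₁] [IsProbabilityMeasure ν₂]
    {m : ℕ} (hm : 1 ≤ m) (h₁ : ∀ a ≤ m, weightMoment ν₁ a < ⊤)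
    (h₂ : ∀ a ≤ m + 1, weightMoment ν₂ a < ⊤) :
    Tendsto (fun n => facMom (inhomogLaw (n₁ n) (n₂ n) ν₁ ν₂) m) atTop
      (𝓝 (treeSum m (fun π => √β ^ Fintype.card (Quotient π) * (√β)⁻¹ ^ m)
        (fun a => (weightMoment ν₁ a).toReal) fun a => (weightMoment ν₂ a).toReal)) := by
  have hs₁ := tendsto_div_scale₁ hβ hratio
  have hs₂ := tendsto_div_scale₂ hratio
  have hc (π : Setoid (Fin m)) : Tendsto (fun n =>
      (scale (n₁ n) (n₂ n) : ℝ)⁻¹ ^ (Fintype.card (Quotient π) + m) *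
        (n₁ n : ℝ) ^ m * (n₂ n : ℝ) ^ Fintype.card (Quotient π)) atTop
        (𝓝 (√β ^ Fintype.card (Quotient π) * (√β)⁻¹ ^ m)) := by
    refine ((hs₂.pow (Fintype.card (Quotient π))).mul (hs₁.pow m)).congr fun n => ?_
    rw [div_pow, div_pow, pow_add, inv_pow, inv_pow]
    ring
  have hfin (ν : Measure ℝ≥0) [IsProbabilityMeasure ν] (K a : ℕ) :
      (weightMoment (ν.map (cutWeight K)) a).toReal ≤ (K : ℝ) ^ a :=
    ENNReal.toReal_le_of_le_ofReal (by positivity) (by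
      rw [ENNReal.ofReal_pow (by positivity), ENNReal.ofReal_natCast]
      exact weightMoment_cutWeight_le ν K a)
  have hM (ν : Measure ℝ≥0) [IsProbabilityMeasure ν] (K a : ℕ) (ha : a ≤ m + 1) :
      (weightMoment (ν.map (cutWeight K)) a).toReal ≤ ((K : ℝ) + 1) ^ (m + 1) := by
    have hK : (0 : ℝ) ≤ K := K.cast_nonneg
    calc _ ≤ (K : ℝ) ^ a := hfin ν K a
      _ ≤ ((K : ℝ) + 1) ^ a := by gcongr; linarith
      _ ≤ _ := pow_le_pow_right₀ (by linarith) ha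
  refine tendsto_of_eventually_le (s := fun K => treeSum m
    (fun π => √β ^ Fintype.card (Quotient π) * (√β)⁻¹ ^ m)
    (fun a => (weightMoment (ν₁.map (cutWeight K)) a).toReal)
    fun a => (weightMoment (ν₂.map (cutWeight K)) a).toReal) ?_
    (fun b hb => ?_) (fun K b hb => ?_)
  · exact tendsto_treeSum hm (fun a _ ha => (ENNReal.tendsto_toReal (h₁ a ha).ne).comp
      (tendsto_weightMoment_cutWeight ν₁ a)) fun a _ ha =>
      (ENNReal.tendsto_toReal (h₂ a ha).ne).comp (tendsto_weightMoment_cutWeight ν₂ a)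
  · refine eventually_facMom_le hm (fun n => inhomogLaw (n₁ n) (n₂ n) ν₁ ν₂)
      (c := fun n π => (scale (n₁ n) (n₂ n) : ℝ)⁻¹ ^ (Fintype.card (Quotient π) + m))
      (fun n π => by positivity)
      (φ₁ := fun _ a _ => (weightMoment ν₁ a).toReal) (fun _ _ _ => ENNReal.toReal_nonneg)
      (φ₂ := fun _ a _ => (weightMoment ν₂ a).toReal) (fun _ _ _ => ENNReal.toReal_nonneg)
      (.of_forall fun n π x e => inhomogLaw_tree_le h₁ hm h₂ π x e) hc ?_ ?_ hb
    · intro a _ _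
      simp_rw [avg_const]
      exact tendsto_const_nhds
    · intro a _ _
      simp_rw [avg_const]
      exact tendsto_const_nhds
  · refine eventually_le_facMom hm hn₁ hn₂ (fun n => inhomogLaw (n₁ n) (n₂ n) ν₁ ν₂)
      (fun n => inhomogLaw (n₁ n) (n₂ n) (ν₁.map (cutWeight K)) (ν₂.map (cutWeight K)))
      (fun n f hf hf₀ => integral_inhomogLaw_cutWeight_le ν₁ ν₂ K f hf hf₀)
      (y := fun n => (K : ℝ) * K / scale (n₁ n) (n₂ n))
      (fun n => by positivity)
      (C := max (K * K * (√β)⁻¹ + 1) (K * K * √β + 1)) ?_ ?_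
      (.of_forall fun n E _ => edgesProb_inhomogLaw_le ν₁ ν₂ K E)
      (c := fun n π => (scale (n₁ n) (n₂ n) : ℝ)⁻¹ ^ (Fintype.card (Quotient π) + m))
      (δ := fun _ _ => 0)
      (φ₁ := fun _ a _ => (weightMoment (ν₁.map (cutWeight K)) a).toReal)
      (fun _ _ _ => ENNReal.toReal_nonneg)
      (φ₂ := fun _ a _ => (weightMoment (ν₂.map (cutWeight K)) a).toReal)
      (fun _ _ _ => ENNReal.toReal_nonneg) (M := ((K : ℝ) + 1) ^ (m + 1)) (by positivity)
      (.of_forall fun n a _ ham _ => hM ν₁ K a (by omega))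
      (.of_forall fun n a _ ham _ => hM ν₂ K a ham)
      ?_ hc (fun _ _ => le_rfl) (fun π => by simp) ?_ ?_ hb
    · filter_upwards [(hs₁.const_mul ((K : ℝ) * K)).eventually_le_const (lt_add_one _)] with n hn
      refine le_trans (le_of_eq ?_) (hn.trans (le_max_left _ _))
      ring
    · filter_upwards [(hs₂.const_mul ((K : ℝ) * K)).eventually_le_const (lt_add_one _)] with n hn
      refine le_trans (le_of_eq ?_) (hn.trans (le_max_right _ _))
      ring
    · filter_upwards [(tendsto_scale hn₁ hn₂).eventually_ge_atTop ((K : ℝ) * K)] with n hn π x e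
      rw [sub_zero]
      exact (inhomogLaw_tree_cutWeight ν₁ ν₂ (by exact_mod_cast hn) π x e).ge
    · intro a _ _
      simp_rw [avg_const]
      exact tendsto_const_nhds
    · intro a _ _
      simp_rw [avg_const]
      exact tendsto_const_nhds

variable {D₁ D₂ : Measure ℕ} [IsProbabilityMeasure D₁] [IsProbabilityMeasure D₂]
  {μ : ∀ n, Measure (BipGraph (Fin (n₁ n)) (Fin (n₂ n)))} [∀ n, IsProbabilityMeasure (μ n)]

theorem InhomogCase.tendsto {ν₁ ν₂ : Measure ℝ≥0} (h : InhomogCase k n₁ n₂ β μ D₁ D₂ ν₁ ν₂)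
    (hk : 1 ≤ k) (hn₁ : Tendsto n₁ atTop atTop) (hn₂ : Tendsto n₂ atTop atTop)
    (hβ : 0 < β) (hratio : Tendsto (fun n => (n₂ n : ℝ) / n₁ n) atTop (𝓝 β)) :
    limitDegreeMoment D₁ D₂ k < ⊤ ∧
      Tendsto (fun n => degreeMoment (μ n) k) atTop (𝓝 (limitDegreeMoment D₁ D₂ k)) := by
  have := h.prob₁
  have := h.prob₂
  obtain rfl : μ = fun n => inhomogLaw (n₁ n) (n₂ n) ν₁ ν₂ := funext h.model
  have hν₁ (a : ℕ) (ha : a ≤ k) : weightMoment ν₁ a < ⊤ :=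
    weightMoment_lt_top_of_le ha h.moment_lt_top₁
  have hν₂ (a : ℕ) (ha : a ≤ k + 1) : weightMoment ν₂ a < ⊤ :=
    weightMoment_lt_top_of_le ha h.moment_lt_top₂
  set w₁ : ℝ≥0 := (weightMoment ν₁ 1).toNNReal
  set w₂ : ℝ≥0 := (weightMoment ν₂ 1).toNNReal
  have hw₁0 : 0 < w₁ := ENNReal.toNNReal_pos h.mean_pos₁.ne' h.mean_lt_top₁.ne
  have hw₂0 : 0 < w₂ := ENNReal.toNNReal_pos h.mean_pos₂.ne' h.mean_lt_top₂.ne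
  have hw₁' : weightMoment ν₁ 1 = w₁ := (ENNReal.coe_toNNReal h.mean_lt_top₁.ne).symm
  have hw₂' : weightMoment ν₂ 1 = w₂ := (ENNReal.coe_toNNReal h.mean_lt_top₂.ne).symm
  have hs : 0 < NNReal.sqrt β := NNReal.sqrt_pos.2 hβ
  have hD₁ (a : ℕ) : fmom D₁ a = ((NNReal.sqrt β * w₂ : ℝ≥0) : ℝ≥0∞) ^ a * weightMoment ν₁ a := by
    rw [h.law₁, fmom_mixedPoisson, weightMoment_map_mul]
  have hD₂ (a : ℕ) :
      fmom D₂ a = (((NNReal.sqrt β)⁻¹ * w₁ : ℝ≥0) : ℝ≥0∞) ^ a * weightMoment ν₂ a := by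
    rw [h.law₂, fmom_mixedPoisson, weightMoment_map_mul]
  have hpos₁ : 0 < natMoment D₁ 1 := by
    rw [← fmom_one, hD₁, hw₁', pow_one]
    exact_mod_cast mul_pos (mul_pos hs hw₂0) hw₁0
  have hmean₂ : natMoment D₂ 1 = ((NNReal.sqrt β)⁻¹ * w₁ * w₂ : ℝ≥0) := by
    rw [← fmom_one, hD₂, hw₂', pow_one, ← ENNReal.coe_mul]
  have hpos₂ : 0 < natMoment D₂ 1 := by
    rw [hmean₂]
    exact_mod_cast mul_pos (mul_pos (inv_pos.2 hs) hw₁0) hw₂0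
  have hfin₁ : natMoment D₁ k < ⊤ := natMoment_lt_top_of_fmom fun m hm => by
    rw [hD₁]
    exact ENNReal.mul_lt_top (ENNReal.pow_lt_top ENNReal.coe_lt_top) (hν₁ m hm)
  have hfin₂ : natMoment D₂ (k + 1) < ⊤ := natMoment_lt_top_of_fmom fun m hm => by
    rw [hD₂]
    exact ENNReal.mul_lt_top (ENNReal.pow_lt_top ENNReal.coe_lt_top) (hν₂ m hm)
  refine tendsto_degreeMoment hpos₁ hpos₂ hk hfin₁ hfin₂ fun m hm hmk => ?_
  rw [toReal_limFac (γ := fun π => √β ^ Fintype.card (Quotient π) * (√β)⁻¹ ^ m)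
    (α₁ := fun a => (weightMoment ν₁ a).toReal) (α₂ := fun a => (weightMoment ν₂ a).toReal)
    (limFac_lt_top hpos₂ hmk hfin₁ hfin₂)]
  · exact tendsto_facMom_inhomogLaw hn₁ hn₂ hβ hratio hm (fun a ha => hν₁ a (ha.trans hmk))
      fun a ha => hν₂ a (ha.trans (by omega))
  · intro π
    have hs' : √(β : ℝ) ≠ 0 := (Real.sqrt_pos.2 (by exact_mod_cast hβ)).ne'
    have hw₁r : (w₁ : ℝ) ≠ 0 := by exact_mod_cast hw₁0.ne'
    have hw₂r : (w₂ : ℝ) ≠ 0 := by exact_mod_cast hw₂0.ne'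
    -- One of the `blk π q + 1` factors `β^(-1/2) * E ξ⁽¹⁾` cancels against `E D₂`, leaving `1 / E
    -- ξ⁽²⁾` for each block; the latter cancels against the factors `E ξ⁽²⁾` in the moments of `D₁`.
    have hq (q : Quotient π) : (natMoment D₂ 1).toReal⁻¹ * (fmom D₂ (blk π q + 1)).toReal =
        (w₂ : ℝ)⁻¹ * ((√β)⁻¹ * w₁) ^ blk π q * (weightMoment ν₂ (blk π q + 1)).toReal := by
      rw [hmean₂, hD₂, ENNReal.toReal_mul, ENNReal.toReal_pow, ENNReal.coe_toReal,
        ENNReal.coe_toReal, pow_succ]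
      push_cast
      field_simp
    simp_rw [hq]
    rw [Finset.prod_mul_distrib, Finset.prod_mul_distrib, Finset.prod_pow_eq_pow_sum, sum_blk,
      Finset.prod_const, Finset.card_univ, hD₁, ENNReal.toReal_mul, ENNReal.toReal_pow,
      ENNReal.coe_toReal, hw₁', ENNReal.coe_toReal]
    push_cast
    rw [mul_pow, mul_pow, inv_pow (w₂ : ℝ)]
    field_simp

end InhomogTendsto

/-! ### The configuration model -/

/-! ### Counting bijections with prescribed values -/

section Counting

variable {A B ι : Type*} [Fintype A] [Fintype B] [Fintype ι]

open Classical in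
/-- The bijections which map `f i` to `g i`, for all `i`. -/
def extensions (f : ι → A) (g : ι → B) : Finset (A ≃ B) :=
  Finset.univ.filter fun σ => ∀ i, σ (f i) = g i

theorem mem_extensions {f : ι → A} {g : ι → B} {σ : A ≃ B} :
    σ ∈ extensions f g ↔ ∀ i, σ (f i) = g i := by
  simp [extensions]

/-- Compose with a permutation of `B` that carries `g` to `g'`. -/
theorem card_extensions_le_of_injective (f : ι → A) {g g' : ι → B} (hg : Function.Injective g)
    (hg' : Function.Injective g') : (extensions f g).card ≤ (extensions f g').card := by
  classical
  obtain ⟨τ, hτ⟩ : ∃ τ : Equiv.Perm B, ∀ i, τ (g i) = g' i := by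
    refine ⟨((Equiv.ofInjective g hg).symm.trans (Equiv.ofInjective g' hg')).extendSubtype,
      fun i => ?_⟩
    rw [Equiv.extendSubtype_apply_of_mem _ _ (Set.mem_range_self i)]
    simp [Equiv.ofInjective_symm_apply hg]
  refine Finset.card_le_card_of_injOn (fun σ => σ.trans τ) (fun σ hσ => ?_) fun σ _ σ' _ h => ?_
  · have := mem_extensions.1 hσ
    exact mem_extensions.2 fun i => by simp [this, hτ]
  · ext a
    exact τ.injective (DFunLike.congr_fun h a)

/-- Every bijection induces exactly one injection along `f`, and all injections have equally many
extensions. -/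
theorem card_extensions_mul {f : ι → A} {g : ι → B} (hf : Function.Injective f)
    (hg : Function.Injective g) :
    (extensions f g).card * (Fintype.card B).descFactorial (Fintype.card ι) =
      Nat.card (A ≃ B) := by
  classical
  have h : ∀ g' : ι ↪ B, (extensions f g').card = (extensions f g).card := fun g' =>
    le_antisymm (card_extensions_le_of_injective f g'.injective hg)
      (card_extensions_le_of_injective f hg g'.injective)
  rw [Nat.card_eq_fintype_card, ← Finset.card_univ (α := A ≃ B), Finset.card_eq_sum_card_fiberwise
    (s := (Finset.univ : Finset (A ≃ B))) (f := fun σ : A ≃ B => (⟨f, hf⟩ : ι ↪ A).trans σ.toEmbedding) (t := Finset.univ)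
    fun _ _ => Finset.mem_coe.2 (Finset.mem_univ _)]
  trans ∑ _g' : ι ↪ B, (extensions f g).card
  · rw [Finset.sum_const, Finset.card_univ, Fintype.card_embedding_eq, smul_eq_mul, mul_comm]
  · refine Finset.sum_congr rfl fun g' _ => ?_
    rw [← h g']
    congr 1
    ext σ
    simp [mem_extensions, DFunLike.ext_iff]

theorem card_extensions_div {f : ι → A} {g : ι → B} (hf : Function.Injective f)
    (hg : Function.Injective g) [Nonempty (A ≃ B)] :
    ((extensions f g).card : ℝ) / Nat.card (A ≃ B) =
      (((Fintype.card B).descFactorial (Fintype.card ι) : ℝ))⁻¹ := by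
  have hpos : 0 < Nat.card (A ≃ B) := Nat.card_pos
  have h := card_extensions_mul hf hg
  have h₁ : ((extensions f g).card : ℝ) ≠ 0 := by
    intro h0
    rw [Nat.cast_eq_zero.1 h0, zero_mul] at h
    omega
  rw [← h]
  push_cast
  rw [div_mul_eq_div_div, div_self h₁, one_div]

theorem extensions_eq_empty {f : ι → A} {g : ι → B} (hf : Function.Injective f)
    (hg : ¬ Function.Injective g) : extensions f g = ∅ := by
  refine Finset.eq_empty_of_forall_notMem fun σ hσ => hg fun i j hij => hf (σ.injective ?_)
  rw [mem_extensions.1 hσ, mem_extensions.1 hσ, hij]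

theorem card_extensions_div_le {f : ι → A} (hf : Function.Injective f) (g : ι → B)
    [Nonempty (A ≃ B)] :
    ((extensions f g).card : ℝ) / Nat.card (A ≃ B) ≤
      (((Fintype.card B).descFactorial (Fintype.card ι) : ℝ))⁻¹ := by
  by_cases hg : Function.Injective g
  · exact (card_extensions_div hf hg).le
  · rw [extensions_eq_empty hf hg]
    simp

/-- A Bonferroni inequality: inserting a set loses at most its overlaps with the sets already
present. -/
theorem sum_card_le_card_biUnion {Ω C : Type*} [DecidableEq Ω] [DecidableEq C] (S : Finset C)
    (F : C → Finset Ω) {b : ℝ} (hb₀ : 0 ≤ b)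
    (hb : ∀ c c', c ≠ c' → ((F c ∩ F c').card : ℝ) ≤ b) :
    ∑ c ∈ S, ((F c).card : ℝ) ≤ ((S.biUnion F).card : ℝ) + (S.card : ℝ) ^ 2 * b := by
  induction S using Finset.induction_on with
  | empty => simp
  | insert a S ha ih =>
    rw [Finset.sum_insert ha, Finset.biUnion_insert, Finset.card_insert_of_notMem ha]
    have h₁ : (((F a ∪ S.biUnion F).card : ℝ)) + ((F a ∩ S.biUnion F).card : ℝ) =
        (F a).card + (S.biUnion F).card := by
      exact_mod_cast Finset.card_union_add_card_inter _ _
    have h₂ : ((F a ∩ S.biUnion F).card : ℝ) ≤ S.card * b := by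
      rw [Finset.inter_biUnion]
      calc (((S.biUnion fun c => F a ∩ F c).card : ℕ) : ℝ)
          ≤ ∑ c ∈ S, ((F a ∩ F c).card : ℝ) := by exact_mod_cast Finset.card_biUnion_le
        _ ≤ ∑ _c ∈ S, b := Finset.sum_le_sum fun c hc => hb _ _ fun h => ha (h ▸ hc)
        _ = S.card * b := by rw [Finset.sum_const, nsmul_eq_mul]
    push_cast
    have hS : (0 : ℝ) ≤ S.card := Nat.cast_nonneg _
    nlinarith [mul_nonneg hS hb₀]

end Counting

/-! ### Edge probabilities in a uniform matching -/

section Matchings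

variable {n₁ n₂ : ℕ} (d : DegSeqs n₁ n₂)

/-- The law of the multigraph given by a uniformly random matching of the half-edges. -/
def matchingLaw : Measure (BipGraph (Fin n₁) (Fin n₂)) :=
  ((PMF.uniformOfFintype (Matching d)).map (matchingGraph d)).toMeasure

instance : IsProbabilityMeasure (matchingLaw d) := by
  unfold matchingLaw
  infer_instance

open Classical in
theorem matchingLaw_real (s : Set (BipGraph (Fin n₁) (Fin n₂))) :
    (matchingLaw d).real s =
      ((Finset.univ.filter fun σ => matchingGraph d σ ∈ s).card : ℝ) / Nat.card (Matching d) := by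
  rw [Measure.real, matchingLaw, PMF.toMeasure_apply_eq_toOuterMeasure, PMF.toOuterMeasure_map_apply,
    PMF.toOuterMeasure_uniformOfFintype_apply, ENNReal.toReal_div, ENNReal.toReal_natCast,
    ENNReal.toReal_natCast, Nat.card_eq_fintype_card, Fintype.card_subtype]
  simp only [Set.mem_preimage]

/-- The choices of half-edges at the end vertices `L` such that no half-edge is chosen twice. -/
abbrev HalfEdgeChoice {ι : Type*} {n : ℕ} (s : Fin n → ℕ) (L : ι → Fin n) :=
  {G : (i : ι) → Fin (s (L i)) // Function.Injective fun i => (⟨L i, G i⟩ : (j : Fin n) × Fin (s j))}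

variable {ι : Type*} [Fintype ι] {L : ι → Fin n₁} {R : ι → Fin n₂}

/-- The matchings which join the chosen half-edges. -/
def choiceMatchings (p : HalfEdgeChoice d.1.1 L × HalfEdgeChoice d.1.2 R) :
    Finset (Matching d) :=
  extensions (fun i => ⟨L i, p.1.1 i⟩) fun i => ⟨R i, p.2.1 i⟩

/-- Distinct edges use distinct half-edges because a matching joins each half-edge only once.
Parallel edges may give several choices for the same matching, so this union is not disjoint. -/
theorem mem_incl_iff (h : Function.Injective fun i => (L i, R i)) (σ : Matching d) :
    matchingGraph d σ ∈ incl L R ↔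
      ∃ p : HalfEdgeChoice d.1.1 L × HalfEdgeChoice d.1.2 R, σ ∈ choiceMatchings d p := by
  constructor
  · intro hσ
    choose G hG using hσ
    have hG' (i : ι) : ∃ G' : Fin (d.1.2 (R i)), σ ⟨L i, G i⟩ = ⟨R i, G'⟩ :=
      ⟨hG i ▸ (σ ⟨L i, G i⟩).2, Sigma.ext (hG i) (by simp)⟩
    choose G' hG' using hG'
    have h₁ : Function.Injective fun i => (⟨L i, G i⟩ : (j : Fin n₁) × Fin (d.1.1 j)) := by
      intro i j hij
      refine h (Prod.ext (congrArg Sigma.fst hij) ?_)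
      have := congrArg σ hij
      simp only [hG'] at this
      exact congrArg Sigma.fst this
    have h₂ : Function.Injective fun i => (⟨R i, G' i⟩ : (j : Fin n₂) × Fin (d.1.2 j)) := by
      intro i j hij
      simp only [← hG'] at hij
      exact h₁ (σ.injective hij)
    exact ⟨(⟨G, h₁⟩, ⟨G', h₂⟩), mem_extensions.2 hG'⟩
  · rintro ⟨p, hp⟩ i
    exact ⟨p.1.1 i, by rw [mem_extensions.1 hp i]⟩

theorem card_halfEdges₂ : Fintype.card ((l : Fin n₂) × Fin (d.1.2 l)) = halfEdges d := by
  rw [halfEdges, d.2]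
  simp

open Classical in
theorem filter_incl (h : Function.Injective fun i => (L i, R i)) :
    (Finset.univ.filter fun σ => matchingGraph d σ ∈ incl L R) =
      (Finset.univ : Finset (HalfEdgeChoice d.1.1 L × HalfEdgeChoice d.1.2 R)).biUnion
        (choiceMatchings d) := by
  ext σ
  simp only [Finset.mem_filter_univ, mem_incl_iff d h, Finset.mem_biUnion, Finset.mem_univ,
    true_and]

theorem card_choiceMatchings_div (p : HalfEdgeChoice d.1.1 L × HalfEdgeChoice d.1.2 R) :
    ((choiceMatchings d p).card : ℝ) / Nat.card (Matching d) =
      ((halfEdges d).descFactorial (Fintype.card ι) : ℝ)⁻¹ := by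
  rw [← card_halfEdges₂ d]
  exact card_extensions_div p.1.2 p.2.2

open Classical in
theorem card_choice : (Fintype.card (HalfEdgeChoice d.1.1 L × HalfEdgeChoice d.1.2 R) : ℝ) =
    (∏ v, ((d.1.1 v).descFactorial (fib L v) : ℝ)) *
      ∏ w, ((d.1.2 w).descFactorial (fib R w) : ℝ) := by
  rw [Fintype.card_prod]
  have h₁ := card_lift L d.1.1
  have h₂ := card_lift R d.1.2
  rw [Fintype.card_eq_nat_card] at h₁ h₂
  rw [Fintype.card_eq_nat_card, Fintype.card_eq_nat_card, h₁, h₂]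
  push_cast
  rfl

/-- The union bound over choices of half-edges, all of which are realised with the same probability.
-/
theorem matchingLaw_incl_le (h : Function.Injective fun i => (L i, R i)) :
    (matchingLaw d).real (incl L R) ≤ ((halfEdges d).descFactorial (Fintype.card ι) : ℝ)⁻¹ *
      ((∏ v, ((d.1.1 v).descFactorial (fib L v) : ℝ)) *
        ∏ w, ((d.1.2 w).descFactorial (fib R w) : ℝ)) := by
  classical
  rw [matchingLaw_real, filter_incl d h, ← card_choice]
  calc _ ≤ (∑ p : HalfEdgeChoice d.1.1 L × HalfEdgeChoice d.1.2 R,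
        ((choiceMatchings d p).card : ℝ)) / Nat.card (Matching d) := by
        gcongr
        exact_mod_cast Finset.card_biUnion_le
    _ = _ := by
        rw [Finset.sum_div]
        simp_rw [card_choiceMatchings_div]
        rw [Finset.sum_const, Finset.card_univ, nsmul_eq_mul, mul_comm]

open Classical in
-- A matching that realises two different choices contains a parallel edge, hence at least one
-- prescribed pair of half-edges beyond those of the first choice.
theorem card_inter_choiceMatchings_le (h : Function.Injective fun i => (L i, R i))
    {p p' : HalfEdgeChoice d.1.1 L × HalfEdgeChoice d.1.2 R} (hp : p ≠ p') :
    ((choiceMatchings d p ∩ choiceMatchings d p').card : ℝ) ≤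
      Nat.card (Matching d) * ((halfEdges d).descFactorial (Fintype.card ι + 1) : ℝ)⁻¹ := by
  rcases (choiceMatchings d p ∩ choiceMatchings d p').eq_empty_or_nonempty with h0 | ⟨σ, hσ⟩
  · rw [h0, Finset.card_empty, Nat.cast_zero]
    positivity
  have h₁ := mem_extensions.1 (Finset.mem_inter.1 hσ).1
  have h₂ := mem_extensions.1 (Finset.mem_inter.1 hσ).2
  obtain ⟨i, hi⟩ : ∃ i, p.1.1 i ≠ p'.1.1 i := by
    by_contra! hall
    refine hp (Prod.ext (Subtype.ext (funext hall)) (Subtype.ext (funext fun i => ?_)))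
    have := h₁ i
    rw [hall i, h₂ i] at this
    exact (eq_of_heq (Sigma.ext_iff.1 this).2).symm
  let f : Option ι → (j : Fin n₁) × Fin (d.1.1 j) := fun o =>
    o.elim ⟨L i, p'.1.1 i⟩ fun j => ⟨L j, p.1.1 j⟩
  let g : Option ι → (l : Fin n₂) × Fin (d.1.2 l) := fun o =>
    o.elim ⟨R i, p'.2.1 i⟩ fun j => ⟨R j, p.2.1 j⟩
  -- The half-edge which `p'` uses at `i` is not used by `p`: equality with the one at `j` would
  -- give the same edge, so `j = i`, against `hi`.
  have hne (j : ι) : (⟨L i, p'.1.1 i⟩ : (j : Fin n₁) × Fin (d.1.1 j)) ≠ ⟨L j, p.1.1 j⟩ := by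
    intro hij
    have hR : R i = R j := by
      have := congrArg σ hij
      rw [h₁ j, h₂ i] at this
      exact congrArg Sigma.fst this
    obtain rfl : i = j := h (Prod.ext (congrArg Sigma.fst hij) hR)
    exact hi (eq_of_heq (Sigma.ext_iff.1 hij).2).symm
  have hf : Function.Injective f := by
    rintro (_ | j) (_ | j') hjj
    · rfl
    · exact absurd hjj (hne j')
    · exact absurd hjj.symm (hne j)
    · exact congrArg some (p.1.2 hjj)
  have hsub : choiceMatchings d p ∩ choiceMatchings d p' ⊆ extensions f g := by
    intro τ hτ
    have h₁ := mem_extensions.1 (Finset.mem_inter.1 hτ).1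
    have h₂ := mem_extensions.1 (Finset.mem_inter.1 hτ).2
    refine mem_extensions.2 ?_
    rintro (_ | j)
    · exact h₂ i
    · exact h₁ j
  have hle := card_extensions_div_le hf g
  rw [Fintype.card_option, card_halfEdges₂ d, div_le_iff₀ (by exact_mod_cast Nat.card_pos),
    mul_comm] at hle
  exact (Nat.cast_le.2 (Finset.card_le_card hsub)).trans hle

open Classical in
theorem card_choice_le {K : ℕ} (h₁ : ∀ i, d.1.1 (L i) ≤ K) (h₂ : ∀ i, d.1.2 (R i) ≤ K) :
    (Fintype.card (HalfEdgeChoice d.1.1 L × HalfEdgeChoice d.1.2 R) : ℝ) ≤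
      (K : ℝ) ^ (2 * Fintype.card ι) := by
  rw [Fintype.card_prod, two_mul, pow_add]
  push_cast
  have hb {n : ℕ} (s : Fin n → ℕ) (L : ι → Fin n) (hs : ∀ i, s (L i) ≤ K) :
      (Fintype.card (HalfEdgeChoice s L) : ℝ) ≤ (K : ℝ) ^ Fintype.card ι := by
    have : Fintype.card (HalfEdgeChoice s L) ≤ ∏ i, s (L i) := by
      refine (Fintype.card_subtype_le _).trans ?_
      simp
    refine (Nat.cast_le.2 (this.trans (Finset.prod_le_prod' fun i _ => hs i))).trans ?_
    simp
  exact mul_le_mul (hb _ _ h₁) (hb _ _ h₂) (by positivity) (by positivity)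

/-- Bonferroni over the choices: with degrees at most `K` there are at most `K ^ (2 * |ι|)` of them,
whence the square in the error term. -/
theorem le_matchingLaw_incl (h : Function.Injective fun i => (L i, R i)) {K : ℕ}
    (h₁ : ∀ i, d.1.1 (L i) ≤ K) (h₂ : ∀ i, d.1.2 (R i) ≤ K) :
    ((halfEdges d).descFactorial (Fintype.card ι) : ℝ)⁻¹ *
      ((∏ v, ((d.1.1 v).descFactorial (fib L v) : ℝ)) *
        ∏ w, ((d.1.2 w).descFactorial (fib R w) : ℝ)) -
      ((K : ℝ) ^ (2 * Fintype.card ι)) ^ 2 *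
        ((halfEdges d).descFactorial (Fintype.card ι + 1) : ℝ)⁻¹ ≤
      (matchingLaw d).real (incl L R) := by
  classical
  have hpos : (0 : ℝ) < Nat.card (Matching d) := by exact_mod_cast Nat.card_pos
  have hcard := card_choice_le d h₁ h₂
  rw [matchingLaw_real, filter_incl d h, ← card_choice, le_div_iff₀ hpos, sub_mul, sub_le_iff_le_add]
  have hsum := sum_card_le_card_biUnion
    (Finset.univ : Finset (HalfEdgeChoice d.1.1 L × HalfEdgeChoice d.1.2 R))
    (choiceMatchings d)
    (b := Nat.card (Matching d) * ((halfEdges d).descFactorial (Fintype.card ι + 1) : ℝ)⁻¹)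
    (by positivity) fun c c' hc => card_inter_choiceMatchings_le d h hc
  have heq : ∑ p : HalfEdgeChoice d.1.1 L × HalfEdgeChoice d.1.2 R,
      ((choiceMatchings d p).card : ℝ) =
      ((halfEdges d).descFactorial (Fintype.card ι) : ℝ)⁻¹ *
        (Fintype.card (HalfEdgeChoice d.1.1 L × HalfEdgeChoice d.1.2 R) : ℝ) *
        Nat.card (Matching d) := by
    have h' (p : HalfEdgeChoice d.1.1 L × HalfEdgeChoice d.1.2 R) :
        ((choiceMatchings d p).card : ℝ) =
        ((halfEdges d).descFactorial (Fintype.card ι) : ℝ)⁻¹ * Nat.card (Matching d) := by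
      rw [← card_choiceMatchings_div d p, div_mul_cancel₀ _ hpos.ne']
    simp_rw [h']
    rw [Finset.sum_const, Finset.card_univ, nsmul_eq_mul]
    ring
  rw [← heq]
  refine hsum.trans (add_le_add le_rfl ?_)
  rw [Finset.card_univ]
  calc _ ≤ ((K : ℝ) ^ (2 * Fintype.card ι)) ^ 2 * (Nat.card (Matching d) *
        ((halfEdges d).descFactorial (Fintype.card ι + 1) : ℝ)⁻¹) := by gcongr
    _ = _ := by ring

end Matchings

/-! ### Removal of edges at vertices of high degree -/

section CutMatching

variable {n₁ n₂ : ℕ} (d : DegSeqs n₁ n₂) (K : ℕ)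

/-- The law of the graph given by a random matching, with all edges removed that have an end vertex
of degree greater than `K`. -/
def cutMatchingLaw : Measure (BipGraph (Fin n₁) (Fin n₂)) :=
  (matchingLaw d).map fun H v w => H v w ∧ d.1.1 v ≤ K ∧ d.1.2 w ≤ K

instance : IsProbabilityMeasure (cutMatchingLaw d K) :=
  Measure.isProbabilityMeasure_map (measurable_of_countable _).aemeasurable

theorem integral_cutMatchingLaw_le (f : BipGraph (Fin n₁) (Fin n₂) → ℝ) (hf : Monotone f) :
    ∫ H, f H ∂(cutMatchingLaw d K) ≤ ∫ H, f H ∂(matchingLaw d) := by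
  rw [cutMatchingLaw, integral_map (measurable_of_countable _).aemeasurable
    (measurable_of_countable _).aestronglyMeasurable]
  exact integral_mono .of_finite .of_finite fun H => hf fun v w h => h.1

variable {ι : Type*} {L : ι → Fin n₁} {R : ι → Fin n₂}

/-- Edges are deleted after the matching and `d` is kept, so probabilities between vertices of low
degree do not change and no degree sums need rebalancing. -/
theorem cutMatchingLaw_incl (h₁ : ∀ i, d.1.1 (L i) ≤ K) (h₂ : ∀ i, d.1.2 (R i) ≤ K) :
    (cutMatchingLaw d K).real (incl L R) = (matchingLaw d).real (incl L R) := by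
  rw [cutMatchingLaw, map_measureReal_apply (measurable_of_countable _) .of_discrete]
  congr 1
  ext H
  simp [incl, h₁, h₂]

theorem cutMatchingLaw_incl_eq_zero (h : ∃ i, K < d.1.1 (L i) ∨ K < d.1.2 (R i)) :
    (cutMatchingLaw d K).real (incl L R) = 0 := by
  obtain ⟨i, hi⟩ := h
  rw [cutMatchingLaw, map_measureReal_apply (measurable_of_countable _) .of_discrete]
  have : (fun (H : BipGraph (Fin n₁) (Fin n₂)) v w => H v w ∧ d.1.1 v ≤ K ∧ d.1.2 w ≤ K) ⁻¹'
      incl L R = ∅ := by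
    refine Set.eq_empty_of_forall_notMem fun H hH => ?_
    have := hH i
    omega
  rw [this, measureReal_empty]

/-- Each edge has at most `K ^ 2` pairs of half-edges. The assumption `2 * |E| ≤ N` keeps every
factor of the falling factorial at least `N / 2`, which is the source of the `2`. -/
theorem edgesProb_cutMatchingLaw_le (E : Finset (Fin n₁ × Fin n₂))
    (hE : 2 * E.card ≤ halfEdges d) :
    edgesProb (cutMatchingLaw d K) E ≤ (2 * (K : ℝ) ^ 2 / halfEdges d) ^ E.card := by
  classical
  have hinj : Function.Injective fun e : E => (e.1.1, e.1.2) := fun e e' h => Subtype.ext h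
  rw [edgesProb_eq_incl]
  by_cases h : ∀ e : E, d.1.1 e.1.1 ≤ K ∧ d.1.2 e.1.2 ≤ K
  · rcases E.eq_empty_or_nonempty with rfl | hne
    · simp
    have hN : (0 : ℝ) < halfEdges d := by
      have := hne.card_pos
      exact_mod_cast (by omega : 0 < halfEdges d)
    rw [cutMatchingLaw_incl d K (fun e => (h e).1) fun e => (h e).2]
    refine (matchingLaw_incl_le d hinj).trans ?_
    rw [← card_choice]
    have hdesc : ((halfEdges d : ℝ) / 2) ^ E.card ≤ ((halfEdges d).descFactorial E.card : ℝ) := by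
      calc ((halfEdges d : ℝ) / 2) ^ E.card
          ≤ ((halfEdges d + 1 - E.card : ℕ) : ℝ) ^ E.card := by
            gcongr
            rw [div_le_iff₀ two_pos]
            exact_mod_cast (by omega : halfEdges d ≤ (halfEdges d + 1 - E.card) * 2)
        _ ≤ _ := by exact_mod_cast Nat.pow_sub_le_descFactorial _ _
    calc _ ≤ ((halfEdges d).descFactorial (Fintype.card E) : ℝ)⁻¹ *
          (K : ℝ) ^ (2 * Fintype.card E) := by
          gcongr
          exact card_choice_le d (fun e => (h e).1) fun e => (h e).2
      _ ≤ (((halfEdges d : ℝ) / 2) ^ E.card)⁻¹ * (K : ℝ) ^ (2 * E.card) := by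
          rw [Fintype.card_coe]
          gcongr
      _ = _ := by
          rw [pow_mul, ← inv_pow, ← mul_pow]
          congr 1
          field_simp
  · push Not at h
    rw [cutMatchingLaw_incl_eq_zero d K]
    · positivity
    · obtain ⟨e, he⟩ := h
      refine ⟨e, ?_⟩
      by_cases hv : d.1.1 e.1.1 ≤ K
      · exact Or.inr (he hv)
      · exact Or.inl (not_le.1 hv)

/-- The falling factorial, truncated at `K`. -/
def cutFac (a x : ℕ) : ℝ := if x ≤ K then (x.descFactorial a : ℝ) else 0

theorem cutFac_nonneg (a x : ℕ) : 0 ≤ cutFac K a x := by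
  unfold cutFac
  positivity

theorem cutFac_le {a m : ℕ} (ham : a ≤ m) (x : ℕ) : cutFac K a x ≤ ((K : ℝ) + 1) ^ m := by
  have hK : (0 : ℝ) ≤ K := K.cast_nonneg
  unfold cutFac
  split_ifs with h
  · calc (x.descFactorial a : ℝ) ≤ (x : ℝ) ^ a := by exact_mod_cast Nat.descFactorial_le_pow x a
      _ ≤ ((K : ℝ) + 1) ^ a := by
        gcongr
        have : (x : ℝ) ≤ K := by exact_mod_cast h
        linarith
      _ ≤ _ := pow_le_pow_right₀ (by linarith) ham
  · positivity

variable {m : ℕ}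

theorem matchingLaw_tree_le (π : Setoid (Fin m)) (x : Option (Fin m) ↪ Fin n₁)
    (e : Quotient π ↪ Fin n₂) :
    (matchingLaw d).real (incl (treeL π x) (treeR π e)) ≤
      ((halfEdges d).descFactorial (Fintype.card (Quotient π) + m) : ℝ)⁻¹ *
        (∏ o, rootWeight π (fun a v => ((d.1.1 v).descFactorial a : ℝ)) o (x o)) *
        ∏ q, midWeight π (fun a w => ((d.1.2 w).descFactorial a : ℝ)) q (e q) := by
  refine (matchingLaw_incl_le d (treeL_treeR_injective π x e)).trans (le_of_eq ?_)
  rw [prod_fib_treeL π x (fun v a => ((d.1.1 v).descFactorial a : ℝ)) fun _ => by simp,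
    prod_fib_treeR π e (fun w a => ((d.1.2 w).descFactorial a : ℝ)) fun _ => by simp,
    prod_rootWeight, Fintype.card_sum, Fintype.card_fin]
  simp only [midWeight]
  ring

/-- If a vertex of the tree has degree above `K`, the truncated product vanishes and the left-hand
side is not positive. -/
theorem le_cutMatchingLaw_tree (π : Setoid (Fin m)) (x : Option (Fin m) ↪ Fin n₁)
    (e : Quotient π ↪ Fin n₂) :
    ((halfEdges d).descFactorial (Fintype.card (Quotient π) + m) : ℝ)⁻¹ *
        (∏ o, rootWeight π (fun a v => cutFac K a (d.1.1 v)) o (x o)) *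
        (∏ q, midWeight π (fun a w => cutFac K a (d.1.2 w)) q (e q)) -
      ((K : ℝ) ^ (2 * (Fintype.card (Quotient π) + m))) ^ 2 *
        ((halfEdges d).descFactorial (Fintype.card (Quotient π) + m + 1) : ℝ)⁻¹ ≤
    (cutMatchingLaw d K).real (incl (treeL π x) (treeR π e)) := by
  have hδ : 0 ≤ ((K : ℝ) ^ (2 * (Fintype.card (Quotient π) + m))) ^ 2 *
      ((halfEdges d).descFactorial (Fintype.card (Quotient π) + m + 1) : ℝ)⁻¹ := by positivity
  by_cases h₁ : ∀ o, d.1.1 (x o) ≤ K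
  · by_cases h₂ : ∀ q, d.1.2 (e q) ≤ K
    · have hL (i) : d.1.1 (treeL π x i) ≤ K := by cases i <;> exact h₁ _
      have hR (i) : d.1.2 (treeR π e i) ≤ K := by cases i <;> exact h₂ _
      rw [cutMatchingLaw_incl d K hL hR]
      refine le_trans (le_of_eq ?_)
        (le_matchingLaw_incl d (treeL_treeR_injective π x e) hL hR)
      rw [prod_fib_treeL π x (fun v a => ((d.1.1 v).descFactorial a : ℝ)) fun _ => by simp,
        prod_fib_treeR π e (fun w a => ((d.1.2 w).descFactorial a : ℝ)) fun _ => by simp,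
        prod_rootWeight, Fintype.card_sum, Fintype.card_fin]
      simp only [midWeight, cutFac, h₁, h₂, if_true]
      ring
    · push Not at h₂
      obtain ⟨q, hq⟩ := h₂
      rw [Finset.prod_eq_zero (i := q) (Finset.mem_univ q) (by simp [midWeight, cutFac, hq]),
        mul_zero, zero_sub]
      exact (neg_nonpos.2 hδ).trans measureReal_nonneg
  · push Not at h₁
    obtain ⟨o, ho⟩ := h₁
    rw [Finset.prod_eq_zero (f := fun o => rootWeight π (fun a v => cutFac K a (d.1.1 v)) o (x o))
      (i := o) (Finset.mem_univ o) (by cases o <;> simp [rootWeight, cutFac, ho]),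
      mul_zero, zero_mul, zero_sub]
    exact (neg_nonpos.2 hδ).trans measureReal_nonneg

end CutMatching

/-! ### Empirical averages and normalising constants -/

section Averages

theorem exists_descFactorial_eq_sum_pow (a : ℕ) : ∃ c : ℕ → ℝ, ∀ x : ℕ,
    (x.descFactorial a : ℝ) = ∑ r ∈ Finset.range (a + 1), c r * (x : ℝ) ^ r := by
  refine ⟨(descPochhammer ℝ a).coeff, fun x => ?_⟩
  rw [← descPochhammer_eval_eq_descFactorial, Polynomial.eval_eq_sum_range,
    descPochhammer_natDegree]

theorem toReal_lintegral_natCast (D : Measure ℕ) (f : ℕ → ℕ) :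
    (∫⁻ x, (f x : ℝ≥0∞) ∂D).toReal = ∫ x, (f x : ℝ) ∂D := by
  rw [integral_eq_lintegral_of_nonneg_ae (.of_forall fun x => Nat.cast_nonneg _)
    (measurable_of_countable _).aestronglyMeasurable]
  simp

theorem integrable_natCast_pow {D : Measure ℕ} {r : ℕ} (h : natMoment D r < ⊤) :
    Integrable (fun x : ℕ => (x : ℝ) ^ r) D := by
  refine ⟨(measurable_of_countable _).aestronglyMeasurable, ?_⟩
  rw [hasFiniteIntegral_iff_ofReal (.of_forall fun x => by positivity)]
  convert h using 1
  refine lintegral_congr fun x => ?_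
  rw [ENNReal.ofReal_pow (Nat.cast_nonneg _), ENNReal.ofReal_natCast]

/-- Falling factorials are combinations of powers. The coefficients have signs, so the computation
is done with real integrals, which need finite moments. -/
theorem tendsto_avg_descFactorial {I : Type*} {l : Filter I} {N : I → ℕ} [∀ i, NeZero (N i)]
    {s : ∀ i, Fin (N i) → ℕ} {D : Measure ℕ} [IsProbabilityMeasure D] {a : ℕ}
    (hD : natMoment D a < ⊤)
    (h : ∀ r, 1 ≤ r → r ≤ a →
      Tendsto (fun i => empMoment (s i) r) l (𝓝 (natMoment D r).toReal)) :
    Tendsto (fun i => avg fun v => ((s i v).descFactorial a : ℝ)) l (𝓝 (fmom D a).toReal) := by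
  obtain ⟨c, hc⟩ := exists_descFactorial_eq_sum_pow a
  have hmom (r : ℕ) : (natMoment D r).toReal = ∫ x, (x : ℝ) ^ r ∂D := by
    have := toReal_lintegral_natCast D fun x => x ^ r
    push_cast at this
    exact this
  have hlim : (fmom D a).toReal =
      ∑ r ∈ Finset.range (a + 1), c r * (natMoment D r).toReal := by
    rw [fmom, toReal_lintegral_natCast D fun x => x.descFactorial a]
    simp_rw [hc, hmom]
    rw [integral_finsetSum _ fun r hr => (integrable_natCast_pow (natMoment_lt_top_of_le
      (Finset.mem_range_succ_iff.1 hr) hD)).const_mul _]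
    simp_rw [integral_const_mul]
  have havg (i : I) : (avg fun v => ((s i v).descFactorial a : ℝ)) =
      ∑ r ∈ Finset.range (a + 1), c r * empMoment (s i) r := by
    simp_rw [avg, hc, empMoment]
    rw [Finset.sum_comm, Finset.mul_sum, Fintype.card_fin]
    refine Finset.sum_congr rfl fun r _ => ?_
    rw [← Finset.mul_sum]
    ring
  simp_rw [havg, hlim]
  refine tendsto_finsetSum _ fun r hr => Tendsto.const_mul _ ?_
  rcases Nat.eq_zero_or_pos r with rfl | hr0
  · have h0 (i : I) : empMoment (s i) 0 = 1 := by
      have : (N i : ℝ) ≠ 0 := by simp [NeZero.ne]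
      simp [empMoment, this]
    simp_rw [h0, hmom]
    simpa using tendsto_const_nhds
  · exact h r hr0 (Finset.mem_range_succ_iff.1 hr)

theorem avg_cutFac {n : ℕ} (s : Fin n → ℕ) (K a : ℕ) :
    (avg fun v => cutFac K a (s v)) =
      ∑ x ∈ Finset.range (K + 1), (x.descFactorial a : ℝ) * ((countEq s x : ℝ) / n) := by
  have h (v : Fin n) : cutFac K a (s v) =
      ∑ x ∈ Finset.range (K + 1), if s v = x then (x.descFactorial a : ℝ) else 0 := by
    rw [Finset.sum_ite_eq]
    simp only [Finset.mem_range_succ_iff, cutFac]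
  simp_rw [avg, h]
  rw [Finset.sum_comm, Finset.mul_sum, Fintype.card_fin]
  refine Finset.sum_congr rfl fun x _ => ?_
  rw [← Finset.sum_filter, Finset.sum_const, nsmul_eq_mul, countEq]
  ring

/-- Only the finitely many values up to `K` enter, and the value `0` contributes nothing when `a ≥
1`, so frequencies of positive degrees suffice. -/
theorem tendsto_avg_cutFac {I : Type*} {l : Filter I} {N : I → ℕ}
    {s : ∀ i, Fin (N i) → ℕ} {D : Measure ℕ} {a : ℕ} (ha : 1 ≤ a)
    (h : ∀ x, 1 ≤ x → Tendsto (fun i => (countEq (s i) x : ℝ) / N i) l (𝓝 (D.real {x})))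
    (K : ℕ) : Tendsto (fun i => avg fun v => cutFac K a (s i v)) l (𝓝 (cutMom D K a)) := by
  simp_rw [avg_cutFac]
  refine tendsto_finsetSum _ fun x _ => ?_
  rcases Nat.eq_zero_or_pos x with rfl | hx
  · have : (0 : ℕ).descFactorial a = 0 := Nat.descFactorial_eq_zero_iff_lt.2 (by omega)
    simp only [this, Nat.cast_zero, zero_mul, tendsto_const_nhds]
  · exact (h x hx).const_mul _

variable {I : Type*} {l : Filter I} {N N₁ N₂ : I → ℕ} {e₁ e₂ : ℝ}

theorem tendsto_atTop_of_div (hN₁ : Tendsto N₁ l atTop) (he : 0 < e₁)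
    (h : Tendsto (fun i => (N i : ℝ) / N₁ i) l (𝓝 e₁)) : Tendsto N l atTop := by
  rw [← tendsto_natCast_atTop_iff (R := ℝ)]
  refine (h.pos_mul_atTop he (tendsto_natCast_atTop_atTop.comp hN₁)).congr' ?_
  filter_upwards [hN₁.eventually_ge_atTop 1] with i hi
  have : (N₁ i : ℝ) ≠ 0 := by exact_mod_cast (by omega : N₁ i ≠ 0)
  simp only [Function.comp_apply]
  field_simp

theorem tendsto_treeProb (hN₁ : Tendsto N₁ l atTop) (he₁ : 0 < e₁) (he₂ : 0 < e₂)
    (h₁ : Tendsto (fun i => (N i : ℝ) / N₁ i) l (𝓝 e₁))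
    (h₂ : Tendsto (fun i => (N i : ℝ) / N₂ i) l (𝓝 e₂)) (j m : ℕ) :
    Tendsto (fun i => ((N i).descFactorial (j + m) : ℝ)⁻¹ * (N₁ i : ℝ) ^ m * (N₂ i : ℝ) ^ j) l
      (𝓝 (e₁⁻¹ ^ m * e₂⁻¹ ^ j)) := by
  have hN := tendsto_atTop_of_div hN₁ he₁ h₁
  have := (tendsto_pow_div_descFactorial hN (j + m)).mul
    (((h₁.inv₀ he₁.ne').pow m).mul ((h₂.inv₀ he₂.ne').pow j))
  rw [one_mul] at this
  refine this.congr' ?_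
  filter_upwards [hN.eventually_ge_atTop 1] with i hi
  have : (N i : ℝ) ≠ 0 := by exact_mod_cast (by omega : N i ≠ 0)
  rw [inv_div, inv_div, div_pow, div_pow, pow_add]
  field_simp

/-- The extra pair of half-edges costs a factor of order `1 / N`: this is the previous limit with `m
+ 1` leaves, divided by `N₁`. -/
theorem tendsto_treeProb_succ (hN₁ : Tendsto N₁ l atTop) (he₁ : 0 < e₁) (he₂ : 0 < e₂)
    (h₁ : Tendsto (fun i => (N i : ℝ) / N₁ i) l (𝓝 e₁))
    (h₂ : Tendsto (fun i => (N i : ℝ) / N₂ i) l (𝓝 e₂)) (b : ℝ) (j m : ℕ) :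
    Tendsto (fun i => b * ((N i).descFactorial (j + m + 1) : ℝ)⁻¹ * (N₁ i : ℝ) ^ m *
      (N₂ i : ℝ) ^ j) l (𝓝 0) := by
  have h := (tendsto_treeProb (m := m + 1) hN₁ he₁ he₂ h₁ h₂ j).mul
    ((tendsto_natCast_atTop_atTop (R := ℝ)).comp hN₁).inv_tendsto_atTop
  have := h.const_mul b
  rw [mul_zero, mul_zero] at this
  refine this.congr' ?_
  filter_upwards [hN₁.eventually_ge_atTop 1] with i hi
  have : (N₁ i : ℝ) ≠ 0 := by exact_mod_cast (by omega : N₁ i ≠ 0)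
  simp only [Pi.inv_apply, Function.comp_apply, ← add_assoc]
  rw [pow_succ]
  field_simp

end Averages

/-! ### Convergence along events with small complements -/

section ProbFilter

variable {Ω : ℕ → Type*} [∀ n, MeasurableSpace (Ω n)] (P : ∀ n, Measure (Ω n)) (r : ℕ → ℝ≥0∞)

/-- The filter of the events whose complements have probabilities `o(1 / r n)`. -/
def probFilter : Filter ((n : ℕ) × Ω n) where
  sets := {S | Tendsto (fun n => r n * P n {ω | ⟨n, ω⟩ ∉ S}) atTop (𝓝 0)}
  univ_sets := by simp
  sets_of_superset {S T} hS hST := by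
    refine tendsto_of_tendsto_of_tendsto_of_le_of_le tendsto_const_nhds hS
      (fun n => zero_le) fun n => ?_
    dsimp only
    gcongr
  inter_sets {S T} hS hT := by
    have hST := Tendsto.add hS hT
    rw [add_zero] at hST
    refine tendsto_of_tendsto_of_tendsto_of_le_of_le tendsto_const_nhds hST
      (fun n => zero_le) fun n => ?_
    dsimp only
    rw [← mul_add]
    gcongr
    refine le_trans (measure_mono fun ω hω => ?_) (measure_union_le _ _)
    by_contra h
    simp only [Set.mem_union, Set.mem_ofPred_eq, not_or, not_not] at h
    exact hω h

variable {P r}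

theorem eventually_probFilter {Q : (n : ℕ) × Ω n → Prop} :
    (∀ᶠ p in probFilter P r, Q p) ↔
      Tendsto (fun n => r n * P n {ω | ¬ Q ⟨n, ω⟩}) atTop (𝓝 0) :=
  Iff.rfl

theorem tendsto_fst_probFilter : Tendsto Sigma.fst (probFilter P r) atTop := by
  refine tendsto_atTop.2 fun a => eventually_probFilter.2 ?_
  refine tendsto_const_nhds.congr' ?_
  filter_upwards [eventually_ge_atTop a] with n hn
  simp [hn]

/-- For `r = 1`, convergence in probability is convergence along a filter, so deterministic limit
theorems apply directly to random degree sequences. -/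
theorem TendstoInProb.tendsto_probFilter {Y : ∀ n, Ω n → ℝ} {c : ℝ} (h : TendstoInProb P Y c) :
    Tendsto (fun p : (n : ℕ) × Ω n => Y p.1 p.2) (probFilter P fun _ => 1) (𝓝 c) := by
  refine Metric.tendsto_nhds.2 fun ε hε => eventually_probFilter.2 ?_
  simp_rw [one_mul]
  -- Half of `ε` absorbs the change from strict to weak inequality.
  refine tendsto_of_tendsto_of_tendsto_of_le_of_le tendsto_const_nhds (h (ε / 2) (by positivity))
    (fun n => zero_le) fun n => measure_mono fun ω hω => ?_
  simp only [Set.mem_ofPred_eq, not_lt, Real.dist_eq] at hω ⊢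
  linarith

theorem tendsto_probFilter_of_isLittleO [∀ n, IsProbabilityMeasure (P n)] {u : ℕ → ℕ}
    [∀ n, NeZero (u n)] {k : ℕ} {Y : ∀ n, Ω n → ℝ} {c : ℝ} {f : ℕ → ℝ}
    (hf : Tendsto f atTop (𝓝 0))
    (h : (fun n => (P n).real {ω | f n < |c - Y n ω|}) =o[atTop]
      fun n => ((u n : ℝ) ^ k)⁻¹) :
    Tendsto (fun p : (n : ℕ) × Ω n => Y p.1 p.2)
      (probFilter P fun n => (u n : ℝ≥0∞) ^ k) (𝓝 c) := by
  have hle : ∀ᶠ p in probFilter P fun n => (u n : ℝ≥0∞) ^ k, |c - Y p.1 p.2| ≤ f p.1 := by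
    refine eventually_probFilter.2 ?_
    have h' := ENNReal.tendsto_ofReal h.tendsto_div_nhds_zero
    rw [ENNReal.ofReal_zero] at h'
    refine h'.congr fun n => ?_
    rw [div_inv_eq_mul, ENNReal.ofReal_mul measureReal_nonneg, ofReal_measureReal,
      ENNReal.ofReal_pow (Nat.cast_nonneg _), ENNReal.ofReal_natCast, mul_comm]
    simp only [not_le]
  rw [tendsto_iff_dist_tendsto_zero]
  refine squeeze_zero' (.of_forall fun _ => dist_nonneg) ?_
    (hf.comp tendsto_fst_probFilter)
  filter_upwards [hle] with p hp
  rwa [dist_comm, Real.dist_eq]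

/-- Off the exceptional event `Z ≤ a`; on it `Z ≤ r n`, and `r n` times its probability tends to
`0`. The gap between `a` and `b` absorbs this. -/
theorem eventually_lintegral_le [∀ n, IsProbabilityMeasure (P n)]
    [∀ n, DiscreteMeasurableSpace (Ω n)] {Z : ∀ n, Ω n → ℝ} {a b : ℝ} (hb : 0 < b) (hab : a < b)
    (hZ : ∀ n ω, ENNReal.ofReal (Z n ω) ≤ r n)
    (h : ∀ᶠ p in probFilter P r, Z p.1 p.2 ≤ a) :
    ∀ᶠ n in atTop, ∫⁻ ω, ENNReal.ofReal (Z n ω) ∂(P n) ≤ ENNReal.ofReal b := by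
  have hlim := (eventually_probFilter.1 h).const_add (ENNReal.ofReal a)
  rw [add_zero] at hlim
  filter_upwards [hlim.eventually_lt_const (ENNReal.ofReal_lt_ofReal_iff hb |>.2 hab)] with n hn
  refine le_trans ?_ hn.le
  calc ∫⁻ ω, ENNReal.ofReal (Z n ω) ∂(P n)
      ≤ ∫⁻ ω, (ENNReal.ofReal a + {ω | ¬ Z n ω ≤ a}.indicator (fun _ => r n) ω) ∂(P n) := by
        refine lintegral_mono fun ω => ?_
        by_cases hω : Z n ω ≤ a
        · exact (ENNReal.ofReal_le_ofReal hω).trans le_self_add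
        · rw [Set.indicator_of_mem (by exact hω)]
          exact (hZ n ω).trans le_add_self
    _ = _ := by
        rw [lintegral_add_left measurable_const, lintegral_const, measure_univ, mul_one,
          lintegral_indicator_const .of_discrete]

/-- By Markov's inequality the integral is at least `b` times the probability of `b ≤ Z`, which
tends to `1`. -/
theorem eventually_le_lintegral [∀ n, IsProbabilityMeasure (P n)]
    [∀ n, DiscreteMeasurableSpace (Ω n)] {Z : ∀ n, Ω n → ℝ} {a b : ℝ} (hb : 0 < b) (hab : a < b)
    (h : ∀ᶠ p in probFilter P fun _ => 1, b ≤ Z p.1 p.2) :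
    ∀ᶠ n in atTop, ENNReal.ofReal a ≤ ∫⁻ ω, ENNReal.ofReal (Z n ω) ∂(P n) := by
  have hlim := ENNReal.Tendsto.sub (tendsto_const_nhds (x := (1 : ℝ≥0∞)))
    (eventually_probFilter.1 h) (Or.inl ENNReal.one_ne_top)
  have hlim' := ENNReal.Tendsto.const_mul (a := ENNReal.ofReal b) hlim
    (Or.inr ENNReal.ofReal_ne_top)
  rw [tsub_zero, mul_one] at hlim'
  filter_upwards [hlim'.eventually_const_lt (ENNReal.ofReal_lt_ofReal_iff hb |>.2 hab)] with n hn
  refine hn.le.trans ?_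
  calc _ ≤ ENNReal.ofReal b * P n {ω | b ≤ Z n ω} := by
        gcongr
        rw [one_mul, tsub_le_iff_right, ← measure_univ (μ := P n)]
        refine le_trans (measure_mono fun ω _ => ?_) (measure_union_le _ _)
        exact em (b ≤ Z n ω)
    _ = ∫⁻ ω, {ω | b ≤ Z n ω}.indicator (fun _ => ENNReal.ofReal b) ω ∂(P n) := by
        rw [lintegral_indicator_const .of_discrete]
    _ ≤ _ := by
        refine lintegral_mono fun ω => ?_
        by_cases hω : b ≤ Z n ω
        · rw [Set.indicator_of_mem (by exact hω)]
          exact ENNReal.ofReal_le_ofReal hω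
        · rw [Set.indicator_of_notMem (by exact hω)]
          exact zero_le

end ProbFilter

/-! ### Conditioning on the degree sequences -/

section ConfLaw

variable {n₁ n₂ : ℕ}

instance (L : PMF (DegSeqs n₁ n₂)) : IsProbabilityMeasure (confLaw L) := by
  unfold confLaw
  infer_instance

theorem confLaw_eq_bind (L : PMF (DegSeqs n₁ n₂)) : confLaw L = L.toMeasure.bind matchingLaw := by
  ext s hs
  rw [confLaw, PMF.toMeasure_bind_apply _ _ _ hs, Measure.bind_apply hs
    (measurable_of_countable _).aemeasurable, lintegral_countable']
  refine tsum_congr fun d => ?_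
  rw [PMF.toMeasure_apply_singleton _ _ (measurableSet_singleton d), mul_comm]
  rfl

theorem ofReal_facMom_confLaw [NeZero n₁] (L : PMF (DegSeqs n₁ n₂)) (m : ℕ) :
    ENNReal.ofReal (facMom (confLaw L) m) =
      ∫⁻ d, ENNReal.ofReal (facMom (matchingLaw d) m) ∂L.toMeasure := by
  simp_rw [ofReal_facMom]
  rw [lintegral_const_mul _ (measurable_of_countable _), confLaw_eq_bind, Measure.lintegral_bind
    (measurable_of_countable _).aemeasurable (measurable_of_countable _).aemeasurable]

/-- The trivial bound by the number of vertices, used on the exceptional event. -/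
theorem ofReal_facMom_le [NeZero n₁] (μ : Measure (BipGraph (Fin n₁) (Fin n₂)))
    [IsProbabilityMeasure μ] (m : ℕ) : ENNReal.ofReal (facMom μ m) ≤ (n₁ : ℝ≥0∞) ^ m := by
  have hn : (n₁ : ℝ≥0∞) ≠ 0 := by simp [NeZero.ne]
  rw [ofReal_facMom]
  calc _ ≤ (n₁ : ℝ≥0∞)⁻¹ * ∫⁻ _H, (n₁ : ℝ≥0∞) * (n₁ : ℝ≥0∞) ^ m ∂μ := by
        gcongr with H
        calc _ ≤ ∑ _u : Fin n₁, (n₁ : ℝ≥0∞) ^ m := by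
              refine Finset.sum_le_sum fun u _ => ?_
              have h₁ := natDeg_le_card H u
              rw [Fintype.card_fin] at h₁
              exact_mod_cast (Nat.descFactorial_le_pow _ m).trans (Nat.pow_le_pow_left h₁ m)
          _ = _ := by simp
    _ = _ := by
        rw [lintegral_const, measure_univ, mul_one, ← mul_assoc,
          ENNReal.inv_mul_cancel hn (ENNReal.natCast_ne_top _), one_mul]

theorem empMoment_one₁ (d : DegSeqs n₁ n₂) : empMoment d.1.1 1 = (halfEdges d : ℝ) / n₁ := by
  simp [empMoment, halfEdges]

theorem empMoment_one₂ (d : DegSeqs n₁ n₂) : empMoment d.1.2 1 = (halfEdges d : ℝ) / n₂ := by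
  rw [halfEdges, d.2]
  simp [empMoment]

end ConfLaw

/-! ### The limit in the configuration model -/

section ConfTendsto

variable {n₁ n₂ : ℕ → ℕ} [∀ n, NeZero (n₁ n)] [∀ n, NeZero (n₂ n)]
  {D₁ D₂ : Measure ℕ}
  {l : Filter ((n : ℕ) × DegSeqs (n₁ n) (n₂ n))} {m : ℕ} {e₁ e₂ : ℝ}

theorem eventually_le_facMom_matchingLaw (hm : 1 ≤ m) (hl : Tendsto Sigma.fst l atTop)
    (hn₁ : Tendsto n₁ atTop atTop) (hn₂ : Tendsto n₂ atTop atTop) (he₁ : 0 < e₁) (he₂ : 0 < e₂)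
    (h₁ : Tendsto (fun p => (halfEdges p.2 : ℝ) / n₁ p.1) l (𝓝 e₁))
    (h₂ : Tendsto (fun p => (halfEdges p.2 : ℝ) / n₂ p.1) l (𝓝 e₂))
    (hf₁ : ∀ j, 1 ≤ j →
      Tendsto (fun p => (countEq p.2.1.1 j : ℝ) / n₁ p.1) l (𝓝 (D₁.real {j})))
    (hf₂ : ∀ j, 1 ≤ j →
      Tendsto (fun p => (countEq p.2.1.2 j : ℝ) / n₂ p.1) l (𝓝 (D₂.real {j})))
    {K : ℕ} {b : ℝ} (hb : b < treeSum m (fun π => e₁⁻¹ ^ m * e₂⁻¹ ^ Fintype.card (Quotient π))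
      (fun a => cutMom D₁ K a) (fun a => cutMom D₂ K a)) :
    ∀ᶠ p in l, b ≤ facMom (matchingLaw p.2) m := by
  have hN := tendsto_atTop_of_div (hn₁.comp hl) he₁ h₁
  refine eventually_le_facMom (N₁ := fun p : (n : ℕ) × DegSeqs (n₁ n) (n₂ n) => n₁ p.1)
    (N₂ := fun p => n₂ p.1) hm (hn₁.comp hl) (hn₂.comp hl) (fun p => matchingLaw p.2)
    (fun p => cutMatchingLaw p.2 K) (fun p f hf _ => integral_cutMatchingLaw_le p.2 K f hf)
    (y := fun p => 2 * (K : ℝ) ^ 2 / halfEdges p.2) (fun p => by positivity)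
    (C := max (2 * (K : ℝ) ^ 2 * e₁⁻¹ + 1) (2 * (K : ℝ) ^ 2 * e₂⁻¹ + 1)) ?_ ?_ ?_
    (c := fun p π => ((halfEdges p.2).descFactorial (Fintype.card (Quotient π) + m) : ℝ)⁻¹)
    (δ := fun p π => ((K : ℝ) ^ (2 * (Fintype.card (Quotient π) + m))) ^ 2 *
        ((halfEdges p.2).descFactorial (Fintype.card (Quotient π) + m + 1) : ℝ)⁻¹)
    (φ₁ := fun p a v => cutFac K a (p.2.1.1 v)) (fun _ _ _ => cutFac_nonneg _ _ _)
    (φ₂ := fun p a w => cutFac K a (p.2.1.2 w)) (fun _ _ _ => cutFac_nonneg _ _ _)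
    (M := ((K : ℝ) + 1) ^ (m + 1)) (by positivity)
    (.of_forall fun p a _ ha v => cutFac_le K (by omega) _)
    (.of_forall fun p a _ ha v => cutFac_le K ha _)
    (.of_forall fun p π x e => le_cutMatchingLaw_tree p.2 K π x e)
    (fun π => tendsto_treeProb (hn₁.comp hl) he₁ he₂ h₁ h₂ _ _) (fun p π => by positivity)
    (fun π => tendsto_treeProb_succ (hn₁.comp hl) he₁ he₂ h₁ h₂ _ _ _)
    (fun a ha _ => tendsto_avg_cutFac ha hf₁ K) (fun a ha _ => tendsto_avg_cutFac ha hf₂ K) hb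
  · filter_upwards [((h₁.inv₀ he₁.ne').const_mul (2 * (K : ℝ) ^ 2)).eventually_le_const
      (lt_add_one _)] with p hp
    refine le_trans (le_of_eq ?_) (hp.trans (le_max_left _ _))
    rw [inv_div]
    ring
  · filter_upwards [((h₂.inv₀ he₂.ne').const_mul (2 * (K : ℝ) ^ 2)).eventually_le_const
      (lt_add_one _)] with p hp
    refine le_trans (le_of_eq ?_) (hp.trans (le_max_right _ _))
    rw [inv_div]
    ring
  -- The edge sets in question have at most `2 * m + 2` elements, and the edge bound needs twice as
  -- many half-edges.
  · filter_upwards [hN.eventually_ge_atTop (2 * (2 * m + 2))] with p hp E hE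
    exact edgesProb_cutMatchingLaw_le p.2 K E (by omega)

variable [IsProbabilityMeasure D₁] [IsProbabilityMeasure D₂]

theorem eventually_facMom_matchingLaw_le (hm : 1 ≤ m) (hl : Tendsto Sigma.fst l atTop)
    (hn₁ : Tendsto n₁ atTop atTop) (he₁ : 0 < e₁) (he₂ : 0 < e₂)
    (h₁ : Tendsto (fun p => (halfEdges p.2 : ℝ) / n₁ p.1) l (𝓝 e₁))
    (h₂ : Tendsto (fun p => (halfEdges p.2 : ℝ) / n₂ p.1) l (𝓝 e₂))
    (hD₁ : natMoment D₁ m < ⊤) (hD₂ : natMoment D₂ (m + 1) < ⊤)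
    (hemp₁ : ∀ r, 1 ≤ r → r ≤ m →
      Tendsto (fun p => empMoment p.2.1.1 r) l (𝓝 (natMoment D₁ r).toReal))
    (hemp₂ : ∀ r, 1 ≤ r → r ≤ m + 1 →
      Tendsto (fun p => empMoment p.2.1.2 r) l (𝓝 (natMoment D₂ r).toReal))
    {b : ℝ} (hb : treeSum m (fun π => e₁⁻¹ ^ m * e₂⁻¹ ^ Fintype.card (Quotient π))
      (fun a => (fmom D₁ a).toReal) (fun a => (fmom D₂ a).toReal) < b) :
    ∀ᶠ p in l, facMom (matchingLaw p.2) m ≤ b := by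
  refine eventually_facMom_le (N₁ := fun p : (n : ℕ) × DegSeqs (n₁ n) (n₂ n) => n₁ p.1)
    (N₂ := fun p => n₂ p.1) hm (fun p => matchingLaw p.2)
    (c := fun p π => ((halfEdges p.2).descFactorial (Fintype.card (Quotient π) + m) : ℝ)⁻¹)
    (fun p π => by positivity)
    (φ₁ := fun p a v => ((p.2.1.1 v).descFactorial a : ℝ)) (fun _ _ _ => Nat.cast_nonneg _)
    (φ₂ := fun p a w => ((p.2.1.2 w).descFactorial a : ℝ)) (fun _ _ _ => Nat.cast_nonneg _)
    (.of_forall fun p π x e => matchingLaw_tree_le p.2 π x e)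
    (fun π => tendsto_treeProb (hn₁.comp hl) he₁ he₂ h₁ h₂ _ _) ?_ ?_ hb
  · exact fun a _ ha => tendsto_avg_descFactorial (natMoment_lt_top_of_le ha hD₁)
      fun r hr hra => hemp₁ r hr (hra.trans ha)
  · exact fun a _ ha => tendsto_avg_descFactorial (natMoment_lt_top_of_le ha hD₂)
      fun r hr hra => hemp₂ r hr (hra.trans ha)

variable {k : ℕ} {μ : ∀ n, Measure (BipGraph (Fin (n₁ n)) (Fin (n₂ n)))}
  [∀ n, IsProbabilityMeasure (μ n)]

theorem ConfCase.tendsto {L : ∀ n, PMF (DegSeqs (n₁ n) (n₂ n))}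
    (h : ConfCase k n₁ n₂ μ D₁ D₂ L) (hk : 1 ≤ k)
    (hn₁ : Tendsto n₁ atTop atTop) (hn₂ : Tendsto n₂ atTop atTop) :
    limitDegreeMoment D₁ D₂ k < ⊤ ∧
      Tendsto (fun n => degreeMoment (μ n) k) atTop (𝓝 (limitDegreeMoment D₁ D₂ k)) := by
  obtain rfl : μ = fun n => confLaw (L n) := funext h.model
  refine tendsto_degreeMoment h.mean_pos₁ h.mean_pos₂ hk h.moment_lt_top₁ h.moment_lt_top₂
    fun m hm hmk => ?_
  set e₁ := (natMoment D₁ 1).toReal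
  set e₂ := (natMoment D₂ 1).toReal
  have he₁ : 0 < e₁ := ENNReal.toReal_pos h.mean_pos₁.ne' h.mean_lt_top₁.ne
  have he₂ : 0 < e₂ := ENNReal.toReal_pos h.mean_pos₂.ne' h.mean_lt_top₂.ne
  have hσ : (limFac D₁ D₂ m).toReal = treeSum m
      (fun π => e₁⁻¹ ^ m * e₂⁻¹ ^ Fintype.card (Quotient π))
      (fun a => (fmom D₁ a).toReal) (fun a => (fmom D₂ a).toReal) := by
    refine toReal_limFac (limFac_lt_top h.mean_pos₂ hmk h.moment_lt_top₁ h.moment_lt_top₂)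
      fun π => ?_
    rw [Finset.prod_mul_distrib, Finset.prod_const, Finset.card_univ, fmom_one]
    change _ * (_ * e₁ ^ m) * _ = _ * (e₂⁻¹ ^ _ * _)
    rw [inv_pow]
    field_simp
  have hσ₀ : 0 ≤ (limFac D₁ D₂ m).toReal := ENNReal.toReal_nonneg
  obtain ⟨f, hf, hc₁, hc₂⟩ := h.concentration
  have hemp₁ (r : ℕ) (hr : 1 ≤ r) (hrk : r ≤ k) :=
    tendsto_probFilter_of_isLittleO hf (hc₁ r (Finset.mem_Icc.2 ⟨hr, hrk⟩))
  have hemp₂ (r : ℕ) (hr : 1 ≤ r) (hrk : r ≤ k + 1) :=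
    tendsto_probFilter_of_isLittleO hf (hc₂ r (Finset.mem_Icc.2 ⟨hr, hrk⟩))
  refine tendsto_of_eventually_le (s := fun K => treeSum m
    (fun π => e₁⁻¹ ^ m * e₂⁻¹ ^ Fintype.card (Quotient π))
    (fun a => cutMom D₁ K a) fun a => cutMom D₂ K a) ?_ (fun b hb => ?_) (fun K b hb => ?_)
  · rw [hσ]
    exact tendsto_treeSum hm (fun a _ ha => tendsto_cutMom_atTop
      (fmom_lt_top (ha.trans hmk) h.moment_lt_top₁).ne) fun a _ ha => tendsto_cutMom_atTop
      (fmom_lt_top (ha.trans (by omega)) h.moment_lt_top₂).ne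
  · obtain ⟨a, hσa, hab⟩ := exists_between hb
    have hb₀ : 0 < b := hσ₀.trans_lt hb
    -- The fine filter: exceptional events have probability `o(n₁ ^ (-2k))`, and the factorial
    -- moment is at most `n₁ ^ m` with `m ≤ 2 * k`.
    have hev := eventually_facMom_matchingLaw_le (D₁ := D₁) (D₂ := D₂) hm
      (l := probFilter (fun n => (L n).toMeasure) fun n => (n₁ n : ℝ≥0∞) ^ (2 * k))
      tendsto_fst_probFilter hn₁ he₁ he₂
      ((hemp₁ 1 le_rfl hk).congr fun p => empMoment_one₁ p.2)
      ((hemp₂ 1 le_rfl (by omega)).congr fun p => empMoment_one₂ p.2)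
      (natMoment_lt_top_of_le hmk h.moment_lt_top₁)
      (natMoment_lt_top_of_le (by omega) h.moment_lt_top₂)
      (fun r hr hrm => hemp₁ r hr (hrm.trans hmk))
      (fun r hr hrm => hemp₂ r hr (hrm.trans (by omega))) (hσ ▸ hσa)
    filter_upwards [eventually_lintegral_le (Z := fun n d => facMom (matchingLaw d) m) hb₀ hab
      (fun n d => (ofReal_facMom_le _ m).trans
        (pow_le_pow_right₀ (by exact_mod_cast NeZero.one_le) (by omega))) hev] with n hn
    rwa [← ofReal_facMom_confLaw, ENNReal.ofReal_le_ofReal_iff hb₀.le] at hn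
  -- Negative bounds are trivial and are separated because `ENNReal.ofReal` would lose them.
  · rcases le_or_gt b 0 with hb₀ | hb₀
    · exact .of_forall fun n => hb₀.trans (facMom_nonneg _ _)
    obtain ⟨a, hba, ha⟩ := exists_between hb
    -- The coarse filter suffices here: exceptional events can only be discarded from a non-negative
    -- integral.
    have hev := eventually_le_facMom_matchingLaw (D₁ := D₁) (D₂ := D₂) hm
      (l := probFilter (fun n => (L n).toMeasure) fun _ => 1)
      tendsto_fst_probFilter hn₁ hn₂ he₁ he₂ h.tendsto_mean₁.tendsto_probFilter
      h.tendsto_mean₂.tendsto_probFilter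
      (fun j hj => (h.tendsto_freq₁ j hj).tendsto_probFilter)
      (fun j hj => (h.tendsto_freq₂ j hj).tendsto_probFilter) ha
    filter_upwards [eventually_le_lintegral (Z := fun n d => facMom (matchingLaw d) m)
      (hb₀.trans hba) hba hev] with n hn
    rwa [← ofReal_facMom_confLaw, ENNReal.ofReal_le_ofReal_iff (facMom_nonneg _ _)] at hn

end ConfTendsto

end RIG

end

theorem mainTheorem4 (k : ℕ) (hk : 1 ≤ k)
    (n₁ n₂ : ℕ → ℕ) [∀ n, NeZero (n₁ n)] [∀ n, NeZero (n₂ n)]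
    (hn₁ : Tendsto n₁ atTop atTop) (hn₂ : Tendsto n₂ atTop atTop)
    (β : ℝ≥0) (hβ : 0 < β)
    (hratio : Tendsto (fun n => (n₂ n : ℝ≥0) / (n₁ n : ℝ≥0)) atTop (𝓝 β))
    (μ : ∀ n, Measure (RIG.BipGraph (Fin (n₁ n)) (Fin (n₂ n))))
    [∀ n, IsProbabilityMeasure (μ n)]
    (D₁ D₂ : Measure ℕ) [IsProbabilityMeasure D₁] [IsProbabilityMeasure D₂]
    (hcase : RIG.ActiveCase k n₁ n₂ β μ D₁ D₂ ∨ RIG.PassiveCase k n₁ n₂ β μ D₁ D₂ ∨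
      (∃ ν₁ ν₂, RIG.InhomogCase k n₁ n₂ β μ D₁ D₂ ν₁ ν₂) ∨
      (∃ L, RIG.ConfCase k n₁ n₂ μ D₁ D₂ L)) :
    RIG.limitDegreeMoment D₁ D₂ k < ⊤ ∧
      Tendsto (fun n => RIG.degreeMoment (μ n) k) atTop
        (𝓝 (RIG.limitDegreeMoment D₁ D₂ k)) := by
  have hratio' : Tendsto (fun n => (n₂ n : ℝ) / n₁ n) atTop (𝓝 β) := by
    simpa using NNReal.tendsto_coe.2 hratio
  rcases hcase with h | h | ⟨ν₁, ν₂, h⟩ | ⟨L, h⟩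
  · exact h.tendsto hk hn₁ hn₂ hβ hratio'
  · exact h.tendsto hk hn₁ hn₂ hβ hratio'
  · exact h.tendsto hk hn₁ hn₂ hβ hratio'
  · exact h.tendsto hk hn₁ hn₂
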